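/- A graph means a finite directed multigraph $H=(V,E)$, loops and multiple edges allowed, of weight $|E|-|V|$. It is stable if every vertex has $\deg^-\ge 2$ and $\deg^+\ge 2$, and semistable if every vertex has $\deg^-\ge1$, $\deg^+\ge1$ and $\deg^-+\deg^+\ge3$. An edge $uv$ is contractible if $u\ne v$ and ($\deg^+(u)=1$ or $\deg^-(v)=1$). A semistable graph $H$ is stabilizable, with stabilization graph $G$, if successive contractions of finitely many contractible edges turn $H$ into a stable graph isomorphic to $G$. $\mathrm{Aut}(H)$ is the group of pairs of permutations of $V$ and of $E$ that are compatible with tails and heads. Every semistable graph $H$ is identified with a polynomial in the derivatives of a Kähler metric $g_{i\bar j}$ (with local potential $\Phi$, $g_{i\bar j}=\partial_i\partial_{\bar j}\Phi$) and in the entries of its inverse matrix: a vertex with outward half-edges labelled $a_1,\dots,a_r$ and inward half-edges labelled $\bar b_1,\dots,\bar b_s$ stands for $g_{a_1\bar b_1a_2\cdots a_r\bar b_2\cdots\bar b_s}=\partial_{a_1}\cdots\partial_{a_r}\partial_{\bar b_1}\cdots\partial_{\bar b_s}\Phi$, and every edge, with label $a$ at its tail and $\bar b$ at its head, stands for contraction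 with the inverse metric $g^{a\bar b}$; all labels are summed over $1,\dots,n$. It is evaluated at a point of an $n$-dimensional Kähler manifold in a holomorphic chart on which the metric has a potential. For a stable graph $G$, the canonical Weyl invariant $D(G)$ is the function of (Kähler metric in a chart, point of the chart) that is invariant under holomorphic changes of coordinates and equals $G$ at the center of every coordinate system that is normal to a sufficiently high order. Here, coordinates are normal to order $N$ at a point if there $g_{i\bar j}=\delta_{ij}$ and all purely holomorphic and all purely antiholomorphic derivatives of $g_{i\bar j}$ of orders $1,\dots,N$ vanish. **Theorem.** Let $G$ be a stable graph of weight $k$. There are only finitely many isomorphism classes of stabilizable semistable graphs of weight $k$ whose stabilization graph is $G$, and in every dimension $n\ge 0$ the invariant $D(G)$ exists, is unique, and is given by $$D(G)=\sum_{H}\frac{(-1)^{|V(H)|-|V(G)|}\,|\mathrm{Aut}(G)|}{|\mathrm{Aut}(H)|}\,H,$$ where $H$ runs over these isomorphism classes. -/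

import Mathlib

namespace WeylGraph

/-! ### Finite directed multigraphs -/

/-- A finite directed multigraph; loops and multiple edges are allowed. -/
structure MultiDigraph : Type 1 where
  V : Type
  E : Type
  [fintypeV : Fintype V]
  [fintypeE : Fintype E]
  src : E → V
  tgt : E → V

attribute [instance] MultiDigraph.fintypeV MultiDigraph.fintypeE

namespace MultiDigraph

/-- The outward degree: the number of edges with tail `v` (a loop counts once). -/
noncomputable def outDeg (G : MultiDigraph) (v : G.V) : ℕ := Nat.card {e : G.E // G.src e = v}

/-- The inward degree: the number of edges with head `v` (a loop counts once). -/
noncomputable def inDeg (G : MultiDigraph) (v : G.V) : ℕ := Nat.card {e : G.E // G.tgt e = v}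

/-- The weight `|E| - |V|`. -/
def weight (G : MultiDigraph) : ℤ := (Fintype.card G.E : ℤ) - (Fintype.card G.V : ℤ)

def Stable (G : MultiDigraph) : Prop := ∀ v, 2 ≤ G.inDeg v ∧ 2 ≤ G.outDeg v

def Semistable (G : MultiDigraph) : Prop :=
  ∀ v, 1 ≤ G.inDeg v ∧ 1 ≤ G.outDeg v ∧ 3 ≤ G.inDeg v + G.outDeg v

/-- An isomorphism consists of a bijection of the vertices and a bijection of the edges that are
compatible with tails and heads. -/
structure Iso (G H : MultiDigraph) where
  vertexEquiv : G.V ≃ H.V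
  edgeEquiv : G.E ≃ H.E
  src_map : ∀ e, H.src (edgeEquiv e) = vertexEquiv (G.src e)
  tgt_map : ∀ e, H.tgt (edgeEquiv e) = vertexEquiv (G.tgt e)

/-- `|Aut(G)|`. Automorphisms may permute parallel edges and loops. -/
noncomputable def autCard (G : MultiDigraph) : ℕ := Nat.card (Iso G G)

/-- The edge `e = uv` is contractible: `u ≠ v`, and `deg⁺(u) = 1` or `deg⁻(v) = 1`. -/
def Contractible (G : MultiDigraph) (e : G.E) : Prop :=
  G.src e ≠ G.tgt e ∧ (G.outDeg (G.src e) = 1 ∨ G.inDeg (G.tgt e) = 1)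

/-- `G'` is, up to isomorphism, the graph `G / e`: the edge `e` is removed, its two ends are
merged by the map `f` into one vertex, and nothing else changes. -/
def IsContraction (G : MultiDigraph) (e : G.E) (G' : MultiDigraph) : Prop :=
  ∃ (f : G.V → G'.V) (s : {e' : G.E // e' ≠ e} ≃ G'.E),
    Function.Surjective f ∧
    (∀ x y, f x = f y ↔
      x = y ∨ (x = G.src e ∧ y = G.tgt e) ∨ (x = G.tgt e ∧ y = G.src e)) ∧
    (∀ e', G'.src (s e') = f (G.src e')) ∧
    (∀ e', G'.tgt (s e') = f (G.tgt e'))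

/-- `G'` arises from `G` by contracting one contractible edge. -/
def ContractionStep (G G' : MultiDigraph) : Prop :=
  ∃ e : G.E, G.Contractible e ∧ G.IsContraction e G'

/-- `G` is the stabilization graph of `H`: it is stable, and isomorphic to a graph obtained from
`H` by contracting a finite number of contractible edges. -/
def IsStabilization (H G : MultiDigraph) : Prop :=
  G.Stable ∧ ∃ K, Relation.ReflTransGen ContractionStep H K ∧ Nonempty (Iso K G)

/-- The relation of being isomorphic. -/
instance isoSetoid : Setoid MultiDigraph where
  r G H := Nonempty (Iso G H)
  iseqv :=
    { refl := fun G => ⟨⟨Equiv.refl _, Equiv.refl _, fun _ => rfl, fun _ => rfl⟩⟩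
      symm := by
        rintro G H ⟨i⟩
        refine ⟨⟨i.vertexEquiv.symm, i.edgeEquiv.symm, fun e => ?_, fun e => ?_⟩⟩
        · rw [Equiv.eq_symm_apply, ← i.src_map, Equiv.apply_symm_apply]
        · rw [Equiv.eq_symm_apply, ← i.tgt_map, Equiv.apply_symm_apply]
      trans := by
        rintro G H K ⟨i⟩ ⟨j⟩
        refine ⟨⟨i.vertexEquiv.trans j.vertexEquiv, i.edgeEquiv.trans j.edgeEquiv,
          fun e => ?_, fun e => ?_⟩⟩
        · simp [i.src_map, j.src_map]
        · simp [i.tgt_map, j.tgt_map] }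

end MultiDigraph

/-- Isomorphism classes of finite directed multigraphs. -/
abbrev GraphClass : Type 1 := Quotient MultiDigraph.isoSetoid

/-- The isomorphism classes of the stabilizable semistable graphs of weight `k` whose
stabilization graph is `G`. -/
def stabilizableClasses (G : MultiDigraph) (k : ℤ) : Set GraphClass :=
  {c | ∃ H : MultiDigraph, Quotient.mk _ H = c ∧
    H.Semistable ∧ H.weight = k ∧ H.IsStabilization G}

/-! ### Kähler metrics in local coordinates -/

/-- The Wirtinger derivative `∂f/∂zᵢ = (∂f/∂xᵢ - √-1 ∂f/∂yᵢ)/2`. -/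
noncomputable def dz {n : ℕ} (i : Fin n) (f : (Fin n → ℂ) → ℂ) : (Fin n → ℂ) → ℂ :=
  fun x => (fderiv ℝ f x (Pi.single i 1) - Complex.I * fderiv ℝ f x (Pi.single i Complex.I)) / 2

/-- The Wirtinger derivative `∂f/∂z̄ᵢ = (∂f/∂xᵢ + √-1 ∂f/∂yᵢ)/2`. -/
noncomputable def dzbar {n : ℕ} (i : Fin n) (f : (Fin n → ℂ) → ℂ) : (Fin n → ℂ) → ℂ :=
  fun x => (fderiv ℝ f x (Pi.single i 1) + Complex.I * fderiv ℝ f x (Pi.single i Complex.I)) / 2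

/-- The iterated derivative `∂^α ∂̄^β f` for multi-indices `α` and `β`. -/
noncomputable def mixedDeriv {n : ℕ} (α β : Fin n → ℕ) (f : (Fin n → ℂ) → ℂ) :
    (Fin n → ℂ) → ℂ :=
  (List.finRange n).foldr (fun i h => (dz i)^[α i] h)
    ((List.finRange n).foldr (fun j h => (dzbar j)^[β j] h) f)

/-- The complex Hessian `(∂²Φ/∂zᵢ∂z̄ⱼ)` of a real function. -/
noncomputable def complexHessian {n : ℕ} (Φ : (Fin n → ℂ) → ℝ) (x : Fin n → ℂ) :
    Matrix (Fin n) (Fin n) ℂ :=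
  Matrix.of fun i j => dz i (dzbar j fun y => (Φ y : ℂ)) x

open scoped ComplexOrder in
/-- A coordinate chart of an `n`-dimensional Kähler manifold, with a base point, on which the
metric `g` has a Kähler potential: `g i j = ∂²Φ/∂zᵢ∂z̄ⱼ` (every Kähler metric has such charts
around each point, in every holomorphic coordinate system). -/
structure KahlerChart (n : ℕ) where
  dom : Set (Fin n → ℂ)
  isOpen_dom : IsOpen dom
  pt : Fin n → ℂ
  pt_mem : pt ∈ dom
  potential : (Fin n → ℂ) → ℝ
  smooth : ContDiffOn ℝ (⊤ : ℕ∞) potential dom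
  posDef : ∀ x ∈ dom, (complexHessian potential x).PosDef

namespace KahlerChart

variable {n : ℕ}

/-- The metric tensor: the entry `i j` is `g_{i j̄}`. -/
noncomputable def metric (M : KahlerChart n) (x : Fin n → ℂ) : Matrix (Fin n) (Fin n) ℂ :=
  complexHessian M.potential x

/-- `φ` is a change of coordinates that carries the base point and the metric of `M'` to those of
`M`: an injective holomorphic map with
`g'_{i j̄}(x) = ∑ g_{p q̄}(φ(x)) (∂ᵢφ_p) (conj (∂ⱼφ_q))`. -/
structure IsCoordinateChange (M' M : KahlerChart n) (φ : (Fin n → ℂ) → (Fin n → ℂ)) : Prop where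
  mapsTo : Set.MapsTo φ M'.dom M.dom
  holomorphic : DifferentiableOn ℂ φ M'.dom
  injective : Set.InjOn φ M'.dom
  map_pt : φ M'.pt = M.pt
  pullback : ∀ x ∈ M'.dom, ∀ i j, M'.metric x i j =
    ∑ p, ∑ q, M.metric (φ x) p q * fderiv ℂ φ x (Pi.single i 1) p *
      (starRingEnd ℂ) (fderiv ℂ φ x (Pi.single j 1) q)

/-- The coordinates are (Kähler) normal to order `N` with the base point as center: there
`g_{i j̄} = δ_{i j}`, and the purely holomorphic and the purely antiholomorphic derivatives of
`g_{i j̄}` of the orders `1, …, N` vanish. -/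
def IsNormal (M : KahlerChart n) (N : ℕ) : Prop :=
  M.metric M.pt = 1 ∧
    ∀ i j, ∀ α : Fin n → ℕ, 1 ≤ ∑ l, α l → ∑ l, α l ≤ N →
      mixedDeriv α 0 (fun x => M.metric x i j) M.pt = 0 ∧
      mixedDeriv 0 α (fun x => M.metric x i j) M.pt = 0

end KahlerChart

open Classical in
/-- The value at the base point of the polynomial in the derivatives of the metric that the graph
`H` encodes. Every edge `e` carries an unbarred index `a e` at its tail and a barred index `b e` at
its head. A vertex stands for the partial derivative of the metric in the indices of its outward
(unbarred) and inward (barred) half-edges, which is the corresponding derivative of the potential,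
and every edge stands for the contraction with the inverse metric. -/
noncomputable def MultiDigraph.eval {n : ℕ} (H : MultiDigraph) (M : KahlerChart n) : ℂ :=
  ∑ a : H.E → Fin n, ∑ b : H.E → Fin n,
    (∏ e, (M.metric M.pt)⁻¹ (b e) (a e)) *
      ∏ v, mixedDeriv
        (fun i => Nat.card {e : H.E // H.src e = v ∧ a e = i})
        (fun j => Nat.card {e : H.E // H.tgt e = v ∧ b e = j})
        (fun x => (M.potential x : ℂ)) M.pt

/-- `F` is the canonical Weyl invariant `D(G)` in dimension `n`: it is invariant under changes of
coordinates, and it agrees with `G` at the center of every normal coordinate system (normal to a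
sufficiently high order). -/
def IsCanonicalInvariant {n : ℕ} (G : MultiDigraph) (F : KahlerChart n → ℂ) : Prop :=
  (∀ (M' M : KahlerChart n) (φ : (Fin n → ℂ) → (Fin n → ℂ)),
    M'.IsCoordinateChange M φ → F M' = F M) ∧
  ∃ N : ℕ, ∀ M : KahlerChart n, M.IsNormal N → F M = G.eval M

/-- The coefficient `(-1)^{|V(H)|-|V(G)|} |Aut(G)| / |Aut(H)|`. -/
noncomputable def coefficient (G H : MultiDigraph) : ℂ :=
  (-1) ^ ((Fintype.card H.V : ℤ) - (Fintype.card G.V : ℤ)) *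
    (G.autCard : ℂ) / (H.autCard : ℂ)

end WeylGraph

/-! The formula comes from a telescoping cancellation over graphs. A change of coordinates φ is
joined to its affine part at the base point by the path φ_t(w) = p + L(w - p') + t h(w), where h
vanishes to second order. Along the path the jet of the pulled back potential evolves by the Leibniz
expansion of ξ·∂ + ξ̄·∂̄, where ξ = (Dφ_t)⁻¹ h (`timeDeriv_path`, `hasDerivAt_path`). The
derivatives of ξ of order below 2 vanish at the base point. So the metric there stays fixed, and the
variation of a graph is a sum over a vertex v and a set R of at least two of its outward edges,
whose derivatives fall on ξ, plus the conjugate sum over inward edges.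

Such a term of H is also a term of the graph H' in which the tails of R are moved to a new vertex,
reached from v by a new edge. If all outward derivatives of the new vertex fall on ξ, a factor g
remains there, and the inverse metric on the new edge cancels it (`splitTerm_splitGraph`). H' has
one vertex more, hence the opposite sign. It is semistable with the same stabilization, unless v has
a single inward edge and R is all of its outward edges; these exceptional terms are exactly those
that arise from a graph with one vertex less. That splitting respects the stabilization rests on the
confluence of contractions (`stabilization_of_lone`).

The factors 1/|Aut H| are handled by summing over labelled graphs with m vertices and m + k edges,
with weight (-1)^m / (m! (m+k)!). The exceptional terms with m + 1 vertices are then (m+1)(m+k+1)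
copies of the other terms with m vertices, one for each choice of the new vertex and edge, and the
sum over m telescopes (`sum_outVar_eq_zero`). It terminates because 3|V| ≤ 2|E| forces |V| ≤ 2k;
this also gives the finiteness of the set of classes. The affine end of the path is harmless, since
graphs are tensor contractions (`jetEval_comp_affine`). Thus the sum is invariant.

In coordinates normal to high order a semistable graph that is not stable vanishes, because it has a
vertex with a single inward or a single outward edge and at least two edges of the other kind. The
only stable graph with stabilization G is G, with coefficient 1. So the sum is a canonical
invariant. Conversely, every chart is connected to normal ones (`exists_normal_chart`), where the
value of a canonical invariant is prescribed, and this gives uniqueness. -/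

namespace WeylGraph

open Set Filter Topology

/-! ### Iterated complex directional derivatives -/

section Calculus

variable {X : Type*} [NormedAddCommGroup X] [NormedSpace ℝ X]

/-- The complex combination `(∂_u f + c ∂_v f) / 2` of two directional derivatives. -/
noncomputable def dirD (w : X × X × ℂ) (f : X → ℂ) : X → ℂ :=
  fun x => (fderiv ℝ f x w.1 + w.2.2 * fderiv ℝ f x w.2.1) / 2

theorem dirD_congr {U : Set X} (hU : IsOpen U) (w : X × X × ℂ) {f g : X → ℂ} (h : EqOn f g U) :
    EqOn (dirD w f) (dirD w g) U := by
  intro x hx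
  have : f =ᶠ[𝓝 x] g := by filter_upwards [hU.mem_nhds hx] with y hy using h hy
  simp only [dirD, this.fderiv_eq]

theorem smooth_differentiableAt {Y : Type*} [NormedAddCommGroup Y] [NormedSpace ℝ Y]
    {U : Set X} (hU : IsOpen U) {f : X → Y}
    (hf : ContDiffOn ℝ (⊤ : ℕ∞) f U) {x : X} (hx : x ∈ U) : DifferentiableAt ℝ f x :=
  (hf.contDiffAt (hU.mem_nhds hx)).differentiableAt (by simp)

theorem smooth_fderiv {Y : Type*} [NormedAddCommGroup Y] [NormedSpace ℝ Y]
    {U : Set X} (hU : IsOpen U) {f : X → Y}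
    (hf : ContDiffOn ℝ (⊤ : ℕ∞) f U) : ContDiffOn ℝ (⊤ : ℕ∞) (fderiv ℝ f) U :=
  hf.fderiv_of_isOpen hU (by simp)

theorem dirD_smooth {U : Set X} (hU : IsOpen U) (w : X × X × ℂ) {f : X → ℂ}
    (hf : ContDiffOn ℝ (⊤ : ℕ∞) f U) : ContDiffOn ℝ (⊤ : ℕ∞) (dirD w f) U := by
  have h := smooth_fderiv hU hf
  unfold dirD
  exact ((h.clm_apply contDiffOn_const).add
    (contDiffOn_const.mul (h.clm_apply contDiffOn_const))).div_const _

theorem dirD_add {U : Set X} (hU : IsOpen U) (w : X × X × ℂ) {f g : X → ℂ}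
    (hf : ContDiffOn ℝ (⊤ : ℕ∞) f U) (hg : ContDiffOn ℝ (⊤ : ℕ∞) g U) :
    EqOn (dirD w (fun x => f x + g x)) (fun x => dirD w f x + dirD w g x) U := by
  intro x hx
  have := fderiv_fun_add (smooth_differentiableAt hU hf hx) (smooth_differentiableAt hU hg hx)
  simp only [dirD, this, add_apply]
  ring

theorem dirD_mul {U : Set X} (hU : IsOpen U) (w : X × X × ℂ) {f g : X → ℂ}
    (hf : ContDiffOn ℝ (⊤ : ℕ∞) f U) (hg : ContDiffOn ℝ (⊤ : ℕ∞) g U) :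
    EqOn (dirD w (fun x => f x * g x)) (fun x => dirD w f x * g x + f x * dirD w g x) U := by
  intro x hx
  have := fderiv_fun_mul (smooth_differentiableAt hU hf hx) (smooth_differentiableAt hU hg hx)
  simp only [dirD, this, add_apply, smul_apply, smul_eq_mul]
  ring

theorem dirD_const (w : X × X × ℂ) (c : ℂ) : dirD w (fun _ : X => c) = fun _ => 0 := by
  ext x
  simp [dirD]

theorem dirD_const_mul {U : Set X} (hU : IsOpen U) (w : X × X × ℂ) (c : ℂ) {f : X → ℂ}
    (hf : ContDiffOn ℝ (⊤ : ℕ∞) f U) :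
    EqOn (dirD w (fun x => c * f x)) (fun x => c * dirD w f x) U := by
  intro x hx
  rw [dirD_mul hU w contDiffOn_const hf hx, dirD_const]
  simp

theorem fderiv_fderiv_apply {U : Set X} (hU : IsOpen U) {f : X → ℂ}
    (hf : ContDiffOn ℝ (⊤ : ℕ∞) f U) {x : X} (hx : x ∈ U) (u v : X) :
    fderiv ℝ (fun y => fderiv ℝ f y u) x v = fderiv ℝ (fderiv ℝ f) x v u := by
  have h := smooth_differentiableAt hU (smooth_fderiv hU hf) hx
  rw [fderiv_clm_apply h (differentiableAt_const u)]
  simp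

theorem dirD_dirD_apply {U : Set X} (hU : IsOpen U) (w w' : X × X × ℂ) {f : X → ℂ}
    (hf : ContDiffOn ℝ (⊤ : ℕ∞) f U) {x : X} (hx : x ∈ U) :
    dirD w (dirD w' f) x =
      (fderiv ℝ (fderiv ℝ f) x w.1 w'.1 + w'.2.2 * fderiv ℝ (fderiv ℝ f) x w.1 w'.2.1 +
        w.2.2 * (fderiv ℝ (fderiv ℝ f) x w.2.1 w'.1 +
          w'.2.2 * fderiv ℝ (fderiv ℝ f) x w.2.1 w'.2.1)) / 4 := by
  have h := smooth_differentiableAt hU (smooth_fderiv hU hf) hx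
  have h1 : ∀ u, DifferentiableAt ℝ (fun y => fderiv ℝ f y u) x :=
    fun u => h.clm_apply (differentiableAt_const u)
  have key : fderiv ℝ (dirD w' f) x = (1 / 2 : ℂ) • (fderiv ℝ (fun y => fderiv ℝ f y w'.1) x +
      w'.2.2 • fderiv ℝ (fun y => fderiv ℝ f y w'.2.1) x) := by
    have e : dirD w' f = fun y => (1 / 2 : ℂ) * (fderiv ℝ f y w'.1 +
        w'.2.2 * fderiv ℝ f y w'.2.1) := by
      ext y; simp only [dirD]; ring
    rw [e, fderiv_const_mul, fderiv_fun_add (h1 _) ((h1 _).const_mul _), fderiv_const_mul (h1 _)]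
    exact (h1 _).add ((h1 _).const_mul _)
  have hk : ∀ z, fderiv ℝ (dirD w' f) x z = (1 / 2 : ℂ) * (fderiv ℝ (fderiv ℝ f) x z w'.1 +
      w'.2.2 * fderiv ℝ (fderiv ℝ f) x z w'.2.1) := by
    intro z
    rw [key]
    simp only [smul_apply, add_apply, smul_eq_mul,
      fderiv_fderiv_apply hU hf hx]
  rw [dirD, hk, hk]
  ring

theorem dirD_comm {U : Set X} (hU : IsOpen U) (w w' : X × X × ℂ) {f : X → ℂ}
    (hf : ContDiffOn ℝ (⊤ : ℕ∞) f U) :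
    EqOn (dirD w (dirD w' f)) (dirD w' (dirD w f)) U := by
  intro x hx
  have hs : IsSymmSndFDerivAt ℝ f x :=
    (hf.contDiffAt (hU.mem_nhds hx)).isSymmSndFDerivAt
      (by simpa using WithTop.coe_le_coe.mpr (le_top : (2 : ℕ∞) ≤ ⊤))
  rw [dirD_dirD_apply hU w w' hf hx, dirD_dirD_apply hU w' w hf hx, hs w.1 w'.1, hs w.1 w'.2.1,
    hs w.2.1 w'.1, hs w.2.1 w'.2.1]
  ring

/-- Linear operators on functions that are local, preserve smoothness on `U`, and commute with all
constant-coefficient derivations. -/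
structure LocalOp (U : Set X) (T : (X → ℂ) → X → ℂ) : Prop where
  congr : ∀ f g, EqOn f g U → EqOn (T f) (T g) U
  smooth : ∀ f, ContDiffOn ℝ (⊤ : ℕ∞) f U → ContDiffOn ℝ (⊤ : ℕ∞) (T f) U
  add : ∀ f g, ContDiffOn ℝ (⊤ : ℕ∞) f U → ContDiffOn ℝ (⊤ : ℕ∞) g U →
    EqOn (T (fun x => f x + g x)) (fun x => T f x + T g x) U
  const_mul : ∀ (c : ℂ) f, ContDiffOn ℝ (⊤ : ℕ∞) f U →
    EqOn (T (fun x => c * f x)) (fun x => c * T f x) U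
  comm : ∀ w f, ContDiffOn ℝ (⊤ : ℕ∞) f U → EqOn (T (dirD w f)) (dirD w (T f)) U

namespace LocalOp

variable {U : Set X}

theorem id : LocalOp U id :=
  ⟨fun _ _ h => h, fun _ h => h, fun _ _ _ _ _ _ => rfl, fun _ _ _ _ _ => rfl,
    fun _ _ _ _ _ => rfl⟩

theorem dirD (hU : IsOpen U) (w : X × X × ℂ) : LocalOp U (dirD w) :=
  ⟨fun _ _ h => dirD_congr hU w h, fun _ h => dirD_smooth hU w h,
    fun _ _ hf hg => dirD_add hU w hf hg, fun c _ hf => dirD_const_mul hU w c hf,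
    fun w' _ hf => dirD_comm hU w w' hf⟩

theorem comp (hU : IsOpen U) {S T : (X → ℂ) → X → ℂ} (hS : LocalOp U S) (hT : LocalOp U T) :
    LocalOp U (fun f => S (T f)) where
  congr f g h := hS.congr _ _ (hT.congr _ _ h)
  smooth f h := hS.smooth _ (hT.smooth _ h)
  add f g hf hg := (hS.congr _ _ (hT.add f g hf hg)).trans
    (hS.add _ _ (hT.smooth _ hf) (hT.smooth _ hg))
  const_mul c f hf := (hS.congr _ _ (hT.const_mul c f hf)).trans
    (hS.const_mul c _ (hT.smooth _ hf))
  comm w f hf := (hS.congr _ _ (hT.comm w f hf)).trans (hS.comm w _ (hT.smooth _ hf))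

theorem iterate (hU : IsOpen U) {T : (X → ℂ) → X → ℂ} (hT : LocalOp U T) (k : ℕ) :
    LocalOp U (T^[k]) := by
  induction k with
  | zero => exact LocalOp.id
  | succ k ih => rw [Function.iterate_succ]; exact ih.comp hU hT

theorem foldr (hU : IsOpen U) {ι : Type*} {T : ι → (X → ℂ) → X → ℂ} (hT : ∀ i, LocalOp U (T i))
    (l : List ι) : LocalOp U (fun f => l.foldr T f) := by
  induction l with
  | nil => exact LocalOp.id
  | cons i l ih => exact (hT i).comp hU ih

theorem zero {T : (X → ℂ) → X → ℂ} (hT : LocalOp U T) {f : X → ℂ} (hf : EqOn f (fun _ => 0) U) :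
    EqOn (T f) (fun _ => 0) U := by
  intro x hx
  have h1 : T f x = T (fun _ => (0 : ℂ) * 0) x := hT.congr _ _ (fun y hy => by simp [hf hy]) hx
  rw [h1, hT.const_mul 0 (fun _ => 0) contDiffOn_const hx]
  simp

theorem sum {T : (X → ℂ) → X → ℂ} (hT : LocalOp U T) {ι : Type*} (s : Finset ι)
    (f : ι → X → ℂ) (hf : ∀ i ∈ s, ContDiffOn ℝ (⊤ : ℕ∞) (f i) U) :
    EqOn (T (fun x => ∑ i ∈ s, f i x)) (fun x => ∑ i ∈ s, T (f i) x) U := by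
  classical
  induction s using Finset.induction_on with
  | empty => simpa using! hT.zero (f := fun _ => 0) (fun _ _ => rfl)
  | insert i s hi ih =>
    intro x hx
    simp only [Finset.sum_insert hi]
    rw [hT.add (f i) (fun x => ∑ i ∈ s, f i x) (hf i (by simp))
      (ContDiffOn.sum fun j hj => hf j (by simp [hj])) hx]
    simp only [ih (fun j hj => hf j (by simp [hj])) hx]

end LocalOp

variable {n : ℕ}

/-- Iterated derivatives along two families of complex directions. -/
noncomputable def mixedD (w w' : Fin n → X × X × ℂ) (α β : Fin n → ℕ) (f : X → ℂ) : X → ℂ :=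
  (List.finRange n).foldr (fun i h => (dirD (w i))^[α i] h)
    ((List.finRange n).foldr (fun j h => (dirD (w' j))^[β j] h) f)

theorem localOp_foldr {U : Set X} (hU : IsOpen U) (w : Fin n → X × X × ℂ) (α : Fin n → ℕ)
    (l : List (Fin n)) : LocalOp U (fun f => l.foldr (fun i h => (dirD (w i))^[α i] h) f) :=
  LocalOp.foldr hU (fun i => (LocalOp.dirD hU (w i)).iterate hU (α i)) l

theorem localOp_mixedD {U : Set X} (hU : IsOpen U) (w w' : Fin n → X × X × ℂ) (α β : Fin n → ℕ) :
    LocalOp U (mixedD w w' α β) :=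
  (localOp_foldr hU w α _).comp hU (localOp_foldr hU w' β _)

theorem foldr_congr_of_notMem (w : Fin n → X × X × ℂ) (α : Fin n → ℕ) (i : Fin n)
    (l : List (Fin n)) (hi : i ∉ l) (f : X → ℂ) :
    l.foldr (fun j h => (dirD (w j))^[(α + Pi.single i 1 : Fin n → ℕ) j] h) f =
      l.foldr (fun j h => (dirD (w j))^[α j] h) f := by
  induction l with
  | nil => rfl
  | cons j l ih =>
    simp only [List.mem_cons, not_or] at hi
    have : (Pi.single i 1 : Fin n → ℕ) j = 0 := by simp [Ne.symm hi.1]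
    rw [List.foldr_cons, List.foldr_cons, ih hi.2]
    simp only [Pi.add_apply, this, add_zero]

/-- The additional derivative first appears inside the block of index `i`. It moves to the front
because the blocks of the other indices are local operators, which commute with every `dirD`. -/
theorem foldr_add_single {U : Set X} (hU : IsOpen U) (w : Fin n → X × X × ℂ) (α : Fin n → ℕ)
    (i : Fin n) (l : List (Fin n)) (hl : l.Nodup) (hi : i ∈ l) {f : X → ℂ}
    (hf : ContDiffOn ℝ (⊤ : ℕ∞) f U) :
    EqOn (l.foldr (fun j h => (dirD (w j))^[(α + Pi.single i 1 : Fin n → ℕ) j] h) f)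
      (dirD (w i) (l.foldr (fun j h => (dirD (w j))^[α j] h) f)) U := by
  induction l with
  | nil => simp at hi
  | cons j l ih =>
    simp only [List.foldr_cons]
    rw [List.nodup_cons] at hl
    by_cases hij : i = j
    · subst hij
      rw [foldr_congr_of_notMem w α i l hl.1]
      simp only [Pi.add_apply, Pi.single_eq_same, Function.iterate_succ_apply']
      exact fun _ _ => rfl
    · have hi' : i ∈ l := by simpa [hij] using hi
      have h0 : (Pi.single i 1 : Fin n → ℕ) j = 0 := by simp [Ne.symm hij]
      simp only [Pi.add_apply, h0, add_zero]
      have hop := (LocalOp.dirD hU (w j)).iterate hU (α j)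
      exact (hop.congr _ _ (ih hl.2 hi')).trans
        (hop.comm _ _ ((localOp_foldr hU w α l).smooth _ hf))

theorem mixedD_zero (w w' : Fin n → X × X × ℂ) (f : X → ℂ) : mixedD w w' 0 0 f = f := by
  have : ∀ (v : Fin n → X × X × ℂ) (l : List (Fin n)) (g : X → ℂ),
      l.foldr (fun i h => (dirD (v i))^[(0 : Fin n → ℕ) i] h) g = g := by
    intro v l g
    induction l with
    | nil => rfl
    | cons i l ih => simp
  rw [mixedD, this, this]

theorem mixedD_add_left {U : Set X} (hU : IsOpen U) (w w' : Fin n → X × X × ℂ) (α β : Fin n → ℕ)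
    (i : Fin n) {f : X → ℂ} (hf : ContDiffOn ℝ (⊤ : ℕ∞) f U) :
    EqOn (mixedD w w' (α + Pi.single i 1) β f) (dirD (w i) (mixedD w w' α β f)) U :=
  foldr_add_single hU w α i _ (List.nodup_finRange n) (List.mem_finRange i)
    ((localOp_foldr hU w' β _).smooth _ hf)

theorem mixedD_add_right {U : Set X} (hU : IsOpen U) (w w' : Fin n → X × X × ℂ) (α β : Fin n → ℕ)
    (i : Fin n) {f : X → ℂ} (hf : ContDiffOn ℝ (⊤ : ℕ∞) f U) :
    EqOn (mixedD w w' α (β + Pi.single i 1) f) (dirD (w' i) (mixedD w w' α β f)) U :=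
  ((localOp_foldr hU w α _).congr _ _ (foldr_add_single hU w' β i _ (List.nodup_finRange n)
    (List.mem_finRange i) hf)).trans
    ((localOp_foldr hU w α _).comm _ _ ((localOp_foldr hU w' β _).smooth _ hf))

/-- Here the additional derivative is applied first. This form suits inductions in which the
function is replaced by one of its derivatives. -/
theorem mixedD_add_left' {U : Set X} (hU : IsOpen U) (w w' : Fin n → X × X × ℂ) (α β : Fin n → ℕ)
    (i : Fin n) {f : X → ℂ} (hf : ContDiffOn ℝ (⊤ : ℕ∞) f U) :
    EqOn (mixedD w w' (α + Pi.single i 1) β f) (mixedD w w' α β (dirD (w i) f)) U :=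
  (mixedD_add_left hU w w' α β i hf).trans ((localOp_mixedD hU w w' α β).comm _ _ hf).symm

theorem mixedD_add_right' {U : Set X} (hU : IsOpen U) (w w' : Fin n → X × X × ℂ)
    (α β : Fin n → ℕ) (i : Fin n) {f : X → ℂ} (hf : ContDiffOn ℝ (⊤ : ℕ∞) f U) :
    EqOn (mixedD w w' α (β + Pi.single i 1) f) (mixedD w w' α β (dirD (w' i) f)) U :=
  (mixedD_add_right hU w w' α β i hf).trans ((localOp_mixedD hU w w' α β).comm _ _ hf).symm

/-- Induction on multi-indices, adding one unit at a time. -/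
theorem multiIndex_induction {P : (Fin n → ℕ) → Prop} (zero : P 0)
    (add : ∀ α i, P α → P (α + Pi.single i 1)) (α : Fin n → ℕ) : P α := by
  have : ∀ N (α : Fin n → ℕ), ∑ i, α i = N → P α := by
    intro N
    induction N with
    | zero =>
      intro α h
      have : α = 0 := by
        ext i
        simpa using (Finset.sum_eq_zero_iff.mp h) i (Finset.mem_univ i)
      exact this ▸ zero
    | succ N ih =>
      intro α h
      obtain ⟨i, hi⟩ : ∃ i, α i ≠ 0 := by
        by_contra! hc
        simp [hc] at h
      have hα : α = (α - Pi.single i 1) + Pi.single i 1 := by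
        ext j
        by_cases hj : j = i
        · subst hj; simp; omega
        · simp [hj]
      rw [hα]
      refine add _ i (ih _ ?_)
      rw [hα] at h
      simp only [Pi.add_apply, Finset.sum_add_distrib, Finset.sum_pi_single', Finset.mem_univ,
        if_true] at h
      exact Nat.succ_injective h
  exact this _ α rfl

/-- Carries statements about the first family of directions over to the second; the barred half of
the Leibniz expansion is reduced to the unbarred one in this way. -/
theorem mixedD_swap {U : Set X} (hU : IsOpen U) (w w' : Fin n → X × X × ℂ) (α β : Fin n → ℕ)
    {f : X → ℂ} (hf : ContDiffOn ℝ (⊤ : ℕ∞) f U) :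
    EqOn (mixedD w w' α β f) (mixedD w' w β α f) U := by
  induction α using multiIndex_induction with
  | zero =>
    induction β using multiIndex_induction with
    | zero => simp only [mixedD_zero]; exact fun _ _ => rfl
    | add β i ih =>
      exact (mixedD_add_right hU w w' _ _ i hf).trans
        ((dirD_congr hU _ ih).trans (mixedD_add_left hU w' w _ _ i hf).symm)
  | add α i ih =>
    exact (mixedD_add_left hU w w' _ _ i hf).trans
      ((dirD_congr hU _ ih).trans (mixedD_add_right hU w' w _ _ i hf).symm)

/-! ### Multi-indices counted over finite sets, and the Leibniz rule -/

/-- The multi-index that counts the values of `a` on `S`. -/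
def cnt {ε : Type*} (S : Finset ε) (a : ε → Fin n) : Fin n → ℕ := ∑ s ∈ S, Pi.single (a s) 1

@[simp] theorem cnt_empty {ε : Type*} (a : ε → Fin n) : cnt ∅ a = 0 := rfl

theorem cnt_insert {ε : Type*} [DecidableEq ε] {S : Finset ε} {s : ε} (hs : s ∉ S)
    (a : ε → Fin n) : cnt (insert s S) a = cnt S a + Pi.single (a s) 1 := by
  rw [cnt, Finset.sum_insert hs, add_comm]; rfl

theorem cnt_singleton {ε : Type*} (s : ε) (a : ε → Fin n) : cnt {s} a = Pi.single (a s) 1 := by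
  simp [cnt]

theorem cnt_apply {ε : Type*} (S : Finset ε) (a : ε → Fin n) (i : Fin n) :
    cnt S a i = (S.filter (fun s => a s = i)).card := by
  simp only [cnt, Finset.sum_apply, Finset.card_filter, Pi.single_apply]
  exact Finset.sum_congr rfl fun s _ => by simp only [eq_comm]

theorem sum_cnt {ε : Type*} (S : Finset ε) (a : ε → Fin n) : ∑ i, cnt S a i = S.card := by
  simp only [cnt, Finset.sum_apply]
  rw [Finset.sum_comm]
  simp [Finset.sum_pi_single']

theorem exists_cnt (γ : Fin n → ℕ) : ∃ (m : ℕ) (a : Fin m → Fin n), γ = cnt Finset.univ a := by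
  classical
  induction γ using multiIndex_induction with
  | zero => exact ⟨0, Fin.elim0, rfl⟩
  | add γ i ih =>
    obtain ⟨m, a, rfl⟩ := ih
    refine ⟨m + 1, Fin.snoc a i, ?_⟩
    simp [cnt, Fin.sum_univ_castSucc]

/-- With derivatives indexed by a set of labels, a distribution over the two factors is a subset,
and no multinomial coefficients occur. Each new label falls either on `f` (subsets of `S`) or on `ξ`
(subsets that contain the label). -/
theorem leibniz_left {U : Set X} (hU : IsOpen U) (w w' : Fin n → X × X × ℂ) {ε : Type*}
    [DecidableEq ε] (S : Finset ε) (a : ε → Fin n) {x : X} (hx : x ∈ U) :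
    ∀ {ξ f : X → ℂ}, ContDiffOn ℝ (⊤ : ℕ∞) ξ U → ContDiffOn ℝ (⊤ : ℕ∞) f U →
    mixedD w w' (cnt S a) 0 (fun x => ξ x * f x) x =
      ∑ R ∈ S.powerset, mixedD w w' (cnt R a) 0 ξ x * mixedD w w' (cnt (S \ R) a) 0 f x := by
  induction S using Finset.induction_on with
  | empty => intro ξ f _ _; simp [mixedD_zero]
  | insert s S hs ih =>
    intro ξ f hξ hf
    have h1 : ∀ {g : X → ℂ} (R : Finset ε), R ⊆ S → ContDiffOn ℝ (⊤ : ℕ∞) g U →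
        mixedD w w' (cnt (insert s R) a) 0 g x = mixedD w w' (cnt R a) 0 (dirD (w (a s)) g) x := by
      intro g R hR hg
      rw [cnt_insert (fun h => hs (hR h))]
      exact mixedD_add_left' hU w w' _ _ _ hg hx
    rw [h1 S subset_rfl (hξ.mul hf),
      (localOp_mixedD hU w w' _ _).congr _ _ (dirD_mul hU _ hξ hf) hx,
      (localOp_mixedD hU w w' _ _).add _ _ ((dirD_smooth hU _ hξ).mul hf)
        (hξ.mul (dirD_smooth hU _ hf)) hx]
    beta_reduce
    rw [ih (dirD_smooth hU _ hξ) hf,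
      ih hξ (dirD_smooth hU _ hf), Finset.sum_powerset_insert hs, add_comm]
    congr 1
    · refine Finset.sum_congr rfl fun R hR => ?_
      have hR := Finset.mem_powerset.mp hR
      rw [Finset.insert_sdiff_of_notMem _ (fun h => hs (hR h)), h1 _ Finset.sdiff_subset hf]
    · refine Finset.sum_congr rfl fun R hR => ?_
      have hR := Finset.mem_powerset.mp hR
      rw [h1 R hR hξ]
      congr 3
      ext i
      simp only [Finset.mem_sdiff, Finset.mem_insert]
      grind

/-- The second family of derivations kills `ξ`, so all of `β` falls on `f`. This is the situation of
a holomorphic field and barred derivatives. -/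
theorem leibniz {U : Set X} (hU : IsOpen U) (w w' : Fin n → X × X × ℂ) {ε : Type*}
    [DecidableEq ε] (S : Finset ε) (a : ε → Fin n) (β : Fin n → ℕ) {x : X} (hx : x ∈ U)
    {ξ f : X → ℂ} (hξ : ContDiffOn ℝ (⊤ : ℕ∞) ξ U) (hf : ContDiffOn ℝ (⊤ : ℕ∞) f U)
    (h0 : ∀ j, EqOn (dirD (w' j) ξ) (fun _ => 0) U) :
    mixedD w w' (cnt S a) β (fun x => ξ x * f x) x =
      ∑ R ∈ S.powerset, mixedD w w' (cnt R a) 0 ξ x * mixedD w w' (cnt (S \ R) a) β f x := by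
  induction β using multiIndex_induction generalizing f with
  | zero => exact leibniz_left hU w w' S a hx hξ hf
  | add β j ih =>
    have h1 : EqOn (dirD (w' j) (fun x => ξ x * f x)) (fun x => ξ x * dirD (w' j) f x) U := by
      intro y hy
      simp [dirD_mul hU _ hξ hf hy, h0 j hy]
    rw [mixedD_add_right' hU w w' _ _ _ (hξ.mul hf) hx,
      (localOp_mixedD hU w w' _ _).congr _ _ h1 hx, ih (dirD_smooth hU _ hf)]
    refine Finset.sum_congr rfl fun R _ => ?_
    rw [mixedD_add_right' hU w w' _ _ _ hf hx]

/-- The family of directions whose derivations are the complex conjugates. -/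
def conjDir (w : Fin n → X × X × ℂ) : Fin n → X × X × ℂ :=
  fun i => ((w i).1, (w i).2.1, (starRingEnd ℂ) (w i).2.2)

theorem dirD_conj {U : Set X} (hU : IsOpen U) (w : Fin n → X × X × ℂ) (i : Fin n)
    {f : X → ℂ} (hf : ContDiffOn ℝ (⊤ : ℕ∞) f U) :
    EqOn (dirD (conjDir w i) (fun x => (starRingEnd ℂ) (f x)))
      (fun x => (starRingEnd ℂ) (dirD (w i) f x)) U := by
  intro x hx
  have h := (Complex.conjCLE.toContinuousLinearMap.hasFDerivAt.comp x
    (smooth_differentiableAt hU hf hx).hasFDerivAt).fderiv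
  have h' : fderiv ℝ (fun x => (starRingEnd ℂ) (f x)) x =
      Complex.conjCLE.toContinuousLinearMap.comp (fderiv ℝ f x) := h
  simp only [dirD, conjDir, h', map_div₀, map_add, map_mul, map_ofNat]
  rfl

theorem smooth_conj {U : Set X} {f : X → ℂ} (hf : ContDiffOn ℝ (⊤ : ℕ∞) f U) :
    ContDiffOn ℝ (⊤ : ℕ∞) (fun x => (starRingEnd ℂ) (f x)) U :=
  Complex.conjCLE.contDiff.comp_contDiffOn hf

theorem mixedD_conj {U : Set X} (hU : IsOpen U) (w w' : Fin n → X × X × ℂ) (α β : Fin n → ℕ)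
    {f : X → ℂ} (hf : ContDiffOn ℝ (⊤ : ℕ∞) f U) :
    EqOn (mixedD (conjDir w) (conjDir w') α β (fun x => (starRingEnd ℂ) (f x)))
      (fun x => (starRingEnd ℂ) (mixedD w w' α β f x)) U := by
  induction α using multiIndex_induction with
  | zero =>
    induction β using multiIndex_induction with
    | zero => simp only [mixedD_zero]; exact fun _ _ => rfl
    | add β i ih =>
      intro x hx
      rw [mixedD_add_right hU _ _ _ _ i (smooth_conj hf) hx, dirD_congr hU _ ih hx,
        dirD_conj hU w' i ((localOp_mixedD hU w w' _ _).smooth _ hf) hx]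
      simp only [mixedD_add_right hU _ _ _ _ i hf hx]
  | add α i ih =>
    intro x hx
    rw [mixedD_add_left hU _ _ _ _ i (smooth_conj hf) hx, dirD_congr hU _ ih hx,
      dirD_conj hU w i ((localOp_mixedD hU w w' _ _).smooth _ hf) hx]
    simp only [mixedD_add_left hU _ _ _ _ i hf hx]

end Calculus

end WeylGraph

namespace WeylGraph

open Set Filter Topology

/-! ### Holomorphic functions of several variables -/

section Osgood

variable {n : ℕ}

/-- Cauchy's estimate on the complex lines through `y`. It provides the domination needed to
differentiate under the Cauchy integral. -/
theorem exists_fderiv_bound {f : (Fin n → ℂ) → ℂ} {U : Set (Fin n → ℂ)} (hU : IsOpen U)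
    (hf : DifferentiableOn ℂ f U) {x₀ : Fin n → ℂ} (hx₀ : x₀ ∈ U) :
    ∃ ρ > 0, ∃ C, Metric.ball x₀ (2 * ρ) ⊆ U ∧
      ∀ y ∈ Metric.ball x₀ (2 * ρ), ‖fderiv ℂ f y‖ ≤ C := by
  have hc : ContinuousAt f x₀ := (hf.differentiableAt (hU.mem_nhds hx₀)).continuousAt
  have hb : ∀ᶠ y in 𝓝 x₀, ‖f y‖ < ‖f x₀‖ + 1 :=
    hc.norm.eventually (gt_mem_nhds (by linarith))
  obtain ⟨ε, hε, hball⟩ := Metric.mem_nhds_iff.mp (Filter.inter_mem (hU.mem_nhds hx₀) hb)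
  -- With ρ = ε/4, a point within 2ρ = ε/2 of `x₀` stays within ε of it after a displacement of
  -- length at most ε/4.
  refine ⟨ε / 4, by positivity, (‖f x₀‖ + 1) / (ε / 4), fun y hy => (hball ?_).1, fun y hy => ?_⟩
  · exact Metric.ball_subset_ball (by linarith) hy
  refine ContinuousLinearMap.opNorm_le_bound _ (by positivity) fun u => ?_
  by_cases hu : u = 0
  · simp [hu]
  have hu' : 0 < ‖u‖ := norm_pos_iff.mpr hu
  have hmem : ∀ ζ ∈ Metric.closedBall (0 : ℂ) (ε / 4 / ‖u‖), y + ζ • u ∈ Metric.ball x₀ ε := by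
    intro ζ hζ
    rw [mem_closedBall_zero_iff, le_div_iff₀ hu'] at hζ
    rw [Metric.mem_ball, dist_eq_norm] at hy ⊢
    calc ‖y + ζ • u - x₀‖ = ‖(y - x₀) + ζ • u‖ := by congr 1; abel
      _ ≤ ‖y - x₀‖ + ‖ζ • u‖ := norm_add_le _ _
      _ < ε := by rw [norm_smul]; linarith
  have hd : ∀ ζ ∈ Metric.closedBall (0 : ℂ) (ε / 4 / ‖u‖),
      HasDerivAt (fun ζ : ℂ => f (y + ζ • u)) (fderiv ℂ f (y + ζ • u) u) ζ := by
    intro ζ hζ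
    have h1 := (hf.differentiableAt (hU.mem_nhds (hball (hmem ζ hζ)).1)).hasFDerivAt
    have h2 : HasDerivAt (fun ζ : ℂ => y + ζ • u) u ζ := by
      simpa using! ((hasDerivAt_id ζ).smul_const u).const_add y
    exact h1.comp_hasDerivAt ζ h2
  have hR : 0 < ε / 4 / ‖u‖ := by positivity
  have h0 := hd 0 (by simp [hR.le])
  have hdc : DiffContOnCl ℂ (fun ζ : ℂ => f (y + ζ • u)) (Metric.ball 0 (ε / 4 / ‖u‖)) := by
    apply DifferentiableOn.diffContOnCl
    rw [closure_ball _ hR.ne']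
    exact fun ζ hζ => (hd ζ hζ).differentiableAt.differentiableWithinAt
  have := Complex.norm_deriv_le_of_forall_mem_sphere_norm_le hR hdc (C := ‖f x₀‖ + 1)
    (fun ζ hζ => (hball (hmem ζ (Metric.sphere_subset_closedBall hζ))).2.le)
  rw [h0.deriv] at this
  simp only [zero_smul, add_zero] at this
  calc _ ≤ _ := this
    _ = _ := by field_simp

/-- Cauchy's formula on the line x + ζv writes the directional derivative as an integral of f(x +
ζv)/ζ² over a fixed circle, and this integral may be differentiated in `x`. Only complex
differentiability of `f` is assumed. -/
theorem differentiableOn_fderiv_apply {f : (Fin n → ℂ) → ℂ} {U : Set (Fin n → ℂ)}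
    (hU : IsOpen U) (hf : DifferentiableOn ℂ f U) (v : Fin n → ℂ) :
    DifferentiableOn ℂ (fun x => fderiv ℂ f x v) U := by
  intro x₀ hx₀
  obtain ⟨ρ, hρ, C, hsub, hC⟩ := exists_fderiv_bound hU hf hx₀
  -- The summand 1 keeps the radius meaningful for v = 0, and still R‖v‖ ≤ ρ.
  set R := ρ / (‖v‖ + 1) with hRdef
  have hR : 0 < R := by positivity
  have hRv : R * ‖v‖ ≤ ρ := by
    rw [hRdef, div_mul_eq_mul_div, div_le_iff₀ (by positivity)]
    nlinarith [norm_nonneg v]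
  have hmem : ∀ x ∈ Metric.ball x₀ ρ, ∀ ζ ∈ Metric.closedBall (0 : ℂ) R,
      x + ζ • v ∈ Metric.ball x₀ (2 * ρ) := by
    intro x hx ζ hζ
    rw [mem_closedBall_zero_iff] at hζ
    rw [Metric.mem_ball, dist_eq_norm] at hx ⊢
    calc ‖x + ζ • v - x₀‖ = ‖(x - x₀) + ζ • v‖ := by congr 1; abel
      _ ≤ ‖x - x₀‖ + ‖ζ • v‖ := norm_add_le _ _
      _ < 2 * ρ := by
        rw [norm_smul]
        have := mul_le_mul_of_nonneg_right hζ (norm_nonneg v)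
        linarith
  have hd : ∀ x ∈ Metric.ball x₀ ρ, ∀ ζ ∈ Metric.closedBall (0 : ℂ) R,
      HasFDerivAt f (fderiv ℂ f (x + ζ • v)) (x + ζ • v) := fun x hx ζ hζ =>
    (hf.differentiableAt (hU.mem_nhds (hsub (hmem x hx ζ hζ)))).hasFDerivAt
  have hcirc : ∀ θ, circleMap 0 R θ ∈ Metric.closedBall (0 : ℂ) R := fun θ =>
    circleMap_mem_closedBall 0 hR.le θ
  set c : ℝ → ℂ := fun θ => deriv (circleMap 0 R) θ * (1 / (circleMap 0 R θ - 0) ^ 2) with hc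
  have hcc : Continuous c := by
    have h1 : ∀ θ, (circleMap 0 R θ - 0) ^ 2 ≠ 0 := fun θ => by
      simpa using hR.ne'
    simp only [hc, deriv_circleMap]
    fun_prop (disch := assumption)
  set K : (Fin n → ℂ) → ℝ → ℂ := fun x θ => c θ • f (x + circleMap 0 R θ • v) with hK
  have hrep : ∀ x ∈ Metric.ball x₀ ρ,
      fderiv ℂ f x v = (2 * Real.pi * Complex.I)⁻¹ * ∫ θ in (0 : ℝ)..2 * Real.pi, K x θ := by
    intro x hx
    have h2 : ∀ ζ, HasDerivAt (fun ζ : ℂ => x + ζ • v) v ζ := fun ζ => by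
      simpa using! ((hasDerivAt_id ζ).smul_const v).const_add x
    have h1 : ∀ ζ ∈ Metric.closedBall (0 : ℂ) R,
        HasDerivAt (fun ζ : ℂ => f (x + ζ • v)) (fderiv ℂ f (x + ζ • v) v) ζ := fun ζ hζ =>
      (hd x hx ζ hζ).comp_hasDerivAt ζ (h2 ζ)
    have h3 := DifferentiableOn.deriv_eq_smul_circleIntegral hR
      (fun ζ hζ => (h1 ζ hζ).differentiableAt.differentiableWithinAt)
    rw [(h1 0 (by simp [hR.le])).deriv] at h3
    have h4 : (2 * Real.pi * Complex.I) ≠ 0 := Complex.two_pi_I_ne_zero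
    rw [eq_inv_mul_iff_mul_eq₀ h4]
    simp only [zero_smul, add_zero, smul_eq_mul, circleIntegral] at h3
    rw [← h3]
    simp only [hK, hc, smul_eq_mul, mul_assoc]
  have hcont : ∀ x ∈ Metric.ball x₀ ρ, Continuous (K x) := by
    intro x hx
    refine hcc.smul (continuous_iff_continuousAt.mpr fun θ => ?_)
    exact ContinuousAt.comp (f := fun θ => x + circleMap 0 R θ • v) (g := f)
      (hd x hx _ (hcirc θ)).continuousAt (by fun_prop)
  have hnb : Metric.ball x₀ ρ ∈ 𝓝 x₀ := Metric.ball_mem_nhds x₀ hρ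
  have hx₀' : x₀ ∈ Metric.ball x₀ ρ := Metric.mem_ball_self hρ
  have key : HasFDerivAt (fun x => ∫ θ in (0 : ℝ)..2 * Real.pi, K x θ)
      (∫ θ in (0 : ℝ)..2 * Real.pi, c θ • fderiv ℂ f (x₀ + circleMap 0 R θ • v)) x₀ := by
    refine intervalIntegral.hasFDerivAt_integral_of_dominated_of_fderiv_le
      (F' := fun x θ => c θ • fderiv ℂ f (x + circleMap 0 R θ • v)) (bound := fun θ => ‖c θ‖ * C)
      hnb ?_ ((hcont x₀ hx₀').intervalIntegrable _ _) ?_ ?_ ?_ ?_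
    · filter_upwards [hnb] with x hx using (hcont x hx).aestronglyMeasurable
    -- Continuity of the derivative is not yet known, but any derivative is measurable.
    · refine Measurable.aestronglyMeasurable ?_
      have h1 : Measurable fun θ => fderiv ℂ f (x₀ + circleMap 0 R θ • v) :=
        (measurable_fderiv ℂ f).comp
          (by fun_prop : Continuous fun θ => x₀ + circleMap 0 R θ • v).measurable
      exact hcc.measurable.smul h1
    · refine Eventually.of_forall fun θ _ x hx => ?_
      rw [norm_smul]
      exact mul_le_mul_of_nonneg_left (hC _ (hmem x hx _ (hcirc θ))) (norm_nonneg _)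
    · exact (hcc.norm.mul continuous_const).intervalIntegrable _ _
    · refine Eventually.of_forall fun θ _ x hx => ?_
      exact ((hd x hx _ (hcirc θ)).comp x ((hasFDerivAt_id x).add_const _)).const_smul (c θ)
  refine DifferentiableAt.differentiableWithinAt ?_
  refine (key.differentiableAt.const_mul (2 * Real.pi * Complex.I)⁻¹).congr_of_eventuallyEq ?_
  filter_upwards [hnb] with x hx using hrep x hx

theorem contDiffOn_of_differentiableOn {f : (Fin n → ℂ) → ℂ} {U : Set (Fin n → ℂ)}
    (hU : IsOpen U) (hf : DifferentiableOn ℂ f U) : ContDiffOn ℂ (⊤ : ℕ∞) f U := by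
  rw [contDiffOn_infty]
  intro m
  induction m generalizing f with
  | zero => exact contDiffOn_zero.mpr hf.continuousOn
  | succ m ih =>
    push_cast
    rw [contDiffOn_succ_iff_fderiv_of_isOpen hU]
    refine ⟨hf, by simp, ?_⟩
    rw [contDiffOn_clm_apply]
    exact fun v => ih (differentiableOn_fderiv_apply hU hf v)

theorem holo_smooth {f : (Fin n → ℂ) → Fin n → ℂ} {U : Set (Fin n → ℂ)}
    (hU : IsOpen U) (hf : DifferentiableOn ℂ f U) : ContDiffOn ℂ (⊤ : ℕ∞) f U :=
  contDiffOn_pi.mpr fun i => contDiffOn_of_differentiableOn hU (differentiableOn_pi.mp hf i)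

end Osgood

/-! ### Wirtinger calculus -/

section Wirtinger

variable {n : ℕ}

/-- The direction of `∂/∂zᵢ`. -/
noncomputable def zDir (i : Fin n) : (Fin n → ℂ) × (Fin n → ℂ) × ℂ :=
  (Pi.single i 1, Pi.single i Complex.I, -Complex.I)

/-- The direction of `∂/∂z̄ᵢ`. -/
noncomputable def zbarDir (i : Fin n) : (Fin n → ℂ) × (Fin n → ℂ) × ℂ :=
  (Pi.single i 1, Pi.single i Complex.I, Complex.I)

theorem dz_eq (i : Fin n) : dz i = dirD (zDir i) := by
  ext f x
  simp only [dz, dirD, zDir]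
  ring

theorem dzbar_eq (i : Fin n) : dzbar i = dirD (zbarDir i) := by
  ext f x
  simp only [dzbar, dirD, zbarDir]

theorem mixedDeriv_eq (α β : Fin n → ℕ) : mixedDeriv α β = mixedD zDir zbarDir α β := by
  ext f x
  simp only [mixedDeriv, mixedD, dz_eq, dzbar_eq]

theorem conjDir_zDir : conjDir (zDir (n := n)) = zbarDir := by
  ext i <;> simp [conjDir, zDir, zbarDir]

theorem conjDir_zbarDir : conjDir (zbarDir (n := n)) = zDir := by
  ext i <;> simp [conjDir, zDir, zbarDir]

theorem dz_conj {U : Set (Fin n → ℂ)} (hU : IsOpen U) (i : Fin n) {f : (Fin n → ℂ) → ℂ}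
    (hf : ContDiffOn ℝ (⊤ : ℕ∞) f U) {x} (hx : x ∈ U) :
    dz i (fun x => (starRingEnd ℂ) (f x)) x = (starRingEnd ℂ) (dzbar i f x) := by
  rw [dz_eq, dzbar_eq, ← conjDir_zbarDir]
  exact dirD_conj hU zbarDir i hf hx

theorem mixedDeriv_conj {U : Set (Fin n → ℂ)} (hU : IsOpen U) (α β : Fin n → ℕ)
    {f : (Fin n → ℂ) → ℂ} (hf : ContDiffOn ℝ (⊤ : ℕ∞) f U) {x} (hx : x ∈ U) :
    mixedDeriv β α (fun x => (starRingEnd ℂ) (f x)) x = (starRingEnd ℂ) (mixedDeriv α β f x) := by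
  have h := mixedD_conj hU zDir zbarDir α β hf hx
  rw [conjDir_zDir, conjDir_zbarDir] at h
  rw [mixedDeriv_eq, mixedDeriv_eq]
  exact (mixedD_swap hU _ _ _ _ (smooth_conj hf) hx).trans h

/-- A real derivative in terms of the Wirtinger derivatives. -/
theorem linear_wirtinger (A : (Fin n → ℂ) →L[ℝ] ℂ) (v : Fin n → ℂ) :
    A v = ∑ p, (v p * ((A (Pi.single p 1) - Complex.I * A (Pi.single p Complex.I)) / 2) +
      (starRingEnd ℂ) (v p) * ((A (Pi.single p 1) + Complex.I * A (Pi.single p Complex.I)) / 2)) := by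
  have hv : v = ∑ p, ((v p).re • (Pi.single p 1 : Fin n → ℂ) +
      (v p).im • (Pi.single p Complex.I : Fin n → ℂ)) := by
    ext q
    simp only [Finset.sum_apply, Pi.add_apply, Pi.smul_apply, Pi.single_apply, Finset.sum_add_distrib,
      smul_ite, smul_zero, Finset.sum_ite_eq, Finset.mem_univ, if_true]
    simp [Complex.re_add_im]
  conv_lhs => rw [hv]
  rw [map_sum]
  refine Finset.sum_congr rfl fun p _ => ?_
  rw [map_add, map_smul, map_smul]
  set a := A (Pi.single p 1)
  set b := A (Pi.single p Complex.I)
  have h1 : v p = (v p).re + (v p).im * Complex.I := (Complex.re_add_im _).symm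
  have h2 : (starRingEnd ℂ) (v p) = (v p).re - (v p).im * Complex.I := by
    conv_lhs => rw [h1]
    simp only [map_add, map_mul, Complex.conj_ofReal, Complex.conj_I]
    ring
  rw [h2]
  nth_rewrite 3 [h1]
  simp only [Complex.real_smul]
  linear_combination ((v p).im * b) * Complex.I_sq

theorem fderiv_wirtinger (f : (Fin n → ℂ) → ℂ) (x v : Fin n → ℂ) :
    fderiv ℝ f x v = ∑ p, (v p * dz p f x + (starRingEnd ℂ) (v p) * dzbar p f x) :=
  linear_wirtinger _ v

theorem fderiv_single_I {F : Type*} [NormedAddCommGroup F] [NormedSpace ℂ F]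
    (A : (Fin n → ℂ) →L[ℂ] F) (i : Fin n) :
    A (Pi.single i Complex.I) = Complex.I • A (Pi.single i 1) := by
  rw [← map_smul]
  congr 1
  ext j
  by_cases h : j = i
  · subst h; simp
  · simp [h]

theorem dz_holo {f : (Fin n → ℂ) → ℂ} {x : Fin n → ℂ} (hf : DifferentiableAt ℂ f x) (i : Fin n) :
    dz i f x = fderiv ℂ f x (Pi.single i 1) := by
  have h : ∀ v, fderiv ℝ f x v = fderiv ℂ f x v := fun v => by
    rw [(hf.hasFDerivAt.restrictScalars ℝ).fderiv]; rfl
  rw [dz, h, h, fderiv_single_I, smul_eq_mul]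
  linear_combination (-(fderiv ℂ f x (Pi.single i 1)) / 2) * Complex.I_sq

theorem dzbar_holo {f : (Fin n → ℂ) → ℂ} {x : Fin n → ℂ} (hf : DifferentiableAt ℂ f x)
    (i : Fin n) : dzbar i f x = 0 := by
  have h : ∀ v, fderiv ℝ f x v = fderiv ℂ f x v := fun v => by
    rw [(hf.hasFDerivAt.restrictScalars ℝ).fderiv]; rfl
  rw [dzbar, h, h, fderiv_single_I, smul_eq_mul]
  linear_combination ((fderiv ℂ f x (Pi.single i 1)) / 2) * Complex.I_sq

theorem fderiv_comp_holo {f : (Fin n → ℂ) → ℂ} {φ : (Fin n → ℂ) → Fin n → ℂ} {x : Fin n → ℂ}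
    (hφ : DifferentiableAt ℂ φ x) (hf : DifferentiableAt ℝ f (φ x)) (v : Fin n → ℂ) :
    fderiv ℝ (fun y => f (φ y)) x v = fderiv ℝ f (φ x) (fderiv ℂ φ x v) := by
  have h := (hf.hasFDerivAt.comp x (hφ.hasFDerivAt.restrictScalars ℝ)).fderiv
  have h' : fderiv ℝ (fun y => f (φ y)) x = _ := h
  rw [h']
  rfl

/-- Since Dφ is complex linear, passing from e_i to √-1 e_i multiplies the coefficients of ∂f by √-1
and those of ∂̄f by -√-1. The combination that defines ∂/∂zᵢ therefore removes the ∂̄ part. -/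
theorem dz_comp {f : (Fin n → ℂ) → ℂ} {φ : (Fin n → ℂ) → Fin n → ℂ} {x : Fin n → ℂ}
    (hφ : DifferentiableAt ℂ φ x) (hf : DifferentiableAt ℝ f (φ x)) (i : Fin n) :
    dz i (fun y => f (φ y)) x = ∑ p, dz p f (φ x) * fderiv ℂ φ x (Pi.single i 1) p := by
  rw [dz, fderiv_comp_holo hφ hf, fderiv_comp_holo hφ hf, fderiv_single_I, fderiv_wirtinger,
    fderiv_wirtinger, Finset.mul_sum, ← Finset.sum_sub_distrib, Finset.sum_div]
  refine Finset.sum_congr rfl fun p _ => ?_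
  simp only [Pi.smul_apply, smul_eq_mul, map_mul, Complex.conj_I]
  linear_combination ((-(fderiv ℂ φ x (Pi.single i 1) p) * dz p f (φ x) +
    (starRingEnd ℂ) (fderiv ℂ φ x (Pi.single i 1) p) * dzbar p f (φ x)) / 2) * Complex.I_sq

theorem dzbar_comp {f : (Fin n → ℂ) → ℂ} {φ : (Fin n → ℂ) → Fin n → ℂ} {x : Fin n → ℂ}
    (hφ : DifferentiableAt ℂ φ x) (hf : DifferentiableAt ℝ f (φ x)) (i : Fin n) :
    dzbar i (fun y => f (φ y)) x =
      ∑ p, dzbar p f (φ x) * (starRingEnd ℂ) (fderiv ℂ φ x (Pi.single i 1) p) := by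
  rw [dzbar, fderiv_comp_holo hφ hf, fderiv_comp_holo hφ hf, fderiv_single_I, fderiv_wirtinger,
    fderiv_wirtinger, Finset.mul_sum, ← Finset.sum_add_distrib, Finset.sum_div]
  refine Finset.sum_congr rfl fun p _ => ?_
  simp only [Pi.smul_apply, smul_eq_mul, map_mul, Complex.conj_I]
  linear_combination (((fderiv ℂ φ x (Pi.single i 1) p) * dz p f (φ x) -
    (starRingEnd ℂ) (fderiv ℂ φ x (Pi.single i 1) p) * dzbar p f (φ x)) / 2) * Complex.I_sq

theorem fderiv_component {φ : (Fin n → ℂ) → Fin n → ℂ} {x : Fin n → ℂ}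
    (hφ : DifferentiableAt ℂ φ x) (v : Fin n → ℂ) (q : Fin n) :
    fderiv ℂ (fun z => φ z q) x v = fderiv ℂ φ x v q := by
  rw [(hasFDerivAt_pi'.mp hφ.hasFDerivAt q).fderiv]
  rfl

theorem differentiableOn_fderiv_component {U : Set (Fin n → ℂ)} (hU : IsOpen U)
    {φ : (Fin n → ℂ) → Fin n → ℂ} (hφ : DifferentiableOn ℂ φ U) (v : Fin n → ℂ) (q : Fin n) :
    DifferentiableOn ℂ (fun y => fderiv ℂ φ y v q) U := by
  refine (differentiableOn_fderiv_apply hU (differentiableOn_pi.mp hφ q) v).congr fun y hy => ?_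
  rw [fderiv_component (hφ.differentiableAt (hU.mem_nhds hy))]

theorem dz_congr {U : Set (Fin n → ℂ)} (hU : IsOpen U) (i : Fin n) {f g : (Fin n → ℂ) → ℂ}
    (h : EqOn f g U) : EqOn (dz i f) (dz i g) U := by
  rw [dz_eq]; exact dirD_congr hU _ h

theorem dzbar_smooth {U : Set (Fin n → ℂ)} (hU : IsOpen U) (i : Fin n) {f : (Fin n → ℂ) → ℂ}
    (h : ContDiffOn ℝ (⊤ : ℕ∞) f U) : ContDiffOn ℝ (⊤ : ℕ∞) (dzbar i f) U := by
  rw [dzbar_eq]; exact dirD_smooth hU _ h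

theorem ofReal_smooth {Y : Type*} [NormedAddCommGroup Y] [NormedSpace ℝ Y] {U : Set Y} {f : Y → ℝ}
    (h : ContDiffOn ℝ (⊤ : ℕ∞) f U) : ContDiffOn ℝ (⊤ : ℕ∞) (fun x => (f x : ℂ)) U :=
  Complex.ofRealCLM.contDiff.comp_contDiffOn h

/-- The complex Hessian of a pulled back potential. -/
theorem dz_dzbar_comp {U W : Set (Fin n → ℂ)} (hU : IsOpen U) (hW : IsOpen W)
    {φ : (Fin n → ℂ) → Fin n → ℂ} (hφ : DifferentiableOn ℂ φ U) (hm : MapsTo φ U W)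
    {f : (Fin n → ℂ) → ℂ} (hf : ContDiffOn ℝ (⊤ : ℕ∞) f W) (i j : Fin n) {x : Fin n → ℂ}
    (hx : x ∈ U) :
    dz i (dzbar j fun y => f (φ y)) x =
      ∑ p, ∑ q, dz p (dzbar q f) (φ x) * fderiv ℂ φ x (Pi.single i 1) p *
        (starRingEnd ℂ) (fderiv ℂ φ x (Pi.single j 1) q) := by
  have hφd : ∀ y ∈ U, DifferentiableAt ℂ φ y := fun y hy => hφ.differentiableAt (hU.mem_nhds hy)
  have hD : ∀ q, DifferentiableOn ℂ (fun y => fderiv ℂ φ y (Pi.single j 1) q) U :=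
    differentiableOn_fderiv_component hU hφ _
  have hDs : ∀ q, ContDiffOn ℝ (⊤ : ℕ∞) (fun y => fderiv ℂ φ y (Pi.single j 1) q) U := fun q =>
    (contDiffOn_of_differentiableOn hU (hD q)).restrict_scalars ℝ
  have hφs : ContDiffOn ℝ (⊤ : ℕ∞) φ U := (holo_smooth hU hφ).restrict_scalars ℝ
  have h1 : EqOn (dzbar j fun y => f (φ y)) (fun y => ∑ q, dzbar q f (φ y) *
      (starRingEnd ℂ) (fderiv ℂ φ y (Pi.single j 1) q)) U := fun y hy =>
    dzbar_comp (hφd y hy) (smooth_differentiableAt hW hf (hm hy)) j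
  have hs1 : ∀ q, ContDiffOn ℝ (⊤ : ℕ∞) (fun y => dzbar q f (φ y)) U := fun q =>
    (dzbar_smooth hW q hf).comp hφs hm
  rw [dz_congr hU i h1 hx, dz_eq, (LocalOp.dirD hU (zDir i)).sum _ _
    (fun q _ => (hs1 q).mul (smooth_conj (hDs q))) hx]
  beta_reduce
  rw [Finset.sum_comm]
  refine Finset.sum_congr rfl fun q _ => ?_
  rw [dirD_mul hU _ (hs1 q) (smooth_conj (hDs q)) hx]
  beta_reduce
  -- The Leibniz term with a second derivative of φ vanishes: ∂ of the conjugate of a holomorphic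
  -- function is zero.
  rw [← dz_eq, dz_conj hU i (hDs q) hx,
    dzbar_holo ((hD q).differentiableAt (hU.mem_nhds hx)),
    dz_comp (hφd x hx) (smooth_differentiableAt hW (dzbar_smooth hW q hf) (hm hx))]
  simp [Finset.sum_mul]

theorem mixedDeriv_add_left {U : Set (Fin n → ℂ)} (hU : IsOpen U) (α β : Fin n → ℕ) (i : Fin n)
    {f : (Fin n → ℂ) → ℂ} (hf : ContDiffOn ℝ (⊤ : ℕ∞) f U) {x} (hx : x ∈ U) :
    mixedDeriv (α + Pi.single i 1) β f x = mixedDeriv α β (dz i f) x := by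
  rw [mixedDeriv_eq, mixedDeriv_eq, dz_eq]
  exact mixedD_add_left' hU _ _ _ _ _ hf hx

theorem mixedDeriv_add_right {U : Set (Fin n → ℂ)} (hU : IsOpen U) (α β : Fin n → ℕ) (i : Fin n)
    {f : (Fin n → ℂ) → ℂ} (hf : ContDiffOn ℝ (⊤ : ℕ∞) f U) {x} (hx : x ∈ U) :
    mixedDeriv α (β + Pi.single i 1) f x = mixedDeriv α β (dzbar i f) x := by
  rw [mixedDeriv_eq, mixedDeriv_eq, dzbar_eq]
  exact mixedD_add_right' hU _ _ _ _ _ hf hx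

theorem mixedDeriv_zero (f : (Fin n → ℂ) → ℂ) : mixedDeriv 0 0 f = f := by
  rw [mixedDeriv_eq, mixedD_zero]

theorem localOp_mixedDeriv {U : Set (Fin n → ℂ)} (hU : IsOpen U) (α β : Fin n → ℕ) :
    LocalOp U (mixedDeriv α β) := by
  rw [mixedDeriv_eq]; exact localOp_mixedD hU _ _ α β

/-- The mixed derivatives with `α = α' + eᵢ` and `β = β' + eⱼ` are derivatives of the metric. -/
theorem mixedDeriv_add_add {U : Set (Fin n → ℂ)} (hU : IsOpen U) (α β : Fin n → ℕ) (i j : Fin n)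
    {f : (Fin n → ℂ) → ℂ} (hf : ContDiffOn ℝ (⊤ : ℕ∞) f U) {x} (hx : x ∈ U) :
    mixedDeriv (α + Pi.single i 1) (β + Pi.single j 1) f x =
      mixedDeriv α β (dz i (dzbar j f)) x := by
  rw [mixedDeriv_add_right hU _ _ _ hf hx,
    mixedDeriv_add_left hU _ _ _ (dzbar_smooth hU j hf) hx]

end Wirtinger

end WeylGraph

namespace WeylGraph

open Set Filter Topology

/-! ### Functions that depend on a parameter -/

section Slices

variable {E : Type*} [NormedAddCommGroup E] [NormedSpace ℝ E] {n : ℕ}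

/-- A direction in the space variable of `ℝ × E`. -/
def liftDir (w : E × E × ℂ) : (ℝ × E) × (ℝ × E) × ℂ := ((0, w.1), (0, w.2.1), w.2.2)

/-- The direction of the parameter in `ℝ × E`. -/
def timeDir : (ℝ × E) × (ℝ × E) × ℂ := ((1, 0), (1, 0), 1)

theorem isOpen_slice {U : Set (ℝ × E)} (hU : IsOpen U) (t : ℝ) : IsOpen {y | (t, y) ∈ U} :=
  hU.preimage (by fun_prop : Continuous fun y : E => (t, y))

theorem smooth_slice {U : Set (ℝ × E)} {F : ℝ × E → ℂ} (hF : ContDiffOn ℝ (⊤ : ℕ∞) F U) (t : ℝ) :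
    ContDiffOn ℝ (⊤ : ℕ∞) (fun y => F (t, y)) {y | (t, y) ∈ U} :=
  hF.comp (g := F) (f := fun y => (t, y)) (by fun_prop) fun _ hy => hy

theorem fderiv_slice {F : ℝ × E → ℂ} {t : ℝ} {x : E} (hF : DifferentiableAt ℝ F (t, x)) (v : E) :
    fderiv ℝ (fun y => F (t, y)) x v = fderiv ℝ F (t, x) (0, v) := by
  have h := (hF.hasFDerivAt.comp x (hasFDerivAt_prodMk_right t x)).fderiv
  have h' : fderiv ℝ (fun y => F (t, y)) x = _ := h
  rw [h']
  simp

theorem dirD_slice {F : ℝ × E → ℂ} {t : ℝ} {x : E} (hF : DifferentiableAt ℝ F (t, x))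
    (w : E × E × ℂ) : dirD w (fun y => F (t, y)) x = dirD (liftDir w) F (t, x) := by
  simp only [dirD, fderiv_slice hF, liftDir]

/-- Space derivatives of a slice are derivatives on ℝ × E along directions without time component.
The parameter can thus be treated as one more variable. -/
theorem mixedD_slice {U : Set (ℝ × E)} (hU : IsOpen U) {F : ℝ × E → ℂ}
    (hF : ContDiffOn ℝ (⊤ : ℕ∞) F U) (w w' : Fin n → E × E × ℂ) (α β : Fin n → ℕ) (t : ℝ) :
    ∀ {x : E}, (t, x) ∈ U → mixedD w w' α β (fun y => F (t, y)) x =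
      mixedD (fun i => liftDir (w i)) (fun i => liftDir (w' i)) α β F (t, x) := by
  have hUt := isOpen_slice hU t
  have hFt := smooth_slice hF t
  induction α using multiIndex_induction with
  | zero =>
    induction β using multiIndex_induction with
    | zero => simp [mixedD_zero]
    | add β i ih =>
      intro x hx
      rw [mixedD_add_right hUt _ _ _ _ i hFt hx, mixedD_add_right hU _ _ _ _ i hF hx,
        dirD_congr hUt _ (fun y hy => ih hy) hx]
      exact dirD_slice (smooth_differentiableAt hU ((localOp_mixedD hU _ _ _ _).smooth _ hF) hx) _
  | add α i ih =>
    intro x hx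
    rw [mixedD_add_left hUt _ _ _ _ i hFt hx, mixedD_add_left hU _ _ _ _ i hF hx,
      dirD_congr hUt _ (fun y hy => ih hy) hx]
    exact dirD_slice (smooth_differentiableAt hU ((localOp_mixedD hU _ _ _ _).smooth _ hF) hx) _

theorem hasDerivAt_time {U : Set (ℝ × E)} (hU : IsOpen U) {F : ℝ × E → ℂ}
    (hF : ContDiffOn ℝ (⊤ : ℕ∞) F U) {t : ℝ} {x : E} (hx : (t, x) ∈ U) :
    HasDerivAt (fun s => F (s, x)) (dirD timeDir F (t, x)) t := by
  have h := (smooth_differentiableAt hU hF hx).hasFDerivAt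
  have h2 := h.comp_hasDerivAt t ((hasDerivAt_id t).prodMk (hasDerivAt_const t x))
  refine (h2.congr_deriv ?_)
  -- The time direction enters twice with coefficient 1, which compensates the division by 2 in
  -- `dirD`.
  simp only [dirD, timeDir]
  ring

/-- Differentiation in time is a constant-coefficient derivation on ℝ × E, so it commutes with the
space derivatives. -/
theorem hasDerivAt_mixedD {U : Set (ℝ × E)} (hU : IsOpen U) {F : ℝ × E → ℂ}
    (hF : ContDiffOn ℝ (⊤ : ℕ∞) F U) (w w' : Fin n → E × E × ℂ) (α β : Fin n → ℕ) {t : ℝ} {x : E}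
    (hx : (t, x) ∈ U) :
    HasDerivAt (fun s => mixedD w w' α β (fun y => F (s, y)) x)
      (mixedD (fun i => liftDir (w i)) (fun i => liftDir (w' i)) α β (dirD timeDir F) (t, x)) t := by
  have hop := localOp_mixedD hU (fun i => liftDir (w i)) (fun i => liftDir (w' i)) α β
  have h := hasDerivAt_time hU (hop.smooth _ hF) hx
  rw [hop.comm _ _ hF hx]
  refine h.congr_of_eventuallyEq ?_
  have : ∀ᶠ s in 𝓝 t, (s, x) ∈ U :=
    (hU.preimage (by fun_prop : Continuous fun s : ℝ => (s, x))).mem_nhds hx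
  filter_upwards [this] with s hs using mixedD_slice hU hF w w' α β s hs

end Slices

/-! ### The variation of a function along a path of holomorphic maps -/

section Path

variable {n : ℕ}

/-- A path of holomorphic maps with the affine part fixed. -/
noncomputable def pathMap (p p' : Fin n → ℂ) (L : (Fin n → ℂ) →L[ℂ] (Fin n → ℂ))
    (h : (Fin n → ℂ) → Fin n → ℂ) (t : ℝ) (w : Fin n → ℂ) : Fin n → ℂ :=
  p + L (w - p') + (t : ℂ) • h w

/-- The derivative of `pathMap`. -/
noncomputable def pathDeriv (L : (Fin n → ℂ) →L[ℂ] (Fin n → ℂ))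
    (h : (Fin n → ℂ) → Fin n → ℂ) (t : ℝ) (w : Fin n → ℂ) : (Fin n → ℂ) →L[ℂ] (Fin n → ℂ) :=
  L + (t : ℂ) • fderiv ℂ h w

/-- The vector field that generates `pathMap`. -/
noncomputable def pathVec (L : (Fin n → ℂ) →L[ℂ] (Fin n → ℂ))
    (h : (Fin n → ℂ) → Fin n → ℂ) (t : ℝ) (w : Fin n → ℂ) : Fin n → ℂ :=
  Ring.inverse (pathDeriv L h t w) (h w)

/-- The pairs `(t, w)` near which the path of maps is defined and locally invertible. -/
def pathDom (p p' : Fin n → ℂ) (L : (Fin n → ℂ) →L[ℂ] (Fin n → ℂ))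
    (h : (Fin n → ℂ) → Fin n → ℂ) (W W' : Set (Fin n → ℂ)) : Set (ℝ × (Fin n → ℂ)) :=
  {x | x.2 ∈ W' ∧ pathMap p p' L h x.1 x.2 ∈ W ∧ IsUnit (pathDeriv L h x.1 x.2)}

variable {p p' : Fin n → ℂ} {L : (Fin n → ℂ) →L[ℂ] (Fin n → ℂ)}
  {h : (Fin n → ℂ) → Fin n → ℂ} {W W' : Set (Fin n → ℂ)}

theorem smooth_fderiv_holo (hW' : IsOpen W') (hh : DifferentiableOn ℂ h W') :
    ContDiffOn ℂ (⊤ : ℕ∞) (fderiv ℂ h) W' :=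
  (holo_smooth hW' hh).fderiv_of_isOpen hW' (by simp)

theorem smooth_comp_snd {Y : Type*} [NormedAddCommGroup Y] [NormedSpace ℝ Y]
    {g : (Fin n → ℂ) → Y} (hg : ContDiffOn ℝ (⊤ : ℕ∞) g W') :
    ContDiffOn ℝ (⊤ : ℕ∞) (fun x : ℝ × (Fin n → ℂ) => g x.2) {x | x.2 ∈ W'} :=
  hg.comp (g := g) (f := Prod.snd) contDiffOn_snd fun _ hx => hx

theorem smooth_ofReal_fst {s : Set (ℝ × (Fin n → ℂ))} :
    ContDiffOn ℝ (⊤ : ℕ∞) (fun x : ℝ × (Fin n → ℂ) => (x.1 : ℂ)) s :=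
  Complex.ofRealCLM.contDiff.comp_contDiffOn contDiffOn_fst

theorem smooth_pathMap (hW' : IsOpen W') (hh : DifferentiableOn ℂ h W') :
    ContDiffOn ℝ (⊤ : ℕ∞) (fun x : ℝ × (Fin n → ℂ) => pathMap p p' L h x.1 x.2) {x | x.2 ∈ W'} := by
  have h1 : ContDiffOn ℝ (⊤ : ℕ∞) h W' := (holo_smooth hW' hh).restrict_scalars ℝ
  have hL : ContDiff ℝ (⊤ : ℕ∞) (fun w : Fin n → ℂ => L (w - p')) :=
    (L.restrictScalars ℝ).contDiff.comp (contDiff_id.sub contDiff_const)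
  unfold pathMap
  exact (contDiffOn_const.add (hL.comp_contDiffOn contDiffOn_snd)).add
    (smooth_ofReal_fst.smul (smooth_comp_snd h1))

theorem smooth_pathDeriv (hW' : IsOpen W') (hh : DifferentiableOn ℂ h W') :
    ContDiffOn ℝ (⊤ : ℕ∞) (fun x : ℝ × (Fin n → ℂ) => pathDeriv L h x.1 x.2) {x | x.2 ∈ W'} := by
  have h1 : ContDiffOn ℝ (⊤ : ℕ∞) (fderiv ℂ h) W' := (smooth_fderiv_holo hW' hh).restrict_scalars ℝ
  unfold pathDeriv
  exact contDiffOn_const.add (smooth_ofReal_fst.smul (smooth_comp_snd h1))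

theorem isOpen_pathDom (hW : IsOpen W) (hW' : IsOpen W') (hh : DifferentiableOn ℂ h W') :
    IsOpen (pathDom p p' L h W W') := by
  have hV : IsOpen {x : ℝ × (Fin n → ℂ) | x.2 ∈ W'} := hW'.preimage continuous_snd
  have h1 := (smooth_pathMap (p := p) (p' := p') (L := L) hW' hh).continuousOn.isOpen_inter_preimage hV hW
  have h2 := (smooth_pathDeriv (L := L) hW' hh).continuousOn.isOpen_inter_preimage hV Units.isOpen
  have : pathDom p p' L h W W' = ({x : ℝ × (Fin n → ℂ) | x.2 ∈ W'} ∩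
      (fun x => pathMap p p' L h x.1 x.2) ⁻¹' W) ∩ ({x : ℝ × (Fin n → ℂ) | x.2 ∈ W'} ∩
      (fun x => pathDeriv L h x.1 x.2) ⁻¹' {a | IsUnit a}) := by
    ext x
    simp only [pathDom, mem_ofPred_eq, mem_inter_iff, mem_preimage]
    tauto
  rw [this]
  exact h1.inter h2

theorem smooth_pathVec (hW' : IsOpen W') (hh : DifferentiableOn ℂ h W') (q : Fin n) :
    ContDiffOn ℝ (⊤ : ℕ∞) (fun x : ℝ × (Fin n → ℂ) => pathVec L h x.1 x.2 q)
      (pathDom p p' L h W W') := by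
  have h1 : ContDiffOn ℝ (⊤ : ℕ∞) h W' := (holo_smooth hW' hh).restrict_scalars ℝ
  have hs : pathDom p p' L h W W' ⊆ {x | x.2 ∈ W'} := fun x hx => hx.1
  have h2 : ContDiffOn ℝ (⊤ : ℕ∞) (fun x : ℝ × (Fin n → ℂ) => Ring.inverse (pathDeriv L h x.1 x.2))
      (pathDom p p' L h W W') := by
    intro x hx
    obtain ⟨u, hu⟩ := hx.2.2
    have h3 : ContDiffAt ℝ (⊤ : ℕ∞) Ring.inverse (pathDeriv L h x.1 x.2) :=
      hu ▸ contDiffAt_ringInverse ℝ u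
    exact h3.comp_contDiffWithinAt x ((smooth_pathDeriv hW' hh).mono hs x hx)
  have h4 : ContDiffOn ℝ (⊤ : ℕ∞) (fun x : ℝ × (Fin n → ℂ) =>
      ContinuousLinearMap.restrictScalars ℝ (Ring.inverse (pathDeriv L h x.1 x.2)))
      (pathDom p p' L h W W') :=
    (ContinuousLinearMap.restrictScalarsL ℂ (Fin n → ℂ) (Fin n → ℂ) ℝ ℝ).contDiff.comp_contDiffOn h2
  have h5 : ContDiffOn ℝ (⊤ : ℕ∞) (fun x : ℝ × (Fin n → ℂ) => pathVec L h x.1 x.2)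
      (pathDom p p' L h W W') := h4.clm_apply ((smooth_comp_snd h1).mono hs)
  exact contDiffOn_pi.mp h5 q

/-- Holomorphy in the space variable is what makes barred derivatives of the field vanish in the
Leibniz expansion; in (t, w) jointly the field is only used as a real smooth function. -/
theorem holo_pathVec (hW' : IsOpen W') (hh : DifferentiableOn ℂ h W') {t : ℝ} {w : Fin n → ℂ}
    (hx : (t, w) ∈ pathDom p p' L h W W') (q : Fin n) :
    DifferentiableAt ℂ (fun y => pathVec L h t y q) w := by
  have hw := hW'.mem_nhds hx.1
  obtain ⟨u, hu⟩ := hx.2.2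
  have h3 : ContDiffAt ℂ 1 Ring.inverse (pathDeriv L h t w) := hu ▸ contDiffAt_ringInverse ℂ u
  have h4 : DifferentiableAt ℂ (fun y => pathDeriv L h t y) w :=
    ((((smooth_fderiv_holo hW' hh).contDiffAt hw).differentiableAt (by simp)).const_smul
      (t : ℂ)).const_add L
  have h5 : DifferentiableAt ℂ (fun y => Ring.inverse (pathDeriv L h t y)) w :=
    (h3.differentiableAt (by simp)).comp w h4
  exact differentiableAt_pi.mp (h5.clm_apply (hh.differentiableAt hw)) q

theorem pathDeriv_pathVec {t : ℝ} {w : Fin n → ℂ} (hu : IsUnit (pathDeriv L h t w)) :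
    pathDeriv L h t w (pathVec L h t w) = h w := by
  have := Ring.mul_inverse_cancel _ hu
  exact congrArg (fun A => A (h w)) this

theorem hasFDerivAt_pathMap (hW' : IsOpen W') (hh : DifferentiableOn ℂ h W') (t : ℝ)
    {w : Fin n → ℂ} (hw : w ∈ W') :
    HasFDerivAt (pathMap p p' L h t) (pathDeriv L h t w) w :=
  ((L.hasFDerivAt.comp w ((hasFDerivAt_id w).sub_const p')).const_add p).add
    ((hh.differentiableAt (hW'.mem_nhds hw)).hasFDerivAt.const_smul (t : ℂ))

theorem smooth_path_comp (hW' : IsOpen W') (hh : DifferentiableOn ℂ h W')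
    {f : (Fin n → ℂ) → ℂ} (hf : ContDiffOn ℝ (⊤ : ℕ∞) f W) :
    ContDiffOn ℝ (⊤ : ℕ∞) (fun x : ℝ × (Fin n → ℂ) => f (pathMap p p' L h x.1 x.2))
      (pathDom p p' L h W W') :=
  hf.comp ((smooth_pathMap hW' hh).mono fun _ hx => hx.1) fun _ hx => hx.2.1

/-- The variation of a function along the path is its derivative along the generating field. -/
theorem timeDeriv_path (hW : IsOpen W) (hW' : IsOpen W') (hh : DifferentiableOn ℂ h W')
    {f : (Fin n → ℂ) → ℂ} (hf : ContDiffOn ℝ (⊤ : ℕ∞) f W) :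
    EqOn (dirD timeDir (fun x : ℝ × (Fin n → ℂ) => f (pathMap p p' L h x.1 x.2)))
      (fun x => (∑ q, pathVec L h x.1 x.2 q *
          dirD (liftDir (zDir q)) (fun x => f (pathMap p p' L h x.1 x.2)) x) +
        ∑ q, (starRingEnd ℂ) (pathVec L h x.1 x.2 q) *
          dirD (liftDir (zbarDir q)) (fun x => f (pathMap p p' L h x.1 x.2)) x)
      (pathDom p p' L h W W') := by
  rintro ⟨t, w⟩ hx
  have hU := isOpen_pathDom (p := p) (p' := p') (L := L) hW hW' hh
  have hF := smooth_path_comp (p := p) (p' := p') (L := L) hW' hh hf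
  have hFd := smooth_differentiableAt hU hF hx
  have hfd := smooth_differentiableAt hW hf hx.2.1
  have h1 : HasDerivAt (fun s => f (pathMap p p' L h s w))
      (fderiv ℝ f (pathMap p p' L h t w) (h w)) t := by
    refine hfd.hasFDerivAt.comp_hasDerivAt t ?_
    have h2 : HasDerivAt (fun s : ℝ => (s : ℂ) • h w) ((1 : ℂ) • h w) t :=
      (Complex.ofRealCLM.hasDerivAt (x := t)).smul_const (h w)
    rw [one_smul] at h2
    exact h2.const_add _
  have h3 := (hasDerivAt_time hU hF hx).unique h1
  -- Writing h = Dφ_t ξ turns the derivative of f at φ_t(w) in direction h into the derivative of f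
  -- ∘ φ_t at w in direction ξ, by the chain rule read backwards.
  rw [h3, ← pathDeriv_pathVec hx.2.2, ← (hasFDerivAt_pathMap hW' hh t hx.1).fderiv,
    ← fderiv_comp_holo (hasFDerivAt_pathMap hW' hh t hx.1).differentiableAt hfd, fderiv_wirtinger,
    Finset.sum_add_distrib]
  congr 1 <;> refine Finset.sum_congr rfl fun q _ => ?_
  · rw [dz_eq, ← dirD_slice hFd]
  · rw [dzbar_eq, ← dirD_slice hFd]

/-- Apply the mixed derivative to ξ·∂F + ξ̄·∂̄F, with F the pulled back function. As ξ is
holomorphic, only the unbarred labels `S` distribute over it, and only the barred labels `T` over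
its conjugate. -/
theorem hasDerivAt_path (hW : IsOpen W) (hW' : IsOpen W') (hh : DifferentiableOn ℂ h W')
    {f : (Fin n → ℂ) → ℂ} (hf : ContDiffOn ℝ (⊤ : ℕ∞) f W) {t : ℝ} {x : Fin n → ℂ}
    (hx : (t, x) ∈ pathDom p p' L h W W') {ε : Type*} [DecidableEq ε] (S T : Finset ε)
    (a b : ε → Fin n) :
    HasDerivAt (fun s => mixedDeriv (cnt S a) (cnt T b) (fun y => f (pathMap p p' L h s y)) x)
      ((∑ R ∈ S.powerset, ∑ q, mixedDeriv (cnt R a) 0 (fun y => pathVec L h t y q) x *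
          mixedDeriv (cnt (S \ R) a + Pi.single q 1) (cnt T b)
            (fun y => f (pathMap p p' L h t y)) x) +
        ∑ R ∈ T.powerset, ∑ q,
          mixedDeriv 0 (cnt R b) (fun y => (starRingEnd ℂ) (pathVec L h t y q)) x *
          mixedDeriv (cnt S a) (cnt (T \ R) b + Pi.single q 1)
            (fun y => f (pathMap p p' L h t y)) x) t := by
  have hU := isOpen_pathDom (p := p) (p' := p') (L := L) hW hW' hh
  have hF := smooth_path_comp (p := p) (p' := p') (L := L) hW' hh hf
  have hξ := smooth_pathVec (p := p) (p' := p') (L := L) (W := W) hW' hh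
  simp only [mixedDeriv_eq]
  refine (hasDerivAt_mixedD hU hF zDir zbarDir _ _ hx).congr_deriv ?_
  have hop := localOp_mixedD hU (fun i => liftDir (zDir (n := n) i)) (fun i => liftDir (zbarDir i))
    (cnt S a) (cnt T b)
  have hdz : ∀ v : (Fin n → ℂ) × (Fin n → ℂ) × ℂ, ContDiffOn ℝ (⊤ : ℕ∞) (dirD (liftDir v)
      (fun x : ℝ × (Fin n → ℂ) => f (pathMap p p' L h x.1 x.2))) (pathDom p p' L h W W') :=
    fun v => dirD_smooth hU _ hF
  rw [hop.congr _ _ (timeDeriv_path hW hW' hh hf) hx,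
    hop.add _ _ (ContDiffOn.sum fun q _ => (hξ q).mul (hdz _))
      (ContDiffOn.sum fun q _ => (smooth_conj (hξ q)).mul (hdz _)) hx]
  beta_reduce
  rw [hop.sum _ _ (fun q _ => (hξ q).mul (hdz _)) hx,
    hop.sum _ _ (fun q _ => (smooth_conj (hξ q)).mul (hdz _)) hx]
  beta_reduce
  have hbar : ∀ q j, EqOn (dirD (liftDir (zbarDir j)) fun x : ℝ × (Fin n → ℂ) =>
      pathVec L h x.1 x.2 q) (fun _ => 0) (pathDom p p' L h W W') := by
    rintro q j ⟨s, y⟩ hy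
    rw [← dirD_slice (smooth_differentiableAt hU (hξ q) hy), ← dzbar_eq]
    exact dzbar_holo (holo_pathVec hW' hh hy q) j
  have hbar' : ∀ q j, EqOn (dirD (liftDir (zDir j)) fun x : ℝ × (Fin n → ℂ) =>
      (starRingEnd ℂ) (pathVec L h x.1 x.2 q)) (fun _ => 0) (pathDom p p' L h W W') := by
    rintro q j ⟨s, y⟩ hy
    rw [← dirD_slice (smooth_differentiableAt hU (smooth_conj (hξ q)) hy), ← dz_eq]
    rw [dz_conj (isOpen_slice hU s) j (smooth_slice (hξ q) s) hy,
      dzbar_holo (holo_pathVec hW' hh hy q) j, map_zero]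
  congr 1
  · rw [Finset.sum_comm]
    refine Finset.sum_congr rfl fun q _ => ?_
    rw [leibniz hU _ _ S a _ hx (hξ q) (hdz _) (hbar q)]
    refine Finset.sum_congr rfl fun R _ => ?_
    rw [mixedD_slice hU (hξ q) _ _ _ _ _ hx, mixedD_slice hU hF _ _ _ _ _ hx,
      mixedD_add_left' hU _ _ _ _ _ hF hx]
  · rw [Finset.sum_comm]
    refine Finset.sum_congr rfl fun q _ => ?_
    -- Exchanging the two families lets the same Leibniz rule serve for the conjugate field.
    rw [mixedD_swap hU _ _ _ _ ((smooth_conj (hξ q)).mul (hdz _)) hx,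
      leibniz hU _ _ T b _ hx (smooth_conj (hξ q)) (hdz _) (hbar' q)]
    refine Finset.sum_congr rfl fun R _ => ?_
    rw [mixedD_slice hU (smooth_conj (hξ q)) _ _ _ _ _ hx, mixedD_slice hU hF _ _ _ _ _ hx,
      mixedD_add_right' hU _ _ _ _ _ hF hx, mixedD_swap hU _ _ _ _ (smooth_conj (hξ q)) hx,
      mixedD_swap hU _ _ _ _ (hdz _) hx]

/-- Differentiate (L + t Dh) ξ = h. A term in which some derivative falls on the matrix contains a
derivative of ξ over a proper subset of `S`, which vanishes by `hR`. In the remaining term the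
matrix is evaluated at `x`, where Dh = 0 leaves only L. -/
theorem pathVec_jet_aux (hW : IsOpen W) (hW' : IsOpen W') (hh : DifferentiableOn ℂ h W')
    {t : ℝ} {x : Fin n → ℂ} (hx : (t, x) ∈ pathDom p p' L h W W')
    (hvan : ∀ q, ∀ γ : Fin n → ℕ, ∑ i, γ i < 2 → mixedDeriv γ 0 (fun y => h y q) x = 0)
    {ε : Type*} [DecidableEq ε] (S : Finset ε) (a : ε → Fin n)
    (hR : ∀ R, R ⊂ S → ∀ r, mixedDeriv (cnt R a) 0 (fun y => pathVec L h t y r) x = 0)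
    (q : Fin n) :
    L (fun r => mixedDeriv (cnt S a) 0 (fun y => pathVec L h t y r) x) q =
      mixedDeriv (cnt S a) 0 (fun y => h y q) x := by
  have hU := isOpen_slice (isOpen_pathDom (p := p) (p' := p') (L := L) hW hW' hh) t
  have hξ : ∀ r, ContDiffOn ℝ (⊤ : ℕ∞) (fun y => pathVec L h t y r)
      {y | (t, y) ∈ pathDom p p' L h W W'} := fun r => smooth_slice (smooth_pathVec hW' hh r) t
  set V := {y | (t, y) ∈ pathDom p p' L h W W'} with hV
  have hVW : V ⊆ W' := fun y hy => hy.1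
  have hdiff : ∀ y ∈ V, DifferentiableAt ℂ h y := fun y hy =>
    hh.differentiableAt (hW'.mem_nhds (hVW hy))
  set A : Fin n → (Fin n → ℂ) → ℂ := fun r y => pathDeriv L h t y (Pi.single r 1) q with hA
  have hAeq : ∀ r y, A r y = L (Pi.single r 1) q + (t : ℂ) * fderiv ℂ h y (Pi.single r 1) q :=
    fun r y => rfl
  have hAd : ∀ r, DifferentiableOn ℂ (A r) V := by
    intro r
    change DifferentiableOn ℂ
      (fun y => L (Pi.single r 1) q + (t : ℂ) * fderiv ℂ h y (Pi.single r 1) q) V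
    exact (((differentiableOn_fderiv_component hW' hh _ q).mono hVW).const_mul _).const_add _
  have hAs : ∀ r, ContDiffOn ℝ (⊤ : ℕ∞) (A r) V := fun r =>
    (contDiffOn_of_differentiableOn hU (hAd r)).restrict_scalars ℝ
  have hA0 : ∀ r, A r x = L (Pi.single r 1) q := by
    intro r
    have hs : ContDiffOn ℝ (⊤ : ℕ∞) (fun y => h y q) W' :=
      contDiffOn_pi.mp ((holo_smooth hW' hh).restrict_scalars ℝ) q
    have h1 := hvan q (0 + Pi.single r 1) (by simp [Finset.sum_pi_single'])
    rw [mixedDeriv_add_left hW' _ _ _ hs (hVW hx), mixedDeriv_zero,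
      dz_holo (differentiableAt_pi.mp (hdiff x hx) q), fderiv_component (hdiff x hx)] at h1
    rw [hAeq, h1, mul_zero, add_zero]
  have hid : EqOn (fun y => ∑ r, A r y * pathVec L h t y r) (fun y => h y q) V := by
    intro y hy
    have h1 := congrFun (pathDeriv_pathVec (L := L) (h := h) hy.2.2) q
    have h2 : pathVec L h t y = ∑ r, pathVec L h t y r • (Pi.single r 1 : Fin n → ℂ) := by
      ext j
      simp [Pi.single_apply]
    rw [h2, map_sum] at h1
    simp only [map_smul, Finset.sum_apply, Pi.smul_apply, smul_eq_mul] at h1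
    simp only [← h1, hA, mul_comm]
  have hop := localOp_mixedDeriv hU (cnt S a) 0
  rw [← hop.congr _ _ hid hx, hop.sum _ _ (fun r _ => (hAs r).mul (hξ r)) hx]
  have h2 : (fun r => mixedDeriv (cnt S a) 0 (fun y => pathVec L h t y r) x) =
      ∑ r, mixedDeriv (cnt S a) 0 (fun y => pathVec L h t y r) x •
        (Pi.single r 1 : Fin n → ℂ) := by
    ext j
    simp [Pi.single_apply]
  rw [h2, map_sum]
  simp only [map_smul, Finset.sum_apply, Pi.smul_apply, smul_eq_mul]
  refine Finset.sum_congr rfl fun r _ => ?_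
  rw [mixedDeriv_eq, leibniz_left hU _ _ S a hx (hAs r) (hξ r), Finset.sum_eq_single ∅]
  · rw [cnt_empty, mixedD_zero, hA0, Finset.sdiff_empty, mul_comm, ← mixedDeriv_eq]
  · intro R hRS hne
    rw [← mixedDeriv_eq, ← mixedDeriv_eq, hR (S \ R), mul_zero]
    have hRS := Finset.mem_powerset.mp hRS
    exact Finset.sdiff_ssubset hRS (Finset.nonempty_iff_ne_empty.mpr hne)
  · simp

/-- The lowest order derivatives of the generating field. -/
theorem pathVec_jet (hW : IsOpen W) (hW' : IsOpen W') (hh : DifferentiableOn ℂ h W')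
    {t : ℝ} {x : Fin n → ℂ} (hx : (t, x) ∈ pathDom p p' L h W W') (hL : IsUnit L) {m : ℕ}
    (hm : 2 ≤ m)
    (hvan : ∀ q, ∀ γ : Fin n → ℕ, ∑ i, γ i < m → mixedDeriv γ 0 (fun y => h y q) x = 0)
    (γ : Fin n → ℕ) (hγ : ∑ i, γ i ≤ m) (q : Fin n) :
    L (fun r => mixedDeriv γ 0 (fun y => pathVec L h t y r) x) q =
      mixedDeriv γ 0 (fun y => h y q) x := by
  have hvan' := fun q γ (hγ : ∑ i, γ i < 2) => hvan q γ (hγ.trans_le hm)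
  obtain ⟨k, a, rfl⟩ := exists_cnt γ
  -- By strong induction on the order: below order m the right-hand side is zero, and L is
  -- invertible.
  have hzero : ∀ N, N < m → ∀ S : Finset (Fin k), S.card = N → ∀ r,
      mixedDeriv (cnt S a) 0 (fun y => pathVec L h t y r) x = 0 := by
    intro N
    induction N using Nat.strong_induction_on with
    | _ N ih =>
      intro hN S hS r
      have h1 : L (fun r => mixedDeriv (cnt S a) 0 (fun y => pathVec L h t y r) x) = 0 := by
        ext q
        rw [pathVec_jet_aux hW hW' hh hx hvan' S a
          (fun R hR r => ih _ (hS ▸ Finset.card_lt_card hR)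
            ((hS ▸ Finset.card_lt_card hR).trans hN) R rfl r) q]
        exact hvan q _ (by rwa [sum_cnt, hS])
      obtain ⟨u, rfl⟩ := hL
      have h2 := congrArg (fun v => (↑u⁻¹ : (Fin n → ℂ) →L[ℂ] (Fin n → ℂ)) v) h1
      have h3 : ∀ v, (↑u⁻¹ : (Fin n → ℂ) →L[ℂ] (Fin n → ℂ)) ((u : (Fin n → ℂ) →L[ℂ] (Fin n → ℂ)) v)
          = v := fun v => congrArg (fun A : (Fin n → ℂ) →L[ℂ] (Fin n → ℂ) => A v) (Units.inv_mul u)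
      simp only [h3, map_zero] at h2
      exact congrFun h2 r
  rw [sum_cnt] at hγ
  exact pathVec_jet_aux hW hW' hh hx hvan' _ a
    (fun R hR r => hzero R.card ((Finset.card_lt_card hR).trans_le hγ) R rfl r) q

end Path

end WeylGraph

namespace WeylGraph

/-! ### Contractions of graphs -/

namespace MultiDigraph

theorem one_le_inDeg {G : MultiDigraph} {v : G.V} : 1 ≤ G.inDeg v ↔ ∃ e, G.tgt e = v := by
  rw [inDeg, Nat.one_le_iff_ne_zero, ← Nat.pos_iff_ne_zero, Finite.card_pos_iff, nonempty_subtype]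

theorem one_le_outDeg {G : MultiDigraph} {v : G.V} : 1 ≤ G.outDeg v ↔ ∃ e, G.src e = v := by
  rw [outDeg, Nat.one_le_iff_ne_zero, ← Nat.pos_iff_ne_zero, Finite.card_pos_iff, nonempty_subtype]

theorem two_le_inDeg {G : MultiDigraph} {v : G.V} :
    2 ≤ G.inDeg v ↔ ∃ e e', e ≠ e' ∧ G.tgt e = v ∧ G.tgt e' = v := by
  rw [inDeg, Nat.succ_le_iff, Finite.one_lt_card_iff_nontrivial]
  constructor
  · rintro ⟨⟨e, he⟩, ⟨e', he'⟩, hne⟩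
    exact ⟨e, e', fun h => hne (Subtype.ext h), he, he'⟩
  · rintro ⟨e, e', hne, he, he'⟩
    exact ⟨⟨e, he⟩, ⟨e', he'⟩, fun h => hne (congrArg Subtype.val h)⟩

theorem two_le_outDeg {G : MultiDigraph} {v : G.V} :
    2 ≤ G.outDeg v ↔ ∃ e e', e ≠ e' ∧ G.src e = v ∧ G.src e' = v := by
  rw [outDeg, Nat.succ_le_iff, Finite.one_lt_card_iff_nontrivial]
  constructor
  · rintro ⟨⟨e, he⟩, ⟨e', he'⟩, hne⟩
    exact ⟨e, e', fun h => hne (Subtype.ext h), he, he'⟩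
  · rintro ⟨e, e', hne, he, he'⟩
    exact ⟨⟨e, he⟩, ⟨e', he'⟩, fun h => hne (congrArg Subtype.val h)⟩

/-- Degrees are replaced by the existence of edges, which is what can be transported through
contractions and splittings. -/
theorem semistable_iff {G : MultiDigraph} : G.Semistable ↔ ∀ v, (∃ e, G.tgt e = v) ∧
    (∃ e, G.src e = v) ∧ ((∃ e e', e ≠ e' ∧ G.tgt e = v ∧ G.tgt e' = v) ∨
      ∃ e e', e ≠ e' ∧ G.src e = v ∧ G.src e' = v) := by
  refine forall_congr' fun v => ?_
  rw [← one_le_inDeg, ← one_le_outDeg, ← two_le_inDeg, ← two_le_outDeg]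
  omega

/-- The edge is the only one with its tail, or the only one with its head. -/
def Lone (G : MultiDigraph) (e : G.E) : Prop :=
  (∀ e', G.src e' = G.src e → e' = e) ∨ ∀ e', G.tgt e' = G.tgt e → e' = e

theorem contractible_iff {G : MultiDigraph} {e : G.E} :
    G.Contractible e ↔ G.src e ≠ G.tgt e ∧ G.Lone e := by
  have h1 : 1 ≤ G.outDeg (G.src e) := one_le_outDeg.mpr ⟨e, rfl⟩
  have h2 : 1 ≤ G.inDeg (G.tgt e) := one_le_inDeg.mpr ⟨e, rfl⟩
  have h3 : G.outDeg (G.src e) = 1 ↔ ∀ e', G.src e' = G.src e → e' = e := by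
    rw [le_antisymm_iff, and_iff_left h1, ← not_lt, ← Nat.succ_le_iff]
    change ¬ 2 ≤ _ ↔ _
    rw [two_le_outDeg]
    grind
  have h4 : G.inDeg (G.tgt e) = 1 ↔ ∀ e', G.tgt e' = G.tgt e → e' = e := by
    rw [le_antisymm_iff, and_iff_left h2, ← not_lt, ← Nat.succ_le_iff]
    change ¬ 2 ≤ _ ↔ _
    rw [two_le_inDeg]
    grind
  rw [Contractible, h3, h4, Lone]

/-- The maps of a contraction of the edge `e`: the vertices map forward, the edges backward. -/
structure ContractionMap (K : MultiDigraph) (e : K.E) (A : MultiDigraph) (f : K.V → A.V)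
    (τ : A.E → K.E) : Prop where
  surj : Function.Surjective f
  ker : ∀ x y, f x = f y ↔
    x = y ∨ (x = K.src e ∧ y = K.tgt e) ∨ (x = K.tgt e ∧ y = K.src e)
  inj : Function.Injective τ
  range : ∀ x, x ≠ e ↔ ∃ y, τ y = x
  src_eq : ∀ y, A.src y = f (K.src (τ y))
  tgt_eq : ∀ y, A.tgt y = f (K.tgt (τ y))

theorem isContraction_iff {K A : MultiDigraph} {e : K.E} :
    K.IsContraction e A ↔ ∃ f τ, ContractionMap K e A f τ := by
  constructor
  · rintro ⟨f, s, h1, h2, h3, h4⟩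
    refine ⟨f, fun y => (s.symm y).1, h1, h2, fun y y' h => ?_, fun x => ⟨fun hx => ?_, ?_⟩,
      fun y => ?_, fun y => ?_⟩
    · exact s.symm.injective (Subtype.ext h)
    · exact ⟨s ⟨x, hx⟩, by simp⟩
    · rintro ⟨y, rfl⟩
      exact (s.symm y).2
    · simpa using h3 (s.symm y)
    · simpa using h4 (s.symm y)
  · rintro ⟨f, τ, h⟩
    have hb : Function.Bijective (fun y => (⟨τ y, (h.range _).mpr ⟨y, rfl⟩⟩ : {x // x ≠ e})) := by
      refine ⟨fun y y' hy => h.inj (congrArg Subtype.val hy), fun ⟨x, hx⟩ => ?_⟩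
      obtain ⟨y, rfl⟩ := (h.range x).mp hx
      exact ⟨y, rfl⟩
    have hs : ∀ x, τ ((Equiv.ofBijective _ hb).symm x) = x.1 := fun x =>
      congrArg Subtype.val ((Equiv.ofBijective _ hb).apply_symm_apply x)
    refine ⟨f, (Equiv.ofBijective _ hb).symm, h.surj, h.ker, fun x => ?_, fun x => ?_⟩
    · rw [h.src_eq, hs]
    · rw [h.tgt_eq, hs]

/-- If `e` is the only edge out of its tail, semistability gives the tail two inward edges, and the
merged vertex inherits them; it keeps an outward edge from the head. The other case is symmetric.
Since `e` is no loop, none of the inherited edges is `e` itself. -/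
theorem semistable_of_contraction {K A : MultiDigraph} {e : K.E} {f : K.V → A.V} {τ : A.E → K.E}
    (h : ContractionMap K e A f τ) (hne : K.src e ≠ K.tgt e) :
    (K.Semistable → K.Lone e → A.Semistable) := by
  simp only [semistable_iff]
  intro hK hl
  have lift : ∀ x, x ≠ e → ∃ y, τ y = x := fun x => (h.range x).mp
  have hin : ∀ v, v ≠ K.tgt e → (∃ y, A.tgt y = f v) := by
    intro v hv
    obtain ⟨x, hx⟩ := (hK v).1
    obtain ⟨y, rfl⟩ := lift x (by rintro rfl; exact hv hx.symm)
    exact ⟨y, by rw [h.tgt_eq, hx]⟩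
  have hout : ∀ v, v ≠ K.src e → (∃ y, A.src y = f v) := by
    intro v hv
    obtain ⟨x, hx⟩ := (hK v).2.1
    obtain ⟨y, rfl⟩ := lift x (by rintro rfl; exact hv hx.symm)
    exact ⟨y, by rw [h.src_eq, hx]⟩
  have hin2 : ∀ v, v ≠ K.tgt e → (∃ x x', x ≠ x' ∧ K.tgt x = v ∧ K.tgt x' = v) →
      ∃ y y', y ≠ y' ∧ A.tgt y = f v ∧ A.tgt y' = f v := by
    rintro v hv ⟨x, x', hxx, hx, hx'⟩
    obtain ⟨y, rfl⟩ := lift x (by rintro rfl; exact hv hx.symm)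
    obtain ⟨y', rfl⟩ := lift x' (by rintro rfl; exact hv hx'.symm)
    exact ⟨y, y', fun hy => hxx (hy ▸ rfl), by rw [h.tgt_eq, hx], by rw [h.tgt_eq, hx']⟩
  have hout2 : ∀ v, v ≠ K.src e → (∃ x x', x ≠ x' ∧ K.src x = v ∧ K.src x' = v) →
      ∃ y y', y ≠ y' ∧ A.src y = f v ∧ A.src y' = f v := by
    rintro v hv ⟨x, x', hxx, hx, hx'⟩
    obtain ⟨y, rfl⟩ := lift x (by rintro rfl; exact hv hx.symm)
    obtain ⟨y', rfl⟩ := lift x' (by rintro rfl; exact hv hx'.symm)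
    exact ⟨y, y', fun hy => hxx (hy ▸ rfl), by rw [h.src_eq, hx], by rw [h.src_eq, hx']⟩
  have hmerge : f (K.src e) = f (K.tgt e) := (h.ker _ _).mpr (Or.inr (Or.inl ⟨rfl, rfl⟩))
  intro z
  obtain ⟨v, rfl⟩ := h.surj z
  by_cases hv : f v = f (K.src e)
  · refine ⟨?_, ?_, ?_⟩
    · rw [hv]; exact hin _ hne
    · rw [hv, hmerge]; exact hout _ hne.symm
    · rcases hl with hl | hl
      · rcases (hK (K.src e)).2.2 with h2 | ⟨x, x', hxx, hx, hx'⟩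
        · left; rw [hv]; exact hin2 _ hne h2
        · exact absurd ((hl x hx).trans (hl x' hx').symm) hxx
      · rcases (hK (K.tgt e)).2.2 with ⟨x, x', hxx, hx, hx'⟩ | h2
        · exact absurd ((hl x hx).trans (hl x' hx').symm) hxx
        · right; rw [hv, hmerge]; exact hout2 _ hne.symm h2
  · have h1 : v ≠ K.src e := fun hh => hv (hh ▸ rfl)
    have h2 : v ≠ K.tgt e := fun hh => hv (by rw [hmerge, hh])
    exact ⟨hin v h2, hout v h1, (hK v).2.2.imp (hin2 v h2) (hout2 v h1)⟩

/-- Merging could only spoil uniqueness if the merged vertex brought in a new edge with the same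
tail or head. Then one end of `e` would have just one inward and one outward edge, which
semistability excludes. -/
theorem lone_of_contraction {K A : MultiDigraph} {e : K.E} {f : K.V → A.V} {τ : A.E → K.E}
    (h : ContractionMap K e A f τ) (hne : K.src e ≠ K.tgt e) (hK : K.Semistable) (hl : K.Lone e)
    {y : A.E} (hy : K.Lone (τ y)) : A.Lone y := by
  rw [semistable_iff] at hK
  have hye : τ y ≠ e := (h.range _).mpr ⟨y, rfl⟩
  rcases hy with hy | hy
  · left
    intro y' h1
    rw [h.src_eq, h.src_eq, h.ker] at h1
    have hye' : τ y' ≠ e := (h.range _).mpr ⟨y', rfl⟩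
    rcases h1 with h1 | ⟨h1, h2⟩ | ⟨h1, h2⟩
    · exact h.inj (hy _ h1)
    · rcases hl with hl | hl
      · exact absurd (hl _ h1) hye'
      · rcases (hK (K.tgt e)).2.2 with ⟨x, x', hxx, hx, hx'⟩ | ⟨x, x', hxx, hx, hx'⟩
        · exact absurd ((hl x hx).trans (hl x' hx').symm) hxx
        · exact absurd ((hy x (hx.trans h2.symm)).trans (hy x' (hx'.trans h2.symm)).symm) hxx
    · exact absurd (hy e h2.symm).symm hye
  · right
    intro y' h1
    rw [h.tgt_eq, h.tgt_eq, h.ker] at h1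
    have hye' : τ y' ≠ e := (h.range _).mpr ⟨y', rfl⟩
    rcases h1 with h1 | ⟨h1, h2⟩ | ⟨h1, h2⟩
    · exact h.inj (hy _ h1)
    · exact absurd (hy e h2.symm).symm hye
    · rcases hl with hl | hl
      · rcases (hK (K.src e)).2.2 with ⟨x, x', hxx, hx, hx'⟩ | ⟨x, x', hxx, hx, hx'⟩
        · exact absurd ((hy x (hx.trans h2.symm)).trans (hy x' (hx'.trans h2.symm)).symm) hxx
        · exact absurd ((hl x hx).trans (hl x' hx').symm) hxx
      · exact absurd (hl _ h1) hye'

theorem contraction_unique {K A B : MultiDigraph} {e : K.E} {f : K.V → A.V} {τ : A.E → K.E}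
    {g : K.V → B.V} {σ : B.E → K.E} (h : ContractionMap K e A f τ)
    (h' : ContractionMap K e B g σ) : Nonempty (Iso A B) := by
  choose r hr using h.surj
  choose u hu using fun y => (h'.range (τ y)).mp ((h.range _).mpr ⟨y, rfl⟩)
  have hg : ∀ x, g (r (f x)) = g x := fun x => by rw [h'.ker, ← h.ker, hr]
  have hV : Function.Bijective fun v => g (r v) := by
    refine ⟨fun v v' hv => ?_, fun z => ?_⟩
    · change g (r v) = g (r v') at hv
      rw [h'.ker, ← h.ker, hr, hr] at hv
      exact hv
    · obtain ⟨x, rfl⟩ := h'.surj z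
      exact ⟨f x, hg x⟩
  have hE : Function.Bijective u := by
    refine ⟨fun y y' hy => h.inj (by rw [← hu y, ← hu y', hy]), fun z => ?_⟩
    obtain ⟨y, hy⟩ := (h.range (σ z)).mp ((h'.range _).mpr ⟨z, rfl⟩)
    exact ⟨y, h'.inj (by rw [hu, hy])⟩
  refine ⟨⟨Equiv.ofBijective _ hV, Equiv.ofBijective _ hE, fun y => ?_, fun y => ?_⟩⟩
  · simp only [Equiv.ofBijective_apply]
    rw [h'.src_eq, hu, h.src_eq, hg]
  · simp only [Equiv.ofBijective_apply]
    rw [h'.tgt_eq, hu, h.tgt_eq, hg]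

theorem exists_contraction {K : MultiDigraph} {e : K.E} (hne : K.src e ≠ K.tgt e) :
    ∃ A f τ, ContractionMap K e A f τ := by
  classical
  let g : K.V → {v : K.V // v ≠ K.tgt e} := fun x =>
    if hx : x = K.tgt e then ⟨K.src e, hne⟩ else ⟨x, hx⟩
  refine ⟨⟨{v : K.V // v ≠ K.tgt e}, {x : K.E // x ≠ e}, fun y => g (K.src y.1),
    fun y => g (K.tgt y.1)⟩, g, Subtype.val, fun v => ⟨v.1, by simp [g, v.2]⟩, fun x y => ?_,
    Subtype.val_injective, fun x => ⟨fun hx => ⟨⟨x, hx⟩, rfl⟩, ?_⟩, fun _ => rfl, fun _ => rfl⟩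
  · simp only [g]
    split_ifs with h1 h2 h2 <;> simp only [Subtype.mk.injEq] <;> grind
  · rintro ⟨y, rfl⟩
    exact y.2

/-- Contracting two edges in either order gives the quotient by the equivalence relation generated
by their two pairs of ends. Hence `C`, a contraction of K/f, is also one of K/e. -/
theorem contraction_comm {K A B C : MultiDigraph} {e f : K.E} {φA : K.V → A.V} {τA : A.E → K.E}
    {φB : K.V → B.V} {τB : B.E → K.E} {φC : B.V → C.V} {τC : C.E → B.E}
    (hA : ContractionMap K e A φA τA) (hB : ContractionMap K f B φB τB) {e' : B.E} {f' : A.E}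
    (he : τB e' = e) (hf : τA f' = f) (hC : ContractionMap B e' C φC τC) :
    ∃ φ τ, ContractionMap A f' C φ τ := by
  choose r hr using hA.surj
  have hne : e ≠ f := (hB.range e).mpr ⟨e', he⟩
  have hCr : ∀ y, τB (τC y) ≠ e := by
    intro y hy
    rw [← he] at hy
    exact (hC.range (τC y)).mpr ⟨y, rfl⟩ (hB.inj hy)
  choose u hu using fun y => (hA.range (τB (τC y))).mp (hCr y)
  have hker : ∀ x y, φC (φB x) = φC (φB y) ↔ φA x = φA y ∨
      (φA x = φA (K.src f) ∧ φA y = φA (K.tgt f)) ∨ (φA x = φA (K.tgt f) ∧ φA y = φA (K.src f)) := by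
    intro x y
    rw [hC.ker, hB.src_eq, hB.tgt_eq, he]
    simp only [hA.ker, hB.ker]
    grind
  have hfac : ∀ x, φC (φB (r (φA x))) = φC (φB x) := fun x => by
    rw [hker]; exact Or.inl (hr _)
  refine ⟨fun v => φC (φB (r v)), u, fun z => ?_, fun v w => ?_, fun y y' hy => ?_,
    fun x => ⟨fun hx => ?_, ?_⟩, fun y => ?_, fun y => ?_⟩
  · obtain ⟨w, rfl⟩ := hC.surj z
    obtain ⟨x, rfl⟩ := hB.surj w
    exact ⟨φA x, hfac x⟩
  · rw [hker, hr, hr, hA.src_eq, hA.tgt_eq, hf]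
  · exact hC.inj (hB.inj (by rw [← hu, ← hu, hy]))
  · have h1 : τA x ≠ f := fun h => hx (hA.inj (h.trans hf.symm))
    obtain ⟨w, hw⟩ := (hB.range _).mp h1
    have h2 : w ≠ e' := by
      rintro rfl
      exact (hA.range (τA x)).mpr ⟨x, rfl⟩ (hw.symm.trans he)
    obtain ⟨y, rfl⟩ := (hC.range _).mp h2
    exact ⟨y, hA.inj (by rw [hu, hw])⟩
  · rintro ⟨y, rfl⟩ rfl
    exact (hB.range (τB (τC y))).mpr ⟨_, rfl⟩ (by rw [← hu, hf])
  · rw [hC.src_eq, hB.src_eq, hA.src_eq, hu, hfac]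
  · rw [hC.tgt_eq, hB.tgt_eq, hA.tgt_eq, hu, hfac]

/-! ### Isomorphisms, and independence of the stabilization from the choice of contractions -/

/-- Isomorphisms, inverted. -/
def Iso.symm {G H : MultiDigraph} (i : Iso G H) : Iso H G where
  vertexEquiv := i.vertexEquiv.symm
  edgeEquiv := i.edgeEquiv.symm
  src_map e := by rw [Equiv.eq_symm_apply, ← i.src_map, Equiv.apply_symm_apply]
  tgt_map e := by rw [Equiv.eq_symm_apply, ← i.tgt_map, Equiv.apply_symm_apply]

/-- Isomorphisms, composed. -/
def Iso.trans {G H K : MultiDigraph} (i : Iso G H) (j : Iso H K) : Iso G K where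
  vertexEquiv := i.vertexEquiv.trans j.vertexEquiv
  edgeEquiv := i.edgeEquiv.trans j.edgeEquiv
  src_map e := by simp [i.src_map, j.src_map]
  tgt_map e := by simp [i.tgt_map, j.tgt_map]

/-- The identity isomorphism. -/
def Iso.refl (G : MultiDigraph) : Iso G G := ⟨Equiv.refl _, Equiv.refl _, fun _ => rfl, fun _ => rfl⟩

theorem Iso.outDeg {G H : MultiDigraph} (i : Iso G H) (v : G.V) :
    H.outDeg (i.vertexEquiv v) = G.outDeg v := by
  refine (Nat.card_congr (i.edgeEquiv.subtypeEquiv fun e => ?_)).symm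
  rw [i.src_map, i.vertexEquiv.apply_eq_iff_eq]

theorem Iso.inDeg {G H : MultiDigraph} (i : Iso G H) (v : G.V) :
    H.inDeg (i.vertexEquiv v) = G.inDeg v := by
  refine (Nat.card_congr (i.edgeEquiv.subtypeEquiv fun e => ?_)).symm
  rw [i.tgt_map, i.vertexEquiv.apply_eq_iff_eq]

theorem Iso.semistable {G H : MultiDigraph} (i : Iso G H) (hG : G.Semistable) : H.Semistable := by
  intro v
  obtain ⟨v, rfl⟩ := i.vertexEquiv.surjective v
  rw [i.outDeg, i.inDeg]
  exact hG v

theorem Iso.contractionStep {G H K : MultiDigraph} (i : Iso G H) (h : ContractionStep H K) :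
    ContractionStep G K := by
  obtain ⟨e, hc, hK⟩ := h
  obtain ⟨f, τ, h⟩ := isContraction_iff.mp hK
  obtain ⟨e, rfl⟩ := i.edgeEquiv.surjective e
  refine ⟨e, ?_, isContraction_iff.mpr ⟨fun v => f (i.vertexEquiv v),
    fun y => i.edgeEquiv.symm (τ y), h.surj.comp i.vertexEquiv.surjective, fun x y => ?_,
    i.edgeEquiv.symm.injective.comp h.inj, fun x => ?_, fun y => ?_, fun y => ?_⟩⟩
  · rw [Contractible, i.src_map, i.tgt_map, i.outDeg, i.inDeg, Ne,
      i.vertexEquiv.apply_eq_iff_eq] at hc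
    exact hc
  · rw [h.ker, i.src_map, i.tgt_map]
    simp only [i.vertexEquiv.apply_eq_iff_eq]
  · rw [← i.edgeEquiv.injective.ne_iff, h.range]
    simp only [Equiv.symm_apply_eq]
  · rw [h.src_eq, ← i.src_map, Equiv.apply_symm_apply]
  · rw [h.tgt_eq, ← i.tgt_map, Equiv.apply_symm_apply]

theorem Iso.isStabilization {G H K : MultiDigraph} (i : Iso G H) (h : H.IsStabilization K) :
    G.IsStabilization K := by
  obtain ⟨hK, L, hL, ⟨j⟩⟩ := h
  refine ⟨hK, ?_⟩
  rcases Relation.ReflTransGen.cases_head hL with rfl | ⟨M, hM, hML⟩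
  · exact ⟨G, .refl, ⟨i.trans j⟩⟩
  · exact ⟨L, .head (i.contractionStep hM) hML, ⟨j⟩⟩

theorem not_lone_of_stable {G : MultiDigraph} (hG : G.Stable) (e : G.E) : ¬ G.Lone e := by
  rintro (h | h)
  · obtain ⟨x, x', hxx, hx, hx'⟩ := two_le_outDeg.mp (hG (G.src e)).2
    exact hxx ((h x hx).trans (h x' hx').symm)
  · obtain ⟨x, x', hxx, hx, hx'⟩ := two_le_inDeg.mp (hG (G.tgt e)).1
    exact hxx ((h x hx).trans (h x' hx').symm)

theorem Iso.lone {G H : MultiDigraph} (i : Iso G H) {e : G.E} (h : G.Lone e) :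
    H.Lone (i.edgeEquiv e) := by
  rcases h with h | h
  · left
    intro x hx
    obtain ⟨x, rfl⟩ := i.edgeEquiv.surjective x
    rw [i.src_map, i.src_map, i.vertexEquiv.apply_eq_iff_eq] at hx
    rw [h x hx]
  · right
    intro x hx
    obtain ⟨x, rfl⟩ := i.edgeEquiv.surjective x
    rw [i.tgt_map, i.tgt_map, i.vertexEquiv.apply_eq_iff_eq] at hx
    rw [h x hx]

/-- A lone edge of a stabilizable graph is no loop, and its contraction does not change the
stabilization. -/
theorem stabilization_of_lone {K G : MultiDigraph} (hK : K.Semistable) (hG : K.IsStabilization G) :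
    ∀ e, K.Lone e → K.src e ≠ K.tgt e ∧
      ∀ A f τ, ContractionMap K e A f τ → A.IsStabilization G := by
  obtain ⟨hGs, L, hL, ⟨j⟩⟩ := hG
  induction hL using Relation.ReflTransGen.head_induction_on with
  | refl =>
    intro e he
    exact absurd (j.lone he) (not_lone_of_stable hGs _)
  | head hstep hrest ih =>
    rename_i K B
    intro e he
    obtain ⟨f, hfc, hB⟩ := hstep
    obtain ⟨φB, τB, hB⟩ := isContraction_iff.mp hB
    rw [contractible_iff] at hfc
    obtain ⟨hfne, hfl⟩ := hfc
    have hBs : B.IsStabilization G := ⟨hGs, L, hrest, ⟨j⟩⟩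
    have hBss := semistable_of_contraction hB hfne hK hfl
    by_cases hef : e = f
    · subst hef
      refine ⟨hfne, fun A φ τ hA => ?_⟩
      obtain ⟨i⟩ := contraction_unique hA hB
      exact i.isStabilization hBs
    -- A diamond argument: the given sequence starts with K → K/f = B. The induction hypothesis
    -- applies to `e` in B, and B/e is also A/f.
    · obtain ⟨e', rfl⟩ := (hB.range e).mp hef
      obtain ⟨hne, hcon⟩ := ih hBss e' (lone_of_contraction hB hfne hK hfl he)
      rw [hB.src_eq, hB.tgt_eq] at hne
      have hne' : K.src (τB e') ≠ K.tgt (τB e') := fun h => hne (by rw [h])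
      refine ⟨hne', fun A φ τ hA => ?_⟩
      obtain ⟨f', rfl⟩ := (hA.range f).mp (Ne.symm hef)
      obtain ⟨C, φC, τC, hC⟩ := exists_contraction (K := B) (e := e')
        (by rwa [hB.src_eq, hB.tgt_eq])
      obtain ⟨φ', τ', h'⟩ := contraction_comm hA hB rfl rfl hC
      have hl' := lone_of_contraction hA hne' hK he hfl
      have hne'' : A.src f' ≠ A.tgt f' := by
        -- If `f` became a loop in A, then `e` and `f` would join the same two vertices, and `e`
        -- would be a loop in B.
        rw [hA.src_eq, hA.tgt_eq, Ne, hA.ker]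
        rw [Ne, hB.ker] at hne
        grind
      obtain ⟨-, M, hM, hMG⟩ := hcon C φC τC hC
      exact ⟨hGs, M, .head ⟨f', contractible_iff.mpr ⟨hne'', hl'⟩,
        isContraction_iff.mpr ⟨φ', τ', h'⟩⟩ hM, hMG⟩

/-- A stable graph is its own stabilization, and has no other. -/
theorem iso_of_stable {H G : MultiDigraph} (hH : H.Stable) (h : H.IsStabilization G) :
    Nonempty (Iso H G) := by
  obtain ⟨-, L, hL, hLG⟩ := h
  rcases Relation.ReflTransGen.cases_head hL with rfl | ⟨M, ⟨e, he, -⟩, -⟩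
  · exact hLG
  · exact absurd (contractible_iff.mp he).2 (not_lone_of_stable hH e)

theorem Stable.semistable {G : MultiDigraph} (hG : G.Stable) : G.Semistable := fun v => by
  have := hG v
  omega

/-- The graph with all edges reversed. -/
def op (G : MultiDigraph) : MultiDigraph := ⟨G.V, G.E, G.tgt, G.src⟩

theorem op_semistable {G : MultiDigraph} (h : G.Semistable) : G.op.Semistable := fun v => by
  have := h v
  change 1 ≤ G.outDeg v ∧ 1 ≤ G.inDeg v ∧ 3 ≤ G.outDeg v + G.inDeg v
  omega

theorem op_contractionStep {G H : MultiDigraph} (h : ContractionStep G H) :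
    ContractionStep G.op H.op := by
  obtain ⟨e, he, hc⟩ := h
  rw [isContraction_iff] at hc
  rw [contractible_iff] at he
  obtain ⟨f, τ, h⟩ := hc
  refine ⟨e, contractible_iff.mpr ⟨he.1.symm, he.2.symm⟩, isContraction_iff.mpr ⟨f, τ, h.surj,
    fun x y => ?_, h.inj, h.range, h.tgt_eq, h.src_eq⟩⟩
  exact (h.ker x y).trans (or_congr_right or_comm)

/-- Reversal of edges exchanges barred and unbarred indices, so the cancellation for outward edges
also settles the conjugate one. -/
theorem op_isStabilization {H G : MultiDigraph} (h : H.IsStabilization G) :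
    H.op.IsStabilization G.op := by
  obtain ⟨hG, L, hL, ⟨j⟩⟩ := h
  exact ⟨fun v => (hG v).symm, L.op, hL.lift op fun _ _ => op_contractionStep,
    ⟨⟨j.vertexEquiv, j.edgeEquiv, j.tgt_map, j.src_map⟩⟩⟩

end MultiDigraph

end WeylGraph

namespace WeylGraph

open MultiDigraph

/-! ### Evaluation of graphs on jets -/

section JetEval

open scoped Classical

variable {n : ℕ}

theorem cnt_map {ε ε' : Type*} (f : ε ↪ ε') (S : Finset ε) (a : ε' → Fin n) :
    cnt (S.map f) a = cnt S (fun e => a (f e)) := by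
  simp only [cnt, Finset.sum_map]

/-- The edges with tail `v`. -/
noncomputable def outE (H : MultiDigraph) (v : H.V) : Finset H.E :=
  Finset.univ.filter fun e => H.src e = v

/-- The edges with head `v`. -/
noncomputable def inE (H : MultiDigraph) (v : H.V) : Finset H.E :=
  Finset.univ.filter fun e => H.tgt e = v

theorem mem_outE {H : MultiDigraph} {v : H.V} {e : H.E} : e ∈ outE H v ↔ H.src e = v := by
  simp [outE]

theorem mem_inE {H : MultiDigraph} {v : H.V} {e : H.E} : e ∈ inE H v ↔ H.tgt e = v := by
  simp [inE]

theorem card_outE (H : MultiDigraph) (v : H.V) : (outE H v).card = H.outDeg v := by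
  rw [MultiDigraph.outDeg, Nat.card_eq_fintype_card, Fintype.card_subtype, outE]

theorem card_inE (H : MultiDigraph) (v : H.V) : (inE H v).card = H.inDeg v := by
  rw [MultiDigraph.inDeg, Nat.card_eq_fintype_card, Fintype.card_subtype, inE]

/-- The value of a graph on a jet `J` and an inverse metric `P`. -/
noncomputable def jetEval (H : MultiDigraph) (P : Matrix (Fin n) (Fin n) ℂ)
    (J : (Fin n → ℕ) → (Fin n → ℕ) → ℂ) : ℂ :=
  ∑ a : H.E → Fin n, ∑ b : H.E → Fin n,
    (∏ e, P (b e) (a e)) * ∏ v, J (cnt (outE H v) a) (cnt (inE H v) b)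

/-- The variation of the factor of the vertex `v`, when the derivatives in `R` fall on the vector
field with derivatives `ξ`. -/
noncomputable def splitTerm (H : MultiDigraph) (P : Matrix (Fin n) (Fin n) ℂ)
    (J : (Fin n → ℕ) → (Fin n → ℕ) → ℂ) (ξ : Fin n → (Fin n → ℕ) → ℂ) (v : H.V)
    (R : Finset H.E) : ℂ :=
  ∑ a : H.E → Fin n, ∑ b : H.E → Fin n, (∏ e, P (b e) (a e)) *
    ((∑ q, ξ q (cnt R a) * J (cnt (outE H v \ R) a + Pi.single q 1) (cnt (inE H v) b)) *
      ∏ w ∈ Finset.univ.erase v, J (cnt (outE H w) a) (cnt (inE H w) b))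

theorem Iso.outE {G H : MultiDigraph} (i : Iso G H) (v : G.V) :
    outE H (i.vertexEquiv v) = (outE G v).map i.edgeEquiv.toEmbedding := by
  ext e
  obtain ⟨e, rfl⟩ := i.edgeEquiv.surjective e
  simp [mem_outE, i.src_map]

theorem Iso.inE {G H : MultiDigraph} (i : Iso G H) (v : G.V) :
    inE H (i.vertexEquiv v) = (inE G v).map i.edgeEquiv.toEmbedding := by
  ext e
  obtain ⟨e, rfl⟩ := i.edgeEquiv.surjective e
  simp [mem_inE, i.tgt_map]

theorem Iso.jetEval {G H : MultiDigraph} (i : Iso G H) (P : Matrix (Fin n) (Fin n) ℂ)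
    (J : (Fin n → ℕ) → (Fin n → ℕ) → ℂ) : jetEval H P J = jetEval G P J := by
  have hs : ∀ f : (H.E → Fin n) → ℂ, ∑ a, f a = ∑ a : G.E → Fin n, f (a ∘ i.edgeEquiv.symm) :=
    fun f => (Fintype.sum_equiv (i.edgeEquiv.arrowCongr (Equiv.refl _)) _ _ fun a => rfl).symm
  unfold WeylGraph.jetEval
  rw [hs]
  refine Finset.sum_congr rfl fun a _ => ?_
  rw [hs]
  refine Finset.sum_congr rfl fun b _ => ?_
  rw [← i.edgeEquiv.prod_comp, ← i.vertexEquiv.prod_comp]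
  simp [Iso.outE, Iso.inE, cnt_map]

theorem Iso.splitTerm {G H : MultiDigraph} (i : Iso G H) (P : Matrix (Fin n) (Fin n) ℂ)
    (J : (Fin n → ℕ) → (Fin n → ℕ) → ℂ) (ξ : Fin n → (Fin n → ℕ) → ℂ) (v : G.V)
    (R : Finset G.E) :
    splitTerm H P J ξ (i.vertexEquiv v) (R.map i.edgeEquiv.toEmbedding) =
      splitTerm G P J ξ v R := by
  have hs : ∀ f : (H.E → Fin n) → ℂ, ∑ a, f a = ∑ a : G.E → Fin n, f (a ∘ i.edgeEquiv.symm) :=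
    fun f => (Fintype.sum_equiv (i.edgeEquiv.arrowCongr (Equiv.refl _)) _ _ fun a => rfl).symm
  unfold WeylGraph.splitTerm
  rw [hs]
  refine Finset.sum_congr rfl fun a _ => ?_
  rw [hs]
  refine Finset.sum_congr rfl fun b _ => ?_
  have he : Finset.univ.erase (i.vertexEquiv v) =
      (Finset.univ.erase v).map i.vertexEquiv.toEmbedding := by
    ext w
    obtain ⟨w, rfl⟩ := i.vertexEquiv.surjective w
    simp
  rw [← i.edgeEquiv.prod_comp, he, Finset.prod_map, Iso.outE, Iso.inE, ← Finset.map_sdiff]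
  simp [Iso.outE, Iso.inE, cnt_map]

/-! ### Splitting a vertex of a labelled graph -/

/-- The graph given by the tails and the heads of its edges. -/
abbrev gr {V E : Type} [Fintype V] [Fintype E] (x : (E → V) × (E → V)) : MultiDigraph :=
  ⟨V, E, x.1, x.2⟩

variable {V E : Type} [Fintype V] [Fintype E]

/-- The graph obtained by moving the tails of the edges in `R` from `v` to a new vertex, to which a
new edge leads from `v`. -/
noncomputable def splitGraph (x : (E → V) × (E → V)) (v : V) (R : Finset E) :
    (Option E → Option V) × (Option E → Option V) :=
  (fun o => o.elim (some v) fun i => if i ∈ R then none else some (x.1 i),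
    fun o => o.elim none fun i => some (x.2 i))

@[simp] theorem splitGraph_src_none (x : (E → V) × (E → V)) (v : V) (R : Finset E) :
    (splitGraph x v R).1 none = some v := rfl

@[simp] theorem splitGraph_src_some (x : (E → V) × (E → V)) (v : V) (R : Finset E) (i : E) :
    (splitGraph x v R).1 (some i) = if i ∈ R then none else some (x.1 i) := rfl

@[simp] theorem splitGraph_tgt_none (x : (E → V) × (E → V)) (v : V) (R : Finset E) :
    (splitGraph x v R).2 none = none := rfl

@[simp] theorem splitGraph_tgt_some (x : (E → V) × (E → V)) (v : V) (R : Finset E) (i : E) :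
    (splitGraph x v R).2 (some i) = some (x.2 i) := rfl

theorem sum_option_fun [DecidableEq (Option E)] {M : Type*} [AddCommMonoid M]
    (f : (Option E → Fin n) → M) :
    ∑ a, f a = ∑ a : E → Fin n, ∑ a₀, f (fun o => o.elim a₀ a) := by
  rw [Finset.sum_comm, ← Fintype.sum_prod_type']
  refine Fintype.sum_equiv Equiv.piOptionEquivProd _ _ fun a => ?_
  congr 1
  ext o
  cases o <;> rfl

theorem prod_erase_none [DecidableEq (Option V)] (f : Option V → ℂ) :
    ∏ w ∈ Finset.univ.erase none, f w = ∏ w, f (some w) := by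
  have : Finset.univ.erase (none : Option V) = Finset.univ.map Function.Embedding.some := by
    ext w; cases w <;> simp
  rw [this, Finset.prod_map]
  rfl

theorem mem_outE_gr {x : (E → V) × (E → V)} {w : V} {i : E} : i ∈ outE (gr x) w ↔ x.1 i = w :=
  mem_outE

theorem mem_inE_gr {x : (E → V) × (E → V)} {w : V} {i : E} : i ∈ inE (gr x) w ↔ x.2 i = w :=
  mem_inE

theorem outE_split_none (x : (E → V) × (E → V)) (v : V) (R : Finset E) :
    outE (gr (splitGraph x v R)) none = R.map Function.Embedding.some := by
  ext o
  rw [mem_outE]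
  cases o <;> simp

theorem inE_split_none (x : (E → V) × (E → V)) (v : V) (R : Finset E) :
    inE (gr (splitGraph x v R)) none = {none} := by
  ext o
  rw [mem_inE]
  cases o <;> simp

theorem outE_split_of_ne (x : (E → V) × (E → V)) (v : V) (R : Finset E)
    (hR : ∀ i ∈ R, x.1 i = v) {w : V} (hw : w ≠ v) :
    outE (gr (splitGraph x v R)) (some w) = (outE (gr x) w).map Function.Embedding.some := by
  ext o
  rw [mem_outE]
  cases o with
  | none => simp [Ne.symm hw]
  | some i =>
    by_cases hi : i ∈ R
    · simp only [splitGraph_src_some, hi, if_true, Finset.mem_map, reduceCtorEq, false_iff,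
        Function.Embedding.some_apply, Option.some.injEq, exists_eq_right]
      exact fun h => hw ((mem_outE_gr.mp h).symm.trans (hR i hi))
    · simp only [splitGraph_src_some, hi, if_false, Finset.mem_map, Option.some.injEq,
        Function.Embedding.some_apply, exists_eq_right]
      exact mem_outE_gr.symm

theorem outE_split_self (x : (E → V) × (E → V)) (v : V) (R : Finset E) :
    outE (gr (splitGraph x v R)) (some v) =
      insert none ((outE (gr x) v \ R).map Function.Embedding.some) := by
  ext o
  rw [mem_outE]
  cases o with
  | none => simp
  | some i =>
    by_cases hi : i ∈ R
    · simp [hi]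
    · simp only [splitGraph_src_some, hi, if_false, Option.some.injEq, Finset.mem_insert,
        reduceCtorEq, false_or, Finset.mem_map, Finset.mem_sdiff, not_false_eq_true, and_true,
        Function.Embedding.some_apply, exists_eq_right]
      exact mem_outE_gr.symm

theorem inE_split_some (x : (E → V) × (E → V)) (v : V) (R : Finset E) (w : V) :
    inE (gr (splitGraph x v R)) (some w) = (inE (gr x) w).map Function.Embedding.some := by
  ext o
  rw [mem_inE]
  cases o with
  | none => simp
  | some i =>
    simp only [splitGraph_tgt_some, Option.some.injEq, Finset.mem_map,
      Function.Embedding.some_apply, exists_eq_right]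
    exact mem_inE_gr.symm

/-- When all outward derivatives of the new vertex fall on ξ, its own factor has one unbarred and
one barred index, so it is the metric. Contraction with `P` along the new edge gives the identity,
and the index of ξ becomes the additional index at `v`, as if the derivatives in `R` had hit the
field there. -/
theorem splitTerm_splitGraph (P : Matrix (Fin n) (Fin n) ℂ)
    (J : (Fin n → ℕ) → (Fin n → ℕ) → ℂ) (ξ : Fin n → (Fin n → ℕ) → ℂ)
    (hP : Matrix.of (fun i j => J (Pi.single i 1) (Pi.single j 1)) * P = 1)
    (x : (E → V) × (E → V)) (v : V) (R : Finset E) (hR : ∀ i ∈ R, x.1 i = v) :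
    splitTerm (gr (splitGraph x v R)) P J ξ none (outE (gr (splitGraph x v R)) none) =
      splitTerm (gr x) P J ξ v R := by
  have hP' : ∀ q r, ∑ j, J (Pi.single q 1) (Pi.single j 1) * P j r = if q = r then 1 else 0 := by
    intro q r
    have := congrFun (congrFun hP q) r
    rwa [Matrix.mul_apply, Matrix.one_apply] at this
  have h1 := outE_split_none x v R
  have h2 := inE_split_none x v R
  have h3 := fun w (hw : w ≠ v) => outE_split_of_ne x v R hR hw
  have h4 := outE_split_self x v R
  have h5 := inE_split_some x v R
  have h6 : (none : Option E) ∉ (outE (gr x) v \ R).map Function.Embedding.some := by simp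
  unfold splitTerm
  have hsum := @sum_option_fun n E _ (fun a b => Classical.propDecidable (a = b)) ℂ _
  refine (hsum _).trans ?_
  refine Finset.sum_congr rfl fun a _ => ?_
  refine (Finset.sum_congr rfl fun a₀ _ => hsum _).trans ?_
  rw [Finset.sum_comm]
  refine Finset.sum_congr rfl fun b _ => ?_
  have hpe : ∀ f : Option E → ℂ, ∏ e, f e = f none * ∏ e : E, f (some e) := Fintype.prod_option
  have c1 : ∀ a₀, cnt (outE (gr (splitGraph x v R)) none) (fun o : Option E => o.elim a₀ a) = cnt R a := by
    intro a₀; rw [h1, cnt_map]; rfl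
  have c2 : ∀ b₀, cnt (inE (gr (splitGraph x v R)) none) (fun o : Option E => o.elim b₀ b) = Pi.single b₀ 1 := by
    intro b₀; rw [h2, cnt_singleton]; rfl
  have c3 : ∀ a₀ w, w ≠ v → cnt (outE (gr (splitGraph x v R)) (some w)) (fun o : Option E => o.elim a₀ a) =
      cnt (outE (gr x) w) a := by
    intro a₀ w hw; rw [h3 w hw, cnt_map]; rfl
  have c4 : ∀ a₀, cnt (outE (gr (splitGraph x v R)) (some v)) (fun o : Option E => o.elim a₀ a) =
      cnt (outE (gr x) v \ R) a + Pi.single a₀ 1 := by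
    intro a₀; rw [h4, cnt_insert h6, cnt_map]; rfl
  have c5 : ∀ b₀ w, cnt (inE (gr (splitGraph x v R)) (some w)) (fun o : Option E => o.elim b₀ b) =
      cnt (inE (gr x) w) b := by
    intro b₀ w; rw [h5, cnt_map]; rfl
  have hsd : ∀ (inst : DecidableEq (Option E)) (S : Finset (Option E)),
      @SDiff.sdiff _ (@Finset.instSDiff _ inst) S S = ∅ := fun _ S => Finset.sdiff_self S
  set rest := ∏ w ∈ Finset.univ.erase v, J (cnt (outE (gr x) w) a) (cnt (inE (gr x) w) b) with hrest
  have hv : ∀ (inst : DecidableEq (Option V)) a₀ b₀, ∏ w ∈ @Finset.erase _ inst Finset.univ none,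
      J (cnt (outE (gr (splitGraph x v R)) w) (fun o : Option E => o.elim a₀ a))
        (cnt (inE (gr (splitGraph x v R)) w) (fun o : Option E => o.elim b₀ b)) =
      J (cnt (outE (gr x) v \ R) a + Pi.single a₀ 1) (cnt (inE (gr x) v) b) * rest := by
    intro inst a₀ b₀
    rw [prod_erase_none, ← Finset.mul_prod_erase _ _ (Finset.mem_univ v), c4, c5, hrest]
    congr 1
    refine Finset.prod_congr rfl fun w hw => ?_
    rw [c3 _ _ (Finset.ne_of_mem_erase hw), c5]
  have : ∀ a₀ : Fin n, ∑ b₀, P b₀ a₀ * (∏ e : E, P (b e) (a e)) *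
      ((∑ q, ξ q (cnt R a) * J (Pi.single q 1) (Pi.single b₀ 1)) *
        (J (cnt (outE (gr x) v \ R) a + Pi.single a₀ 1) (cnt (inE (gr x) v) b) * rest)) =
      (∏ e : E, P (b e) (a e)) * (ξ a₀ (cnt R a) *
        J (cnt (outE (gr x) v \ R) a + Pi.single a₀ 1) (cnt (inE (gr x) v) b) * rest) := by
    intro a₀
    -- The metric at the new vertex meets its inverse on the new edge; summing over the barred label
    -- `b₀` identifies q with `a₀`.
    have h7 : ∑ b₀, (∑ q, ξ q (cnt R a) * J (Pi.single q 1) (Pi.single b₀ 1)) * P b₀ a₀ =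
        ξ a₀ (cnt R a) := by
      simp only [Finset.sum_mul]
      rw [Finset.sum_comm]
      simp only [mul_assoc, ← Finset.mul_sum, hP']
      simp
    rw [← h7, Finset.sum_mul, Finset.sum_mul, Finset.mul_sum]
    exact Finset.sum_congr rfl fun b₀ _ => by ring
  refine (Finset.sum_congr rfl fun a₀ _ => (Finset.sum_congr rfl fun b₀ _ => ?_).trans
    (this a₀)).trans ?_
  · refine congrArg₂ _ (hpe _) (congrArg₂ _ (Finset.sum_congr rfl fun q _ => ?_) (hv _ a₀ b₀))
    refine congrArg₂ _ (congrArg _ (c1 a₀)) (congrArg₂ J ?_ (c2 b₀))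
    exact (congrArg (fun S => cnt S _ + Pi.single q 1) (hsd _ _)).trans (zero_add _)
  · rw [← Finset.mul_sum, ← Finset.sum_mul]

end JetEval

end WeylGraph

namespace WeylGraph

open MultiDigraph

/-! ### Cancellation in the variation of the sum over graphs -/

section Cancellation

open scoped Classical

/-- The graph `H` is semistable, with stabilization graph `G`. -/
def Stab (G H : MultiDigraph) : Prop := H.Semistable ∧ H.IsStabilization G

theorem Iso.stab {G H K : MultiDigraph} (i : Iso H K) (h : Stab G H) : Stab G K :=
  ⟨i.semistable h.1, i.symm.isStabilization h.2⟩

theorem Iso.stab_iff {G H K : MultiDigraph} (i : Iso H K) : Stab G H ↔ Stab G K :=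
  ⟨Iso.stab i, Iso.stab i.symm⟩

variable {V E : Type} [Fintype V] [Fintype E]

theorem contractionMap_split (x : (E → V) × (E → V)) (v : V) (R : Finset E)
    (hR : ∀ i ∈ R, x.1 i = v) :
    ContractionMap (gr (splitGraph x v R)) none (gr x) (fun o : Option V => o.getD v)
      (some : E → Option E) where
  surj w := ⟨some w, rfl⟩
  ker a b := by
    change a.getD v = b.getD v ↔ a = b ∨ (a = some v ∧ b = none) ∨ (a = none ∧ b = some v)
    cases a <;> cases b <;> simp [eq_comm]
  inj := Option.some_injective E
  range o := by
    cases o with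
    | none => simp
    | some i => simp
  src_eq i := by
    by_cases hi : i ∈ R
    · simp [hi, hR i hi]
    · simp [hi]
  tgt_eq i := by simp

theorem lone_split (x : (E → V) × (E → V)) (v : V) (R : Finset E) :
    (gr (splitGraph x v R)).Lone none := by
  right
  intro e he
  cases e with
  | none => rfl
  | some i => simp at he

/-- The new vertex has one inward edge and |R| ≥ 2 outward ones. At `v` the edges of `R` are
replaced by the single new edge, so it loses semistability only if that is its sole outward edge and
it has one inward edge, which is the case excluded by `hb`. -/
theorem semistable_split {x : (E → V) × (E → V)} {v : V} {R : Finset E}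
    (hR : ∀ i ∈ R, x.1 i = v) (h2 : 2 ≤ R.card)
    (hb : ¬((inE (gr x) v).card = 1 ∧ R = outE (gr x) v)) (h : (gr x).Semistable) :
    (gr (splitGraph x v R)).Semistable := by
  rw [semistable_iff] at h ⊢
  intro o
  cases o with
  | none =>
    refine ⟨⟨none, rfl⟩, ?_, Or.inr ?_⟩
    · obtain ⟨i, hi⟩ := Finset.card_pos.mp (by omega : 0 < R.card)
      exact ⟨some i, by simp [hi]⟩
    · obtain ⟨i, hi, j, hj, hij⟩ := Finset.one_lt_card.mp h2
      exact ⟨some i, some j, by simpa using hij, by simp [hi], by simp [hj]⟩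
  | some w =>
    obtain ⟨⟨i, hi⟩, ⟨j, hj⟩, h3⟩ := h w
    replace hi : x.2 i = w := hi
    replace hj : x.1 j = w := hj
    have hin : (∃ e e', e ≠ e' ∧ (gr x).tgt e = w ∧ (gr x).tgt e' = w) →
        ∃ e e', e ≠ e' ∧ (gr (splitGraph x v R)).tgt e = some w ∧
          (gr (splitGraph x v R)).tgt e' = some w := by
      rintro ⟨e, e', hne, he, he'⟩
      exact ⟨some e, some e', by simpa using hne, congrArg some he, congrArg some he'⟩
    refine ⟨⟨some i, by simp [hi]⟩, ?_, ?_⟩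
    · by_cases hw : w = v
      · exact ⟨none, by simp [hw]⟩
      · have hjR : j ∉ R := fun hjR => hw (hj.symm.trans (hR j hjR))
        exact ⟨some j, by simp [hjR, hj]⟩
    · by_cases hw : w = v
      · subst hw
        by_cases h4 : (inE (gr x) w).card = 1
        · right
          have h5 : R ≠ outE (gr x) w := fun h5 => hb ⟨h4, h5⟩
          have h6 : R ⊆ outE (gr x) w := fun e he => mem_outE_gr.mpr (hR e he)
          obtain ⟨e, he, heR⟩ := Finset.exists_of_ssubset (lt_of_le_of_ne h6 h5)
          exact ⟨none, some e, by simp, by simp, by simp [heR, mem_outE_gr.mp he]⟩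
        · left
          apply hin
          have h5 : 0 < (inE (gr x) w).card := Finset.card_pos.mpr ⟨i, mem_inE.mpr hi⟩
          obtain ⟨e, he, e', he', hne⟩ := Finset.one_lt_card.mp
            (by omega : 1 < (inE (gr x) w).card)
          exact ⟨e, e', hne, mem_inE.mp he, mem_inE.mp he'⟩
      · refine h3.imp hin ?_
        rintro ⟨e, e', hne, he, he'⟩
        replace he : x.1 e = w := he
        replace he' : x.1 e' = w := he'
        have h1 : e ∉ R := fun hm => hw (he.symm.trans (hR e hm))
        have h1' : e' ∉ R := fun hm => hw (he'.symm.trans (hR e' hm))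
        exact ⟨some e, some e', by simpa using hne, by simp [h1, he], by simp [h1', he']⟩

/-- The new edge is the only one with its head, and contracting it restores the original graph. One
direction is the independence of the stabilization from the contracted edge, the other puts this
contraction in front of a given sequence. -/
theorem stab_split {G : MultiDigraph} {x : (E → V) × (E → V)} {v : V} {R : Finset E}
    (hR : ∀ i ∈ R, x.1 i = v) (h2 : 2 ≤ R.card)
    (hb : ¬((inE (gr x) v).card = 1 ∧ R = outE (gr x) v)) :
    Stab G (gr (splitGraph x v R)) ↔ Stab G (gr x) := by
  have hc := contractionMap_split x v R hR
  have hl := lone_split x v R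
  have hne : (gr (splitGraph x v R)).src none ≠ (gr (splitGraph x v R)).tgt none := by simp
  constructor
  · rintro ⟨h, h'⟩
    exact ⟨semistable_of_contraction hc hne h hl,
      (stabilization_of_lone h h' none hl).2 _ _ _ hc⟩
  · rintro ⟨h, hG, L, hL, hLG⟩
    exact ⟨semistable_split hR h2 hb h, hG, L, .head ⟨none, contractible_iff.mpr ⟨hne, hl⟩,
      isContraction_iff.mpr ⟨_, _, hc⟩⟩ hL, hLG⟩

/-- The only edge into the marked vertex is no loop, since the graph is stabilizable; contracting it
recovers the original graph. The two conditions on `R` express semistability at the marked vertex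
and at the tail of the marked edge. -/
theorem exists_split {G : MultiDigraph} (y : (Option E → Option V) × (Option E → Option V))
    (hy : Stab G (gr y)) (hin : inE (gr y) none = {none}) :
    ∃ (x : (E → V) × (E → V)) (v : V) (R : Finset E), (∀ i ∈ R, x.1 i = v) ∧ 2 ≤ R.card ∧
      ¬((inE (gr x) v).card = 1 ∧ R = outE (gr x) v) ∧ splitGraph x v R = y := by
  have hin' : ∀ o, y.2 o = none ↔ o = none := by
    intro o
    have := Finset.ext_iff.mp hin o
    rw [mem_inE, Finset.mem_singleton] at this
    exact this
  have hl : (gr y).Lone none := Or.inr fun e he =>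
    (hin' e).mp (he.trans ((hin' none).mpr rfl))
  have hne := (stabilization_of_lone hy.1 hy.2 none hl).1
  have hs : y.1 none ≠ none := fun h => hne (h.trans ((hin' none).mpr rfl).symm)
  obtain ⟨v, hv⟩ := Option.ne_none_iff_exists'.mp hs
  choose t ht using fun i => Option.ne_none_iff_exists'.mp
    (fun h => Option.some_ne_none i ((hin' (some i)).mp h))
  set R : Finset E := Finset.univ.filter fun i => y.1 (some i) = none with hRdef
  have hmem : ∀ i, i ∈ R ↔ y.1 (some i) = none := by simp [hRdef]
  -- The default value `v` puts the tails at the new vertex back to the vertex from which they were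
  -- split off.
  set x : (E → V) × (E → V) := (fun i => (y.1 (some i)).getD v, t) with hx
  have hsplit : splitGraph x v R = y := by
    refine Prod.ext (funext fun o => ?_) (funext fun o => ?_)
    · cases o with
      | none => exact hv.symm
      | some i =>
        by_cases hi : y.1 (some i) = none
        · simp [hmem, hi]
        · obtain ⟨w, hw⟩ := Option.ne_none_iff_exists'.mp hi
          simp [hmem, hx, hw]
    · cases o with
      | none => exact ((hin' none).mpr rfl).symm
      | some i => exact (ht i).symm
  have hR : ∀ i ∈ R, x.1 i = v := by
    intro i hi
    rw [hmem] at hi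
    simp [hx, hi]
  have hss := semistable_iff.mp hy.1
  refine ⟨x, v, R, hR, ?_, ?_, hsplit⟩
  · rcases (hss none).2.2 with ⟨e, e', hne, he, he'⟩ | ⟨e, e', hne, he, he'⟩
    · exact absurd (((hin' e).mp he).trans ((hin' e').mp he').symm) hne
    · cases e with
      | none => exact absurd he hs
      | some i =>
        cases e' with
        | none => exact absurd he' hs
        | some j =>
          exact Finset.one_lt_card.mpr ⟨i, (hmem i).mpr he, j, (hmem j).mpr he', by
            simpa using hne⟩
  · rintro ⟨h1, h2⟩
    rcases (hss (some v)).2.2 with ⟨e, e', hne, he, he'⟩ | ⟨e, e', hne, he, he'⟩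
    · obtain ⟨i₀, hi₀⟩ := Finset.card_eq_one.mp h1
      have : ∀ o, y.2 o = some v → o = some i₀ := by
        intro o ho
        cases o with
        | none => rw [(hin' none).mpr rfl] at ho; simp at ho
        | some i =>
          have h3 : i ∈ inE (gr x) v := mem_inE_gr.mpr (Option.some_injective _ ((ht i).symm.trans ho))
          rw [hi₀] at h3
          rw [Finset.mem_singleton.mp h3]
      exact hne ((this e he).trans (this e' he').symm)
    · have : ∀ o, y.1 o = some v → o = none := by
        intro o ho
        cases o with
        | none => rfl
        | some i =>
          have h3 : i ∈ outE (gr x) v := mem_outE_gr.mpr (by simp [hx, ho])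
          rw [← h2, hmem, ho] at h3
          simp at h3
      exact hne ((this e he).trans (this e' he').symm)

theorem splitGraph_injective {x x' : (E → V) × (E → V)} {v v' : V} {R R' : Finset E}
    (hR : ∀ i ∈ R, x.1 i = v) (hR' : ∀ i ∈ R', x'.1 i = v')
    (h : splitGraph x v R = splitGraph x' v' R') : x = x' ∧ v = v' ∧ R = R' := by
  have h1 : ∀ o, (splitGraph x v R).1 o = (splitGraph x' v' R').1 o := fun o => by rw [h]
  have h2 : ∀ o, (splitGraph x v R).2 o = (splitGraph x' v' R').2 o := fun o => by rw [h]
  have hv : v = v' := Option.some_injective _ (h1 none)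
  have hRR : R = R' := by
    ext i
    have := h1 (some i)
    simp only [splitGraph_src_some] at this
    split_ifs at this <;> simp_all
  refine ⟨Prod.ext (funext fun i => ?_) (funext fun i => ?_), hv, hRR⟩
  · by_cases hi : i ∈ R
    · rw [hR i hi, hR' i (hRR ▸ hi), hv]
    · have := h1 (some i)
      simpa [hi, hRR ▸ hi] using this
  · simpa using h2 (some i)

/-! ### Good and bad terms of the variation -/

variable {n : ℕ} (P : Matrix (Fin n) (Fin n) ℂ) (J : (Fin n → ℕ) → (Fin n → ℕ) → ℂ)
  (ξ : Fin n → (Fin n → ℕ) → ℂ)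

/-- The sum over all labelled graphs with given sets of vertices and edges. -/
noncomputable def labelledSum (V E : Type) [Fintype V] [Fintype E] (f : MultiDigraph → ℂ) : ℂ :=
  ∑ x : (E → V) × (E → V), f (gr x)

/-- The variation of the factors of a graph in the outward directions. -/
noncomputable def outVar (H : MultiDigraph) : ℂ :=
  ∑ v, ∑ R ∈ (outE H v).powerset, splitTerm H P J ξ v R

/-- The terms of the variation that are also graphs with one vertex more. -/
noncomputable def goodSum (G : MultiDigraph) (V E : Type) [Fintype V] [Fintype E] : ℂ :=
  ∑ z : ((E → V) × (E → V)) × V × Finset E,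
    if Stab G (gr z.1) ∧ (∀ i ∈ z.2.2, z.1.1 i = z.2.1) ∧ 2 ≤ z.2.2.card ∧
      ¬((inE (gr z.1) z.2.1).card = 1 ∧ z.2.2 = outE (gr z.1) z.2.1) then
    splitTerm (gr z.1) P J ξ z.2.1 z.2.2 else 0

/-- The terms of the variation where the vector field replaces a vertex with one inward edge. -/
noncomputable def badSum (G : MultiDigraph) (V E : Type) [Fintype V] [Fintype E] : ℂ :=
  ∑ x : (E → V) × (E → V), if Stab G (gr x) then
    ∑ v : V, if (inE (gr x) v).card = 1 then splitTerm (gr x) P J ξ v (outE (gr x) v) else 0 else 0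

theorem splitTerm_eq_zero (hξ : ∀ q γ, ∑ i, γ i < 2 → ξ q γ = 0) (H : MultiDigraph) (v : H.V)
    (R : Finset H.E) (hR : R.card < 2) : splitTerm H P J ξ v R = 0 := by
  unfold splitTerm
  refine Finset.sum_eq_zero fun a _ => Finset.sum_eq_zero fun b _ => ?_
  have : ∀ q, ξ q (cnt R a) = 0 := fun q => hξ q _ (by rwa [sum_cnt])
  simp [this]

/-- Terms with |R| < 2 contain a derivative of ξ of order below 2 and vanish. The others are
separated according to whether splitting keeps the graph semistable. -/
theorem sum_outVar (hξ : ∀ q γ, ∑ i, γ i < 2 → ξ q γ = 0) (G : MultiDigraph) :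
    labelledSum V E (fun H => if Stab G H then outVar P J ξ H else 0) =
      goodSum P J ξ G V E + badSum P J ξ G V E := by
  unfold goodSum badSum labelledSum
  rw [Fintype.sum_prod_type (f := fun z : ((E → V) × (E → V)) × V × Finset E => _), ← Finset.sum_add_distrib]
  refine Finset.sum_congr rfl fun x _ => ?_
  by_cases hx : Stab G (gr x)
  swap
  · simp [hx]
  simp only [hx, if_true, true_and]
  rw [Fintype.sum_prod_type]
  unfold outVar
  rw [← Finset.sum_add_distrib]
  refine Finset.sum_congr rfl fun v _ => ?_
  have h1 : ∑ R ∈ (outE (gr x) v).powerset, splitTerm (gr x) P J ξ v R =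
      ∑ R : Finset E, if ∀ i ∈ R, x.1 i = v then splitTerm (gr x) P J ξ v R else 0 := by
    rw [← Finset.sum_filter]
    refine Finset.sum_congr ?_ fun _ _ => rfl
    ext R
    simp only [Finset.mem_powerset, Finset.mem_filter, Finset.mem_univ, true_and]
    exact forall₂_congr fun i _ => mem_outE_gr
  have h2 : (if (inE (gr x) v).card = 1 then splitTerm (gr x) P J ξ v (outE (gr x) v) else 0) =
      ∑ R : Finset E, if R = outE (gr x) v then
        (if (inE (gr x) v).card = 1 then splitTerm (gr x) P J ξ v R else 0) else 0 := by
    rw [Finset.sum_ite_eq']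
    simp
  rw [h1, h2, ← Finset.sum_add_distrib]
  refine Finset.sum_congr rfl fun R _ => ?_
  by_cases hR : ∀ i ∈ R, x.1 i = v
  swap
  · have h3 : R ≠ outE (gr x) v := by
      rintro rfl
      exact hR fun i hi => mem_outE_gr.mp hi
    simp [hR, h3]
  by_cases hc : 2 ≤ R.card
  swap
  · simp [splitTerm_eq_zero P J ξ hξ (gr x) v R (by omega)]
  by_cases h3 : R = outE (gr x) v <;> by_cases h4 : (inE (gr x) v).card = 1
  · rw [if_pos hR, if_neg fun h => h.2.2 ⟨h4, h3⟩, if_pos h3, if_pos h4, zero_add]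
  · simp [h4, hc]
  · simp [h3, hc]
  · simp [h3, hc]

/-- The graph has the stabilization `G`, and `e` is the only edge to `v`. -/
def MarkedAt (G H : MultiDigraph) (v : H.V) (e : H.E) : Prop := Stab G H ∧ inE H v = {e}

/-- The sum over the graphs with a marked vertex and a marked edge, the only edge to it. -/
noncomputable def markedSum (G : MultiDigraph) (V E : Type) [Fintype V] [Fintype E] (v : V)
    (e : E) : ℂ :=
  ∑ y : (E → V) × (E → V), if MarkedAt G (gr y) v e then
    splitTerm (gr y) P J ξ v (outE (gr y) v) else 0

/-- A vertex with one inward edge determines that edge, so marking both does not change the sum. -/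
theorem badSum_eq (G : MultiDigraph) :
    badSum P J ξ G V E = ∑ v : V, ∑ e : E, markedSum P J ξ G V E v e := by
  unfold badSum markedSum
  have h1 : ∀ v : V, ∑ e : E, (∑ y : (E → V) × (E → V),
      if MarkedAt G (gr y) v e then
        splitTerm (gr y) P J ξ v (outE (gr y) v) else 0) =
      ∑ y : (E → V) × (E → V), ∑ e : E, if MarkedAt G (gr y) v e then
        splitTerm (gr y) P J ξ v (outE (gr y) v) else 0 := fun v => Finset.sum_comm
  rw [Finset.sum_congr rfl fun v _ => h1 v, Finset.sum_comm]
  refine Finset.sum_congr rfl fun y _ => ?_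
  by_cases hy : Stab G (gr y)
  swap
  · simp [hy, MarkedAt]
  simp only [hy, if_true, true_and, MarkedAt]
  refine Finset.sum_congr rfl fun v _ => ?_
  by_cases hc : (inE (gr y) v).card = 1
  · obtain ⟨e, he⟩ := Finset.card_eq_one.mp hc
    rw [if_pos hc, Finset.sum_eq_single e]
    · rw [if_pos he]
    · intro e' _ hne
      rw [if_neg]
      rw [he]
      exact fun h => hne (Finset.singleton_injective h).symm
    · simp
  · rw [if_neg hc, Finset.sum_eq_zero]
    intro e _
    rw [if_neg]
    intro h
    exact hc (by rw [h, Finset.card_singleton])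

/-- Renaming vertices and edges permutes the labelled graphs, so the sum does not depend on which
vertex and which edge are marked. -/
theorem markedSum_equiv (G : MultiDigraph) {V' E' : Type} [Fintype V'] [Fintype E']
    (σ : V ≃ V') (τ : E ≃ E') (v : V) (e : E) :
    markedSum P J ξ G V E v e = markedSum P J ξ G V' E' (σ v) (τ e) := by
  unfold markedSum
  refine Fintype.sum_equiv ((τ.arrowCongr σ).prodCongr (τ.arrowCongr σ)) _ _ fun y => ?_
  set i : Iso (gr y) (gr ((τ.arrowCongr σ) y.1, (τ.arrowCongr σ) y.2)) :=
    ⟨σ, τ, fun e => by simp, fun e => by simp⟩ with hi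
  have h1 := Iso.outE i v
  have h2 := Iso.inE i v
  have h3 := Iso.splitTerm i P J ξ v (outE (gr y) v)
  rw [← h1] at h3
  have h4 : inE (gr y) v = {e} ↔
      inE (gr ((τ.arrowCongr σ) y.1, (τ.arrowCongr σ) y.2)) (i.vertexEquiv v) = {τ e} := by
    rw [h2]
    refine (Finset.map_injective i.edgeEquiv.toEmbedding).eq_iff.symm.trans ?_
    rw [Finset.map_singleton]
    rfl
  have h5 := Iso.stab_iff (G := G) i
  by_cases hc : MarkedAt G (gr y) v e
  · rw [if_pos hc, ← h3]
    exact (if_pos ⟨h5.mp hc.1, h4.mp hc.2⟩).symm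
  · rw [if_neg hc]
    exact (if_neg fun h => hc ⟨h5.mpr h.1, h4.mpr h.2⟩).symm

/-- Splitting is a bijection from the good triples (graph, vertex, set of outward edges) to the
graphs with `none` as marked vertex and edge, and it preserves the terms. -/
theorem markedSum_option (G : MultiDigraph)
    (hP : Matrix.of (fun i j => J (Pi.single i 1) (Pi.single j 1)) * P = 1) :
    markedSum P J ξ G (Option V) (Option E) none none = goodSum P J ξ G V E := by
  unfold markedSum goodSum
  rw [← Finset.sum_filter, ← Finset.sum_filter]
  symm
  refine Finset.sum_nbij (fun z => splitGraph z.1 z.2.1 z.2.2) ?_ ?_ ?_ ?_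
  · intro z hz
    simp only [Finset.mem_filter, Finset.mem_univ, true_and] at hz
    exact Finset.mem_filter.mpr ⟨@Finset.mem_univ _ (_) _, (stab_split hz.2.1 hz.2.2.1 hz.2.2.2).mpr hz.1, inE_split_none _ _ _⟩
  · intro z hz z' hz' h
    simp only [Finset.coe_filter, Finset.mem_univ, true_and, Set.mem_ofPred_eq] at hz hz'
    obtain ⟨h1, h2, h3⟩ := splitGraph_injective hz.2.1 hz'.2.1 h
    exact Prod.ext h1 (Prod.ext h2 h3)
  · intro y hy
    replace hy := (Finset.mem_filter.mp (Finset.mem_coe.mp hy)).2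
    obtain ⟨x, v, R, hR, h2, hb, rfl⟩ := exists_split y hy.1 hy.2
    refine ⟨(x, v, R), ?_, rfl⟩
    simp only [Finset.coe_filter, Finset.mem_univ, true_and, Set.mem_ofPred_eq]
    exact ⟨(stab_split hR h2 hb).mp hy.1, hR, h2, hb⟩
  · intro z hz
    simp only [Finset.mem_filter, Finset.mem_univ, true_and] at hz
    exact (splitTerm_splitGraph P J ξ hP z.1 z.2.1 z.2.2 hz.2.1).symm

/-- The factor counts the choices of the marked vertex and the marked edge, all of which contribute
equally. -/
theorem badSum_fin (G : MultiDigraph)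
    (hP : Matrix.of (fun i j => J (Pi.single i 1) (Pi.single j 1)) * P = 1) (m l : ℕ) :
    badSum P J ξ G (Fin (m + 1)) (Fin (l + 1)) =
      (m + 1) * (l + 1) * goodSum P J ξ G (Fin m) (Fin l) := by
  rw [badSum_eq]
  have h : ∀ v e, markedSum P J ξ G (Fin (m + 1)) (Fin (l + 1)) v e =
      goodSum P J ξ G (Fin m) (Fin l) := by
    intro v e
    rw [markedSum_equiv P J ξ G (finSuccEquiv' v) (finSuccEquiv' e) v e, finSuccEquiv'_at,
      finSuccEquiv'_at, markedSum_option P J ξ G hP]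
  simp only [h, Finset.sum_const, Finset.card_univ, Fintype.card_fin, nsmul_eq_mul]
  push_cast
  ring

/-- The weight of a labelled graph with `m` vertices and `m + k` edges in the sum. -/
noncomputable def labelWeight (k m : ℕ) : ℂ := (-1) ^ m / (m.factorial * (m + k).factorial)

/-- Sum the total degrees, each at least 3. For |E| = |V| + k this bounds |V| by 2k. -/
theorem stab_card_le {G H : MultiDigraph} (h : Stab G H) :
    3 * Fintype.card H.V ≤ 2 * Fintype.card H.E := by
  have h1 : ∑ v, (outE H v).card = Fintype.card H.E := by
    simp only [outE]
    rw [← Finset.card_univ, Finset.card_eq_sum_card_fiberwise (f := H.src) (t := Finset.univ)]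
    simp
  have h2 : ∑ v, (inE H v).card = Fintype.card H.E := by
    simp only [inE]
    rw [← Finset.card_univ, Finset.card_eq_sum_card_fiberwise (f := H.tgt) (t := Finset.univ)]
    simp
  have h3 : ∑ _v : H.V, 3 ≤ ∑ v, ((inE H v).card + (outE H v).card) := by
    refine Finset.sum_le_sum fun v _ => ?_
    rw [card_inE, card_outE]
    exact (h.1 v).2.2
  rw [Finset.sum_add_distrib, h1, h2] at h3
  simp at h3
  omega

/-- The variation of the sum over all labelled graphs vanishes. -/
theorem sum_outVar_eq_zero (hξ : ∀ q γ, ∑ i, γ i < 2 → ξ q γ = 0) (G : MultiDigraph)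
    (hP : Matrix.of (fun i j => J (Pi.single i 1) (Pi.single j 1)) * P = 1) (k : ℕ) :
    ∑ m ∈ Finset.range (2 * k + 1), labelWeight k m *
      labelledSum (Fin m) (Fin (m + k)) (fun H => if Stab G H then outVar P J ξ H else 0) = 0 := by
  -- The partial sums telescope: the bad terms with N + 1 vertices cancel the good terms with N, so
  -- only the last good sum remains.
  have key : ∀ N, ∑ m ∈ Finset.range (N + 1), labelWeight k m *
      labelledSum (Fin m) (Fin (m + k)) (fun H => if Stab G H then outVar P J ξ H else 0) =
      labelWeight k N * goodSum P J ξ G (Fin N) (Fin (N + k)) := by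
    intro N
    induction N with
    | zero =>
      rw [Finset.sum_range_one, sum_outVar P J ξ hξ]
      have : badSum P J ξ G (Fin 0) (Fin (0 + k)) = 0 := by
        unfold badSum
        simp
      rw [this, add_zero]
    | succ N ih =>
      rw [Finset.sum_range_succ, ih, sum_outVar P J ξ hξ]
      have h1 : badSum P J ξ G (Fin (N + 1)) (Fin (N + 1 + k)) =
          (N + 1) * ((N + k : ℕ) + 1) * goodSum P J ξ G (Fin N) (Fin (N + k)) := by
        have h2 : N + 1 + k = N + k + 1 := by omega
        rw [h2]
        exact badSum_fin P J ξ G hP N (N + k)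
      have h2 : labelWeight k (N + 1) * ((N + 1) * ((N + k : ℕ) + 1)) = -labelWeight k N := by
        have h3 : N + 1 + k = N + k + 1 := by omega
        unfold labelWeight
        rw [h3, Nat.factorial_succ, Nat.factorial_succ, pow_succ]
        have h4 : (N.factorial : ℂ) ≠ 0 := by exact_mod_cast N.factorial_ne_zero
        have h5 : ((N + k).factorial : ℂ) ≠ 0 := by exact_mod_cast (N + k).factorial_ne_zero
        have h6 : (N : ℂ) + 1 ≠ 0 := by exact_mod_cast N.succ_ne_zero
        have h7 : (N : ℂ) + k + 1 ≠ 0 := by exact_mod_cast (N + k).succ_ne_zero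
        push_cast
        field_simp
      rw [h1, mul_add, ← mul_assoc (labelWeight k (N + 1)) _ (goodSum P J ξ G (Fin N) (Fin (N + k))),
        h2]
      ring
  rw [key]
  -- Up to a nonzero factor this is a bad sum over graphs with 2k + 1 vertices, and no such graph is
  -- semistable.
  have : goodSum P J ξ G (Fin (2 * k)) (Fin (2 * k + k)) = 0 := by
    have h1 : (2 * (k : ℂ) + 1) * ((2 * k + k : ℕ) + 1) *
        goodSum P J ξ G (Fin (2 * k)) (Fin (2 * k + k)) = 0 := by
      have h2 := badSum_fin P J ξ G hP (2 * k) (2 * k + k)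
      push_cast at h2 ⊢
      rw [← h2]
      unfold badSum
      refine Finset.sum_eq_zero fun x _ => if_neg fun hx => ?_
      have := stab_card_le hx
      simp at this
      omega
    rcases mul_eq_zero.mp h1 with h2 | h2
    · rcases mul_eq_zero.mp h2 with h3 | h3
      · exact absurd h3 (by exact_mod_cast (2 * k).succ_ne_zero)
      · exact absurd h3 (by exact_mod_cast (2 * k + k).succ_ne_zero)
    · exact h2
  rw [this, mul_zero]

end Cancellation

end WeylGraph

namespace WeylGraph

open MultiDigraph

/-! ### Constancy along paths of coordinate changes -/

section Constancy

open scoped Classical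

variable {n : ℕ}

/-- The right-hand side of the evolution equation of the jets: the Leibniz expansion of the
derivative along a vector field with derivatives `ξ` and its conjugate with derivatives `η`. -/
noncomputable def jetVar (J : (Fin n → ℕ) → (Fin n → ℕ) → ℂ) (ξ η : Fin n → (Fin n → ℕ) → ℂ)
    {ε : Type*} (S T : Finset ε) (a b : ε → Fin n) : ℂ :=
  (∑ R ∈ S.powerset, ∑ q, ξ q (cnt R a) * J (cnt (S \ R) a + Pi.single q 1) (cnt T b)) +
    ∑ R ∈ T.powerset, ∑ q, η q (cnt R b) * J (cnt S a) (cnt (T \ R) b + Pi.single q 1)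

theorem outVar_eq (H : MultiDigraph) (P : Matrix (Fin n) (Fin n) ℂ)
    (J : (Fin n → ℕ) → (Fin n → ℕ) → ℂ) (ξ : Fin n → (Fin n → ℕ) → ℂ) :
    outVar P J ξ H = ∑ a : H.E → Fin n, ∑ b : H.E → Fin n, (∏ e, P (b e) (a e)) *
      ∑ v, (∏ w ∈ Finset.univ.erase v, J (cnt (outE H w) a) (cnt (inE H w) b)) *
        ∑ R ∈ (outE H v).powerset, ∑ q,
          ξ q (cnt R a) * J (cnt (outE H v \ R) a + Pi.single q 1) (cnt (inE H v) b) := by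
  unfold outVar splitTerm
  have h1 : ∀ v, ∑ R ∈ (outE H v).powerset, (∑ a : H.E → Fin n, ∑ b : H.E → Fin n,
      (∏ e, P (b e) (a e)) *
      ((∑ q, ξ q (cnt R a) * J (cnt (outE H v \ R) a + Pi.single q 1) (cnt (inE H v) b)) *
        ∏ w ∈ Finset.univ.erase v, J (cnt (outE H w) a) (cnt (inE H w) b))) =
      ∑ a : H.E → Fin n, ∑ b : H.E → Fin n, (∏ e, P (b e) (a e)) *
        ((∏ w ∈ Finset.univ.erase v, J (cnt (outE H w) a) (cnt (inE H w) b)) *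
        ∑ R ∈ (outE H v).powerset, ∑ q,
          ξ q (cnt R a) * J (cnt (outE H v \ R) a + Pi.single q 1) (cnt (inE H v) b)) := by
    intro v
    rw [Finset.sum_comm]
    refine Finset.sum_congr rfl fun a _ => ?_
    rw [Finset.sum_comm]
    refine Finset.sum_congr rfl fun b _ => ?_
    rw [← Finset.mul_sum, ← Finset.sum_mul]
    ring
  rw [Finset.sum_congr rfl fun v _ => h1 v, Finset.sum_comm]
  refine Finset.sum_congr rfl fun a _ => ?_
  rw [Finset.sum_comm]
  refine Finset.sum_congr rfl fun b _ => ?_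
  rw [Finset.mul_sum]

/-- The product rule over the vertices, with the inverse metric held fixed. The half that involves
`η` is an outward variation of the reversed graph, with transposed data. -/
theorem hasDerivAt_jetEval (H : MultiDigraph) (P : Matrix (Fin n) (Fin n) ℂ)
    (J : ℝ → (Fin n → ℕ) → (Fin n → ℕ) → ℂ) (ξ η : Fin n → (Fin n → ℕ) → ℂ) (t : ℝ)
    (hJ : ∀ (S T : Finset H.E) (a b : H.E → Fin n),
      HasDerivAt (fun s => J s (cnt S a) (cnt T b)) (jetVar (J t) ξ η S T a b) t) :
    HasDerivAt (fun s => jetEval H P (J s))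
      (outVar P (J t) ξ H + outVar P.transpose (fun α β => J t β α) η H.op) t := by
  have h1 : HasDerivAt (fun s => jetEval H P (J s))
      (∑ a : H.E → Fin n, ∑ b : H.E → Fin n, (∏ e, P (b e) (a e)) *
        ∑ v, (∏ w ∈ Finset.univ.erase v, J t (cnt (outE H w) a) (cnt (inE H w) b)) •
          jetVar (J t) ξ η (outE H v) (inE H v) a b) t := by
    unfold jetEval
    refine HasDerivAt.fun_sum fun a _ => HasDerivAt.fun_sum fun b _ => HasDerivAt.const_mul _ ?_
    exact HasDerivAt.fun_finsetProd fun v _ => hJ _ _ a b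
  refine h1.congr_deriv ?_
  have h2 : outVar P.transpose (fun α β => J t β α) η H.op =
      ∑ a : H.E → Fin n, ∑ b : H.E → Fin n, (∏ e, P (b e) (a e)) *
      ∑ v, (∏ w ∈ Finset.univ.erase v, J t (cnt (outE H w) a) (cnt (inE H w) b)) *
        ∑ R ∈ (inE H v).powerset, ∑ q,
          η q (cnt R b) * J t (cnt (outE H v) a) (cnt (inE H v \ R) b + Pi.single q 1) := by
    rw [outVar_eq]
    exact Finset.sum_comm
  rw [outVar_eq, h2, ← Finset.sum_add_distrib]
  refine Finset.sum_congr rfl fun a _ => ?_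
  rw [← Finset.sum_add_distrib]
  refine Finset.sum_congr rfl fun b _ => ?_
  rw [← mul_add, ← Finset.sum_add_distrib]
  refine congrArg _ (Finset.sum_congr rfl fun v _ => ?_)
  rw [smul_eq_mul, jetVar, mul_add]

/-- The weighted sum of the values of all labelled graphs with stabilization `G`. -/
noncomputable def totalEval (G : MultiDigraph) (k : ℕ) (P : Matrix (Fin n) (Fin n) ℂ)
    (J : (Fin n → ℕ) → (Fin n → ℕ) → ℂ) : ℂ :=
  ∑ m ∈ Finset.range (2 * k + 1), labelWeight k m *
    labelledSum (Fin m) (Fin (m + k)) fun H => if Stab G H then jetEval H P J else 0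

theorem stab_op {G H : MultiDigraph} : Stab G H ↔ Stab G.op H.op :=
  ⟨fun h => ⟨op_semistable h.1, op_isStabilization h.2⟩,
    fun h => ⟨op_semistable h.1, op_isStabilization h.2⟩⟩

theorem labelledSum_op {V E : Type} [Fintype V] [Fintype E] (f : MultiDigraph → ℂ) :
    labelledSum V E (fun H => f H.op) = labelledSum V E f :=
  Fintype.sum_equiv (Equiv.prodComm _ _) _ _ fun _ => rfl

theorem jetVar_eq_zero (J : (Fin n → ℕ) → (Fin n → ℕ) → ℂ) (ξ η : Fin n → (Fin n → ℕ) → ℂ)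
    (hξ : ∀ q γ, ∑ i, γ i < 2 → ξ q γ = 0) (hη : ∀ q γ, ∑ i, γ i < 2 → η q γ = 0)
    {ε : Type*} (S T : Finset ε) (a b : ε → Fin n) (hS : S.card < 2) (hT : T.card < 2) :
    jetVar J ξ η S T a b = 0 := by
  unfold jetVar
  rw [Finset.sum_eq_zero, Finset.sum_eq_zero, add_zero]
  · intro R hR
    refine Finset.sum_eq_zero fun q _ => ?_
    rw [hη, zero_mul]
    rw [sum_cnt]
    exact (Finset.card_le_card (Finset.mem_powerset.mp hR)).trans_lt hT
  · intro R hR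
    refine Finset.sum_eq_zero fun q _ => ?_
    rw [hξ, zero_mul]
    rw [sum_cnt]
    exact (Finset.card_le_card (Finset.mem_powerset.mp hR)).trans_lt hS

theorem eq_of_hasDerivAt_zero {f : ℝ → ℂ} (h : ∀ t, HasDerivAt f 0 t) (s t : ℝ) : f s = f t :=
  is_const_of_deriv_eq_zero (fun t => (h t).differentiableAt) (fun t => (h t).deriv) s t

/-- With one unbarred and one barred label, only derivatives of the fields of order at most 1 occur,
and these vanish. Hence one inverse metric serves along the whole path. -/
theorem metric_const {J : ℝ → (Fin n → ℕ) → (Fin n → ℕ) → ℂ}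
    {ξ η : ℝ → Fin n → (Fin n → ℕ) → ℂ}
    (hξ : ∀ t q γ, ∑ i, γ i < 2 → ξ t q γ = 0) (hη : ∀ t q γ, ∑ i, γ i < 2 → η t q γ = 0)
    (hJ : ∀ t (ε : Type) (S T : Finset ε) (a b : ε → Fin n),
      HasDerivAt (fun s => J s (cnt S a) (cnt T b)) (jetVar (J t) (ξ t) (η t) S T a b) t)
    (s t : ℝ) (i j : Fin n) :
    J s (Pi.single i 1) (Pi.single j 1) = J t (Pi.single i 1) (Pi.single j 1) := by
  refine eq_of_hasDerivAt_zero (f := fun s => J s (Pi.single i 1) (Pi.single j 1)) (fun t => ?_) s t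
  have h := hJ t Unit {()} {()} (fun _ => i) (fun _ => j)
  simp only [cnt_singleton] at h
  rwa [jetVar_eq_zero _ _ _ (hξ t) (hη t) _ _ _ _ (by simp) (by simp)] at h

/-- The time derivative splits into an unbarred and a barred part. Each vanishes by the telescoping
cancellation, the first for G and the second for the reversed graph. -/
theorem totalEval_const (G : MultiDigraph) (k : ℕ) (P : Matrix (Fin n) (Fin n) ℂ)
    {J : ℝ → (Fin n → ℕ) → (Fin n → ℕ) → ℂ} {ξ η : ℝ → Fin n → (Fin n → ℕ) → ℂ}
    (hξ : ∀ t q γ, ∑ i, γ i < 2 → ξ t q γ = 0) (hη : ∀ t q γ, ∑ i, γ i < 2 → η t q γ = 0)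
    (hJ : ∀ t (ε : Type) (S T : Finset ε) (a b : ε → Fin n),
      HasDerivAt (fun s => J s (cnt S a) (cnt T b)) (jetVar (J t) (ξ t) (η t) S T a b) t)
    (hP : Matrix.of (fun i j => J 0 (Pi.single i 1) (Pi.single j 1)) * P = 1) (s t : ℝ) :
    totalEval G k P (J s) = totalEval G k P (J t) := by
  refine eq_of_hasDerivAt_zero (f := fun s => totalEval G k P (J s)) (fun t => ?_) s t
  have hPt : Matrix.of (fun i j => J t (Pi.single i 1) (Pi.single j 1)) * P = 1 := by
    rw [← hP]
    congr 2
    ext i j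
    exact metric_const hξ hη hJ t 0 i j
  have hPt' : Matrix.of (fun i j => J t (Pi.single j 1) (Pi.single i 1)) * P.transpose = 1 := by
    rw [mul_eq_one_comm] at hPt
    have := congrArg Matrix.transpose hPt
    rw [Matrix.transpose_mul, Matrix.transpose_one] at this
    exact this
  have h1 : HasDerivAt (fun s => totalEval G k P (J s))
      (∑ m ∈ Finset.range (2 * k + 1), labelWeight k m *
        labelledSum (Fin m) (Fin (m + k)) fun H => if Stab G H then
          outVar P (J t) (ξ t) H + outVar P.transpose (fun α β => J t β α) (η t) H.op else 0) t := by
    refine HasDerivAt.fun_sum fun m _ => HasDerivAt.const_mul _ (HasDerivAt.fun_sum fun x _ => ?_)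
    by_cases hx : Stab G (gr x)
    · simp only [hx, if_true]
      exact hasDerivAt_jetEval (gr x) P J (ξ t) (η t) t (hJ t _)
    · simp only [hx, if_false]
      exact hasDerivAt_const _ _
  refine h1.congr_deriv ?_
  have h2 : ∀ m, labelledSum (Fin m) (Fin (m + k)) (fun H => if Stab G H then
          outVar P (J t) (ξ t) H + outVar P.transpose (fun α β => J t β α) (η t) H.op else 0) =
      labelledSum (Fin m) (Fin (m + k)) (fun H => if Stab G H then outVar P (J t) (ξ t) H else 0) +
      labelledSum (Fin m) (Fin (m + k)) (fun H => if Stab G.op H then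
        outVar P.transpose (fun α β => J t β α) (η t) H else 0) := by
    intro m
    rw [← labelledSum_op (fun H => if Stab G.op H then _ else 0)]
    unfold labelledSum
    rw [← Finset.sum_add_distrib]
    refine Finset.sum_congr rfl fun x _ => ?_
    by_cases hx : Stab G (gr x)
    · simp only [hx, if_true, stab_op.mp hx]
    · have hx' := stab_op.not.mp hx
      simp only [hx, if_false, hx', add_zero]
  simp only [h2, mul_add, Finset.sum_add_distrib]
  rw [sum_outVar_eq_zero P (J t) (ξ t) (hξ t) G hPt k,
    sum_outVar_eq_zero P.transpose (fun α β => J t β α) (η t) (hη t) G.op hPt' k, add_zero]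

end Constancy

end WeylGraph

namespace WeylGraph

open MultiDigraph Set

/-! ### Invariance under linear changes of coordinates -/

section Linear

open scoped Classical

variable {n : ℕ}

/-- The jet `J'` is the pullback of `J` by the linear map `A` in the unbarred indices. -/
def Transforms (A : Matrix (Fin n) (Fin n) ℂ) (J' J : (Fin n → ℕ) → (Fin n → ℕ) → ℂ) : Prop :=
  ∀ (m : ℕ) (a : Fin m → Fin n) (β : Fin n → ℕ), J' (cnt Finset.univ a) β =
    ∑ c : Fin m → Fin n, (∏ s, A (c s) (a s)) * J (cnt Finset.univ c) β

theorem cnt_equiv {ι κ : Type*} [Fintype ι] [Fintype κ] (e : ι ≃ κ) (a : κ → Fin n) :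
    cnt Finset.univ (a ∘ e) = cnt Finset.univ a := by
  unfold cnt
  exact e.sum_comp fun k => (Pi.single (a k) 1 : Fin n → ℕ)

theorem Transforms.fintype {A : Matrix (Fin n) (Fin n) ℂ} {J' J : (Fin n → ℕ) → (Fin n → ℕ) → ℂ}
    (h : Transforms A J' J) {ι : Type*} [Fintype ι] (a : ι → Fin n) (β : Fin n → ℕ) :
    J' (cnt Finset.univ a) β =
      ∑ c : ι → Fin n, (∏ s, A (c s) (a s)) * J (cnt Finset.univ c) β := by
  have e := Fintype.equivFin ι
  rw [← cnt_equiv e.symm a, h]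
  refine (Fintype.sum_equiv (e.arrowCongr (Equiv.refl (Fin n))) _ _ fun c => ?_).symm
  have h1 : (e.arrowCongr (Equiv.refl (Fin n))) c = c ∘ e.symm := rfl
  rw [h1, cnt_equiv e.symm c, ← e.symm.prod_comp]
  rfl

theorem sum_prod_eq_prod_sum {ι : Type*} [Fintype ι] (f : ι → Fin n → ℂ) :
    ∑ a : ι → Fin n, ∏ i, f i (a i) = ∏ i, ∑ j, f i j := by
  rw [Finset.prod_univ_sum, Fintype.piFinset_univ]

/-- Choices of indices on all edges are choices on the edges with tail `v`, for each `v`. -/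
theorem prod_sum_fibers {V E : Type} [Fintype V] [Fintype E] (p : E → V)
    [∀ v, DecidableEq {e // p e = v}]
    (f : ∀ v, ({e // p e = v} → Fin n) → ℂ) :
    ∏ v, ∑ c, f v c = ∑ c : E → Fin n, ∏ v, f v fun e => c e.1 := by
  rw [Finset.prod_univ_sum, Fintype.piFinset_univ]
  let φ : (E → Fin n) ≃ ∀ v, ({e // p e = v} → Fin n) :=
    { toFun := fun c v e => c e.1
      invFun := fun c e => c (p e) ⟨e, rfl⟩
      left_inv := fun c => rfl
      right_inv := fun c => by
        ext v ⟨e, rfl⟩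
        rfl }
  exact (Fintype.sum_equiv φ _ _ fun c => rfl).symm

theorem cnt_outE (H : MultiDigraph) (v : H.V) (a : H.E → Fin n) :
    cnt (outE H v) a = cnt Finset.univ (fun e : {e // H.src e = v} => a e.1) := by
  unfold cnt
  refine Finset.sum_subtype _ (fun e => ?_) _
  exact mem_outE

/-- Each half-edge at a tail contributes one factor of `A`, which can be moved from the vertex onto
the edge and absorbed into the edge matrix. -/
theorem jetEval_transforms {A : Matrix (Fin n) (Fin n) ℂ}
    {J' J : (Fin n → ℕ) → (Fin n → ℕ) → ℂ} (h : Transforms A J' J) (H : MultiDigraph)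
    (P : Matrix (Fin n) (Fin n) ℂ) : jetEval H P J' = jetEval H (P * A.transpose) J := by
  have h1 : ∀ a b : H.E → Fin n, ∏ v, J' (cnt (outE H v) a) (cnt (inE H v) b) =
      ∑ c : H.E → Fin n, (∏ e, A (c e) (a e)) *
        ∏ v, J (cnt (outE H v) c) (cnt (inE H v) b) := by
    intro a b
    simp only [cnt_outE, h.fintype]
    refine (@prod_sum_fibers n _ _ _ _ H.src (fun _ _ _ => Classical.propDecidable _) fun v c => (∏ s, A (c s) (a s.1)) *
      J (cnt Finset.univ c) (cnt (inE H v) b)).trans ?_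
    refine Finset.sum_congr rfl fun c _ => ?_
    rw [Finset.prod_mul_distrib]
    congr 1
    rw [← Fintype.prod_fiberwise H.src fun e => A (c e) (a e)]
  unfold jetEval
  simp only [h1, Finset.mul_sum]
  have h2 : ∀ b c : H.E → Fin n, ∏ e, (P * A.transpose) (b e) (c e) =
      ∑ a : H.E → Fin n, (∏ e, P (b e) (a e)) * ∏ e, A (c e) (a e) := by
    intro b c
    simp only [Matrix.mul_apply, Matrix.transpose_apply]
    rw [← sum_prod_eq_prod_sum]
    simp only [Finset.prod_mul_distrib]
  simp only [h2, Finset.sum_mul]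
  have h3 : ∀ f : (H.E → Fin n) → (H.E → Fin n) → (H.E → Fin n) → ℂ,
      ∑ a, ∑ b, ∑ c, f a b c = ∑ c, ∑ b, ∑ a, f a b c := by
    intro f
    rw [Finset.sum_comm, Finset.sum_congr rfl fun b _ => Finset.sum_comm, Finset.sum_comm]
  rw [h3]
  refine Finset.sum_congr rfl fun c _ => Finset.sum_congr rfl fun b _ =>
    Finset.sum_congr rfl fun a _ => ?_
  ring

theorem jetEval_op (H : MultiDigraph) (P : Matrix (Fin n) (Fin n) ℂ)
    (J : (Fin n → ℕ) → (Fin n → ℕ) → ℂ) :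
    jetEval H.op P.transpose (fun α β => J β α) = jetEval H P J := Finset.sum_comm

/-- Heads are treated as tails of the reversed graph. -/
theorem jetEval_transforms₂ {A B : Matrix (Fin n) (Fin n) ℂ}
    {J' J₁ J : (Fin n → ℕ) → (Fin n → ℕ) → ℂ} (h : Transforms A J' J₁)
    (h' : Transforms B (fun α β => J₁ β α) (fun α β => J β α)) (H : MultiDigraph)
    (P : Matrix (Fin n) (Fin n) ℂ) : jetEval H P J' = jetEval H (B * P * A.transpose) J := by
  rw [jetEval_transforms h, ← jetEval_op, jetEval_transforms h', ← jetEval_op]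
  simp only [Matrix.transpose_mul, Matrix.transpose_transpose, Matrix.mul_assoc]
  rfl

/-! ### Derivatives along linearly transformed directions -/

variable {X : Type*} [NormedAddCommGroup X] [NormedSpace ℝ X]

/-- Constant coefficients pass through the remaining derivatives, so the directions can be expanded
one label at a time. -/
theorem transforms_mixedD {U : Set X} (hU : IsOpen U) (w w₁ w' : Fin n → X × X × ℂ)
    (A : Matrix (Fin n) (Fin n) ℂ)
    (hA : ∀ j f, dirD (w₁ j) f = fun x => ∑ p, A p j * dirD (w p) f x) {f : X → ℂ}
    (hf : ContDiffOn ℝ (⊤ : ℕ∞) f U) {x : X} (hx : x ∈ U) :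
    Transforms A (fun α β => mixedD w₁ w' α β f x) (fun α β => mixedD w w' α β f x) := by
  intro m
  induction m generalizing f with
  | zero =>
    intro a β
    have h0 : ∀ c : Fin 0 → Fin n, cnt Finset.univ c = 0 := fun c => by simp [cnt]
    simp only [h0]
    simp only [Finset.univ_eq_empty, Finset.prod_empty, one_mul, Fintype.sum_unique]
    induction β using multiIndex_induction generalizing f with
    | zero => simp only [mixedD_zero]
    | add β i ih =>
      rw [mixedD_add_right' hU _ _ _ _ i hf hx, mixedD_add_right' hU _ _ _ _ i hf hx]
      exact ih (dirD_smooth hU _ hf)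
  | succ m ih =>
    intro a β
    have hc : ∀ c : Fin (m + 1) → Fin n, cnt Finset.univ c =
        cnt Finset.univ (fun s : Fin m => c s.succ) + Pi.single (c 0) 1 := by
      intro c
      simp only [cnt, Fin.sum_univ_succ, add_comm]
    have hs : ∀ g : (Fin (m + 1) → Fin n) → ℂ,
        ∑ c, g c = ∑ p, ∑ c : Fin m → Fin n, g (Fin.cons p c) := by
      intro g
      rw [← Fintype.sum_prod_type']
      exact (Fintype.sum_equiv (Fin.consEquiv fun _ => Fin n) _ _ fun _ => rfl).symm
    have hop := localOp_mixedD hU w₁ w' (cnt Finset.univ fun s : Fin m => a s.succ) β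
    beta_reduce
    rw [hc, mixedD_add_left' hU _ _ _ _ _ hf hx, hA, hop.sum _ _
      (fun p _ => contDiffOn_const.mul (dirD_smooth hU _ hf)) hx, hs]
    refine Finset.sum_congr rfl fun p _ => ?_
    rw [hop.const_mul _ _ (dirD_smooth hU _ hf) hx]
    beta_reduce
    refine (congrArg _ (ih (dirD_smooth hU _ hf) _ β)).trans ?_
    rw [Finset.mul_sum]
    refine Finset.sum_congr rfl fun c _ => ?_
    rw [hc, Fin.prod_univ_succ]
    simp only [Fin.cons_zero, Fin.cons_succ]
    rw [mixedD_add_left' hU _ _ _ _ _ hf hx, mul_assoc]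

/-- The directions of `∂/∂zⱼ`, moved by a linear map. -/
noncomputable def movedDir (L : (Fin n → ℂ) →L[ℂ] (Fin n → ℂ)) (w : Fin n → (Fin n → ℂ) × (Fin n → ℂ) × ℂ)
    (j : Fin n) : (Fin n → ℂ) × (Fin n → ℂ) × ℂ := (L (w j).1, L (w j).2.1, (w j).2.2)

/-- The matrix of a linear map. -/
noncomputable def linMatrix (L : (Fin n → ℂ) →L[ℂ] (Fin n → ℂ)) : Matrix (Fin n) (Fin n) ℂ :=
  Matrix.of fun p j => L (Pi.single j 1) p

theorem dirD_movedDir_zDir (L : (Fin n → ℂ) →L[ℂ] (Fin n → ℂ)) (j : Fin n)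
    (f : (Fin n → ℂ) → ℂ) :
    dirD (movedDir L zDir j) f = fun x => ∑ p, linMatrix L p j * dirD (zDir p) f x := by
  ext x
  simp only [dirD, movedDir, zDir]
  have h := fderiv_wirtinger f x
  rw [h, h, fderiv_single_I, Finset.mul_sum, ← Finset.sum_add_distrib, Finset.sum_div]
  refine Finset.sum_congr rfl fun p _ => ?_
  simp only [Pi.smul_apply, smul_eq_mul, map_mul, Complex.conj_I, linMatrix, Matrix.of_apply]
  have h2 : dz p f x = (fderiv ℝ f x (Pi.single p 1) +
      -Complex.I * fderiv ℝ f x (Pi.single p Complex.I)) / 2 := by rw [dz]; ring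
  rw [← h2]
  linear_combination ((-(L (Pi.single j 1) p) * dz p f x +
    (starRingEnd ℂ) (L (Pi.single j 1) p) * dzbar p f x) / 2) * Complex.I_sq

theorem dirD_movedDir_zbarDir (L : (Fin n → ℂ) →L[ℂ] (Fin n → ℂ)) (j : Fin n)
    (f : (Fin n → ℂ) → ℂ) :
    dirD (movedDir L zbarDir j) f =
      fun x => ∑ p, (linMatrix L).map (starRingEnd ℂ) p j * dirD (zbarDir p) f x := by
  ext x
  simp only [dirD, movedDir, zbarDir]
  have h := fderiv_wirtinger f x
  rw [h, h, fderiv_single_I, Finset.mul_sum, ← Finset.sum_add_distrib, Finset.sum_div]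
  refine Finset.sum_congr rfl fun p _ => ?_
  simp only [Pi.smul_apply, smul_eq_mul, map_mul, Complex.conj_I, linMatrix, Matrix.of_apply,
    Matrix.map_apply]
  have h2 : dzbar p f x = (fderiv ℝ f x (Pi.single p 1) +
      Complex.I * fderiv ℝ f x (Pi.single p Complex.I)) / 2 := by rw [dzbar]
  rw [← h2]
  linear_combination (((L (Pi.single j 1) p) * dz p f x -
    (starRingEnd ℂ) (L (Pi.single j 1) p) * dzbar p f x) / 2) * Complex.I_sq

theorem fderiv_comp_affine {W : Set (Fin n → ℂ)} (hW : IsOpen W) (p p' : Fin n → ℂ)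
    (L : (Fin n → ℂ) →L[ℂ] (Fin n → ℂ)) {f : (Fin n → ℂ) → ℂ} (hf : ContDiffOn ℝ (⊤ : ℕ∞) f W)
    {x : Fin n → ℂ} (hx : p + L (x - p') ∈ W) (v : Fin n → ℂ) :
    fderiv ℝ (fun y => f (p + L (y - p'))) x v = fderiv ℝ f (p + L (x - p')) (L v) := by
  have h1 : HasFDerivAt (fun y => p + L (y - p')) L x :=
    (L.hasFDerivAt.comp x ((hasFDerivAt_id x).sub_const p')).const_add p
  rw [fderiv_comp_holo h1.differentiableAt (smooth_differentiableAt hW hf hx), h1.fderiv]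

theorem mixedD_comp_affine {W : Set (Fin n → ℂ)} (hW : IsOpen W) (p p' : Fin n → ℂ)
    (L : (Fin n → ℂ) →L[ℂ] (Fin n → ℂ)) (w w' : Fin n → (Fin n → ℂ) × (Fin n → ℂ) × ℂ)
    (α β : Fin n → ℕ) {f : (Fin n → ℂ) → ℂ} (hf : ContDiffOn ℝ (⊤ : ℕ∞) f W)
    {x : Fin n → ℂ} (hx : p + L (x - p') ∈ W) :
    mixedD w w' α β (fun y => f (p + L (y - p'))) x =
      mixedD (movedDir L w) (movedDir L w') α β f (p + L (x - p')) := by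
  have hmap : ContDiff ℝ (⊤ : ℕ∞) fun y => p + L (y - p') :=
    contDiff_const.add ((L.restrictScalars ℝ).contDiff.comp (contDiff_id.sub contDiff_const))
  set U := (fun y => p + L (y - p')) ⁻¹' W with hUdef
  have hU : IsOpen U := hW.preimage hmap.continuous
  have key : ∀ (v : (Fin n → ℂ) × (Fin n → ℂ) × ℂ) {g : (Fin n → ℂ) → ℂ},
      ContDiffOn ℝ (⊤ : ℕ∞) g W → EqOn (dirD v fun y => g (p + L (y - p')))
        (fun y => dirD (L v.1, L v.2.1, v.2.2) g (p + L (y - p'))) U := by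
    intro v g hg y hy
    simp only [dirD, fderiv_comp_affine hW p p' L hg hy]
  have hcomp : ∀ {g : (Fin n → ℂ) → ℂ}, ContDiffOn ℝ (⊤ : ℕ∞) g W →
      ContDiffOn ℝ (⊤ : ℕ∞) (fun y => g (p + L (y - p'))) U := fun hg =>
    hg.comp hmap.contDiffOn fun y hy => hy
  induction α using multiIndex_induction generalizing f with
  | zero =>
    induction β using multiIndex_induction generalizing f with
    | zero => simp only [mixedD_zero]
    | add β i ih =>
      rw [mixedD_add_right' hU _ _ _ _ i (hcomp hf) hx,
        (localOp_mixedD hU _ _ _ _).congr _ _ (key _ hf) hx,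
        ih (dirD_smooth hW _ hf), mixedD_add_right' hW _ _ _ _ i hf hx]
      rfl
  | add α i ih =>
    rw [mixedD_add_left' hU _ _ _ _ i (hcomp hf) hx,
      (localOp_mixedD hU _ _ _ _).congr _ _ (key _ hf) hx,
      ih (dirD_smooth hW _ hf), mixedD_add_left' hW _ _ _ _ i hf hx]
    rfl

/-- The values of graphs on a function composed with an affine map. -/
theorem jetEval_comp_affine {W : Set (Fin n → ℂ)} (hW : IsOpen W) (p p' : Fin n → ℂ) (hp : p ∈ W)
    (L : (Fin n → ℂ) →L[ℂ] (Fin n → ℂ)) {f : (Fin n → ℂ) → ℂ} (hf : ContDiffOn ℝ (⊤ : ℕ∞) f W)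
    (H : MultiDigraph) (P : Matrix (Fin n) (Fin n) ℂ) :
    jetEval H P (fun α β => mixedDeriv α β (fun y => f (p + L (y - p'))) p') =
      jetEval H ((linMatrix L).map (starRingEnd ℂ) * P * (linMatrix L).transpose)
        (fun α β => mixedDeriv α β f p) := by
  have h0 : p + L (p' - p') = p := by simp
  have h1 := transforms_mixedD hW zDir (movedDir L zDir) (movedDir L zbarDir) (linMatrix L)
    (dirD_movedDir_zDir L) hf hp
  have h2 := transforms_mixedD hW zbarDir (movedDir L zbarDir) zDir
    ((linMatrix L).map (starRingEnd ℂ)) (dirD_movedDir_zbarDir L) hf hp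
  have h3 : (fun α β => mixedDeriv α β (fun y => f (p + L (y - p'))) p') =
      fun α β => mixedD (movedDir L zDir) (movedDir L zbarDir) α β f p := by
    ext α β
    rw [mixedDeriv_eq, mixedD_comp_affine hW p p' L _ _ _ _ hf (by rwa [h0]), h0]
  have h4 : (fun α β => mixedD (movedDir L zbarDir) zDir α β f p) =
      fun α β => mixedD zDir (movedDir L zbarDir) β α f p := by
    ext α β
    exact mixedD_swap hW _ _ _ _ hf hp
  have h5 : (fun α β => mixedD zbarDir zDir α β f p) = fun α β => mixedDeriv β α f p := by
    ext α β
    rw [mixedDeriv_eq]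
    exact mixedD_swap hW _ _ _ _ hf hp
  rw [h4, h5] at h2
  rw [h3]
  exact jetEval_transforms₂ h1 h2 H P

end Linear

end WeylGraph

namespace WeylGraph

open MultiDigraph Set

/-! ### Isomorphism classes and labelled graphs -/

section Classes

open scoped Classical

variable {n : ℕ}

theorem eval_eq_jetEval (H : MultiDigraph) (M : KahlerChart n) :
    H.eval M = jetEval H (M.metric M.pt)⁻¹
      (fun α β => mixedDeriv α β (fun x => (M.potential x : ℂ)) M.pt) := by
  have h1 : ∀ (p : H.E → Prop) (a : H.E → Fin n),
      (fun i => Nat.card {e : H.E // p e ∧ a e = i}) = cnt (Finset.univ.filter p) a := by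
    intro p a
    ext i
    rw [cnt_apply, Nat.card_eq_fintype_card, Fintype.card_subtype, Finset.filter_filter]
  unfold MultiDigraph.eval jetEval
  refine Finset.sum_congr rfl fun a _ => Finset.sum_congr rfl fun b _ => ?_
  congr 1
  refine Finset.prod_congr rfl fun v _ => ?_
  rw [h1, h1]
  rfl

theorem exists_gr (H : MultiDigraph) {m l : ℕ} (hV : Fintype.card H.V = m)
    (hE : Fintype.card H.E = l) :
    ∃ x : (Fin l → Fin m) × (Fin l → Fin m), Nonempty (Iso (gr x) H) := by
  have eV := Fintype.equivFinOfCardEq hV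
  have eE := Fintype.equivFinOfCardEq hE
  exact ⟨(fun e => eV (H.src (eE.symm e)), fun e => eV (H.tgt (eE.symm e))),
    ⟨⟨eV.symm, eE.symm, fun e => by simp, fun e => by simp⟩⟩⟩

theorem iso_card {G H : MultiDigraph} (i : Iso G H) :
    Fintype.card G.V = Fintype.card H.V ∧ Fintype.card G.E = Fintype.card H.E :=
  ⟨Fintype.card_congr i.vertexEquiv, Fintype.card_congr i.edgeEquiv⟩

theorem Iso.weight_eq {G H : MultiDigraph} (i : Iso G H) : G.weight = H.weight := by
  rw [MultiDigraph.weight, MultiDigraph.weight, (iso_card i).1, (iso_card i).2]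

theorem Iso.ext' {G H : MultiDigraph} {i j : Iso G H} (h : i.vertexEquiv = j.vertexEquiv)
    (h' : i.edgeEquiv = j.edgeEquiv) : i = j := by
  cases i; cases j; simp_all

/-! ### Counting labellings and automorphisms -/

/-- Isomorphisms from labelled graphs to `H` are labellings of `H`. -/
theorem labelling_bijective (H : MultiDigraph) (V E : Type) [Fintype V] [Fintype E] :
    Function.Bijective (fun y : Σ x : (E → V) × (E → V), Iso (gr x) H =>
      ((y.2.vertexEquiv, y.2.edgeEquiv) : (V ≃ H.V) × (E ≃ H.E))) := by
  constructor
  · rintro ⟨x, i⟩ ⟨y, j⟩ h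
    have h1 : i.vertexEquiv = j.vertexEquiv := congrArg Prod.fst h
    have h2 : i.edgeEquiv = j.edgeEquiv := congrArg Prod.snd h
    have hxy : x = y := by
      refine Prod.ext (funext fun e => ?_) (funext fun e => ?_)
      · refine i.vertexEquiv.injective ((i.src_map e).symm.trans ?_)
        rw [h2, j.src_map e, h1]
      · refine i.vertexEquiv.injective ((i.tgt_map e).symm.trans ?_)
        rw [h2, j.tgt_map e, h1]
    subst hxy
    rw [Iso.ext' h1 h2]
  · rintro ⟨a, b⟩
    exact ⟨⟨(fun e => a.symm (H.src (b e)), fun e => a.symm (H.tgt (b e))),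
      ⟨a, b, fun e => by simp, fun e => by simp⟩⟩, rfl⟩

instance finite_iso (G H : MultiDigraph) : Finite (Iso G H) :=
  Finite.of_injective (fun i : Iso G H => (i.vertexEquiv, i.edgeEquiv)) fun i j h =>
    Iso.ext' (congrArg Prod.fst h) (congrArg Prod.snd h)

/-- The isomorphisms between two isomorphic graphs form a torsor under the automorphism group. -/
theorem card_iso {G H : MultiDigraph} (i : Iso G H) : Nat.card (Iso G H) = H.autCard :=
  Nat.card_congr
    { toFun := fun j => i.symm.trans j
      invFun := fun j => i.trans j
      left_inv := fun j => Iso.ext' (by ext; simp [Iso.trans, Iso.symm]) (by ext; simp [Iso.trans, Iso.symm])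
      right_inv := fun j => Iso.ext' (by ext; simp [Iso.trans, Iso.symm]) (by ext; simp [Iso.trans, Iso.symm]) }

theorem autCard_ne_zero (H : MultiDigraph) : H.autCard ≠ 0 := by
  have : Nonempty (Iso H H) := ⟨Iso.refl H⟩
  exact Nat.card_pos.ne'

/-- Group the |V|! |E|! labellings of H by the labelled graph that they induce: each graph
isomorphic to H receives exactly |Aut H| of them. This is how 1/|Aut H| arises from the weight of
labelled graphs. -/
theorem card_labellings (H : MultiDigraph) {V E : Type} [Fintype V] [Fintype E]
    (hV : Fintype.card V = Fintype.card H.V) (hE : Fintype.card E = Fintype.card H.E) :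
    (Finset.univ.filter fun x : (E → V) × (E → V) => Nonempty (Iso (gr x) H)).card * H.autCard =
      (Fintype.card V).factorial * (Fintype.card E).factorial := by
  have h1 := Nat.card_congr (Equiv.ofBijective _ (labelling_bijective H V E))
  rw [Nat.card_sigma, Nat.card_prod, Nat.card_eq_fintype_card (α := V ≃ H.V),
    Nat.card_eq_fintype_card (α := E ≃ H.E), Fintype.card_equiv (Fintype.equivOfCardEq hV),
    Fintype.card_equiv (Fintype.equivOfCardEq hE)] at h1
  rw [← h1, Finset.card_eq_sum_ones, Finset.sum_mul, Finset.sum_filter]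
  refine Finset.sum_congr rfl fun x _ => ?_
  split_ifs with hx
  · rw [one_mul, card_iso hx.some]
  · rw [not_nonempty_iff] at hx
    exact Nat.card_of_isEmpty.symm

theorem mem_classes {G : MultiDigraph} {k : ℤ} {c : GraphClass} :
    c ∈ stabilizableClasses G k ↔ Stab G (Quotient.out c) ∧ (Quotient.out c).weight = k := by
  constructor
  · rintro ⟨H, rfl, h1, h2, h3⟩
    obtain ⟨i⟩ : Nonempty (Iso H (Quotient.out (Quotient.mk _ H))) :=
      Setoid.symm (Quotient.mk_out H)
    exact ⟨Iso.stab i ⟨h1, h3⟩, by rw [← Iso.weight_eq i, h2]⟩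
  · rintro ⟨⟨h1, h3⟩, h2⟩
    exact ⟨_, Quotient.out_eq c, h1, h2, h3⟩

theorem card_of_weight {H : MultiDigraph} {k : ℕ} (h : H.weight = k) :
    Fintype.card H.E = Fintype.card H.V + k := by
  rw [MultiDigraph.weight] at h
  omega

theorem stab_card_le_of_weight {G H : MultiDigraph} {k : ℕ} (h : Stab G H) (hk : H.weight = k) :
    Fintype.card H.V < 2 * k + 1 := by
  have h1 := stab_card_le h
  have h2 := card_of_weight hk
  omega

/-- The number of vertices is at most 2k, and each class has a representative on initial segments of
the natural numbers. -/
theorem classes_finite (G : MultiDigraph) (k : ℕ) : (stabilizableClasses G k).Finite := by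
  refine Set.Finite.subset (s := ⋃ m ∈ Finset.range (2 * k + 1),
    Set.range fun x : (Fin (m + k) → Fin m) × (Fin (m + k) → Fin m) =>
      (Quotient.mk _ (gr x) : GraphClass)) ?_ ?_
  · exact Set.Finite.biUnion (Finset.finite_toSet _) fun m _ => Set.finite_range _
  · rintro c ⟨H, rfl, h1, h2, h3⟩
    obtain ⟨x, hx⟩ := exists_gr H rfl (card_of_weight h2)
    simp only [Set.mem_iUnion]
    exact ⟨_, Finset.mem_range.mpr (stab_card_le_of_weight ⟨h1, h3⟩ h2), x, Quotient.sound hx⟩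

theorem gr_weight {V E : Type} [Fintype V] [Fintype E] {k : ℕ}
    (hE : Fintype.card E = Fintype.card V + k) (x : (E → V) × (E → V)) : (gr x).weight = k := by
  rw [MultiDigraph.weight]
  have : Fintype.card (gr x).E = Fintype.card (gr x).V + k := hE
  omega

theorem labelWeight_mul {k m N A : ℕ} (z : ℂ) (hA : A ≠ 0)
    (h : N * A = m.factorial * (m + k).factorial) :
    labelWeight k m * (N * z) = (-1) ^ m / A * z := by
  have h' := congrArg (Nat.cast (R := ℂ)) h
  push_cast at h'
  have h1 : (A : ℂ) ≠ 0 := Nat.cast_ne_zero.mpr hA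
  have h2 : (m.factorial : ℂ) ≠ 0 := Nat.cast_ne_zero.mpr m.factorial_ne_zero
  have h3 : ((m + k).factorial : ℂ) ≠ 0 := Nat.cast_ne_zero.mpr (m + k).factorial_ne_zero
  rw [labelWeight]
  field_simp
  linear_combination z * h'

/-- A sum over labelled graphs, written as a sum over isomorphism classes. -/
theorem labelledSum_eq_sum_classes (G : MultiDigraph) (k : ℕ) {V E : Type} [Fintype V]
    [Fintype E] (hE : Fintype.card E = Fintype.card V + k) (P : Matrix (Fin n) (Fin n) ℂ)
    (J : (Fin n → ℕ) → (Fin n → ℕ) → ℂ) :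
    labelWeight k (Fintype.card V) * labelledSum V E
        (fun H => if Stab G H then jetEval H P J else 0) =
      ∑ c ∈ (classes_finite G k).toFinset with Fintype.card (Quotient.out c).V = Fintype.card V,
        (-1) ^ Fintype.card (Quotient.out c).V / ((Quotient.out c).autCard : ℂ) *
          jetEval (Quotient.out c) P J := by
  unfold labelledSum
  rw [← Finset.sum_filter]
  have hmaps : ∀ x ∈ Finset.univ.filter
      (fun x : (E → V) × (E → V) => Stab G (gr x)),
      (Quotient.mk _ (gr x) : GraphClass) ∈ (classes_finite G k).toFinset.filter
        fun c => Fintype.card (Quotient.out c).V = Fintype.card V := by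
    intro x hx
    obtain ⟨i⟩ : Nonempty (Iso (gr x) (Quotient.out (Quotient.mk _ (gr x)))) :=
      Setoid.symm (Quotient.mk_out (gr x))
    rw [Finset.mem_filter, Set.Finite.mem_toFinset, mem_classes]
    refine ⟨⟨Iso.stab i (Finset.mem_filter.mp hx).2, ?_⟩, ?_⟩
    · rw [← Iso.weight_eq i, gr_weight hE]
    · exact (iso_card i).1.symm
  refine (congrArg _ (Finset.sum_fiberwise_of_maps_to hmaps fun x => jetEval (gr x) P J).symm).trans ?_
  rw [Finset.mul_sum]
  refine Finset.sum_congr rfl fun c hc => ?_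
  rw [Finset.mem_filter, Set.Finite.mem_toFinset, mem_classes] at hc
  obtain ⟨⟨hst, hw⟩, hm⟩ := hc
  have hfil : (Finset.univ.filter (fun x : (E → V) × (E → V) =>
      Stab G (gr x))).filter (fun x => (Quotient.mk _ (gr x) : GraphClass) = c) =
      Finset.univ.filter fun x => Nonempty (Iso (gr x) (Quotient.out c)) := by
    ext x
    simp only [Finset.mem_filter, Finset.mem_univ, true_and]
    constructor
    · rintro ⟨-, rfl⟩
      exact Setoid.symm (Quotient.mk_out (gr x))
    · rintro ⟨i⟩
      refine ⟨Iso.stab i.symm hst, ?_⟩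
      rw [← Quotient.out_eq c]
      exact Quotient.sound ⟨i⟩
  rw [hfil]
  have hsum : ∑ x ∈ Finset.univ.filter (fun x : (E → V) × (E → V) =>
      Nonempty (Iso (gr x) (Quotient.out c))), jetEval (gr x) P J =
      ∑ x ∈ Finset.univ.filter (fun x : (E → V) × (E → V) =>
      Nonempty (Iso (gr x) (Quotient.out c))), jetEval (Quotient.out c) P J := by
    refine Finset.sum_congr rfl fun x hx => ?_
    exact (Iso.jetEval (Finset.mem_filter.mp hx).2.some P J).symm
  refine (congrArg _ (hsum.trans (Finset.sum_const _))).trans ?_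
  rw [nsmul_eq_mul, hm]
  refine labelWeight_mul _ (autCard_ne_zero _) ((card_labellings (Quotient.out c) hm.symm ?_).trans ?_)
  · rw [hE, card_of_weight hw, hm]
  · rw [hE]

theorem totalEval_eq_sum_classes (G : MultiDigraph) (k : ℕ) (P : Matrix (Fin n) (Fin n) ℂ)
    (J : (Fin n → ℕ) → (Fin n → ℕ) → ℂ) :
    totalEval G k P J = ∑ c ∈ (classes_finite G k).toFinset,
        (-1) ^ Fintype.card (Quotient.out c).V / ((Quotient.out c).autCard : ℂ) *
          jetEval (Quotient.out c) P J := by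
  rw [totalEval, ← Finset.sum_fiberwise_of_maps_to (t := Finset.range (2 * k + 1))
    (g := fun c : GraphClass => Fintype.card (Quotient.out c).V)]
  · refine Finset.sum_congr rfl fun m _ => ?_
    have h := labelledSum_eq_sum_classes G k (V := Fin m) (E := Fin (m + k)) (by simp) P J
    rwa [Fintype.card_fin] at h
  · intro c hc
    rw [Set.Finite.mem_toFinset, mem_classes] at hc
    exact Finset.mem_range.mpr (stab_card_le_of_weight hc.1 hc.2)

/-- The factors |Aut G| and (-1)^|V(G)| are common to all classes; what remains is the weight of the
labelled sum. -/
theorem finsum_eq_totalEval (G : MultiDigraph) (k : ℕ) (P : Matrix (Fin n) (Fin n) ℂ)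
    (J : (Fin n → ℕ) → (Fin n → ℕ) → ℂ) :
    ∑ᶠ c ∈ stabilizableClasses G k, coefficient G (Quotient.out c) *
        jetEval (Quotient.out c) P J =
      (G.autCard : ℂ) * (-1) ^ Fintype.card G.V * totalEval G k P J := by
  rw [finsum_mem_eq_finite_toFinset_sum _ (classes_finite G k), totalEval_eq_sum_classes,
    Finset.mul_sum]
  refine Finset.sum_congr rfl fun c _ => ?_
  have h : ∀ a b : ℕ, (-1 : ℂ) ^ ((a : ℤ) - (b : ℤ)) = (-1) ^ a * (-1) ^ b := by
    intro a b
    rw [zpow_sub₀ (by norm_num), zpow_natCast, zpow_natCast, div_eq_mul_inv]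
    rcases neg_one_pow_eq_or ℂ b with h | h <;> rw [h] <;> norm_num
  rw [coefficient, h]
  ring

theorem weight_nonneg_of_stable {G : MultiDigraph} (hG : G.Stable) : ∃ k : ℕ, G.weight = k := by
  have h := stab_card_le (G := G) (H := G) ⟨hG.semistable, hG, G, .refl, ⟨Iso.refl G⟩⟩
  refine ⟨Fintype.card G.E - Fintype.card G.V, ?_⟩
  rw [MultiDigraph.weight]
  omega

end Classes

end WeylGraph

namespace WeylGraph

open MultiDigraph Set

/-! ### Invariance under changes of coordinates -/

section Paths

variable {n : ℕ} {p p' : Fin n → ℂ} {L : (Fin n → ℂ) →L[ℂ] (Fin n → ℂ)}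
  {h : (Fin n → ℂ) → Fin n → ℂ} {W W' : Set (Fin n → ℂ)}

theorem sum_single_index (i : Fin n) : ∑ l, (Pi.single i 1 : Fin n → ℕ) l = 1 := by
  simp [Finset.sum_pi_single']

theorem fderiv_eq_zero_of_vanish (hW' : IsOpen W') (hh : DifferentiableOn ℂ h W') (hp' : p' ∈ W')
    (hvan : ∀ q, ∀ γ : Fin n → ℕ, ∑ i, γ i < 2 → mixedDeriv γ 0 (fun y => h y q) p' = 0) :
    fderiv ℂ h p' = 0 := by
  have hd := hh.differentiableAt (hW'.mem_nhds hp')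
  ext v q
  have hv : v = ∑ r, v r • (Pi.single r 1 : Fin n → ℂ) := by
    ext j
    simp [Pi.single_apply]
  rw [hv, map_sum]
  simp only [map_smul, Finset.sum_apply, Pi.smul_apply, smul_eq_mul, zero_apply, Pi.zero_apply]
  refine Finset.sum_eq_zero fun r _ => ?_
  have hs : ContDiffOn ℝ (⊤ : ℕ∞) (fun y => h y q) W' :=
    contDiffOn_pi.mp ((holo_smooth hW' hh).restrict_scalars ℝ) q
  have h1 := hvan q (0 + Pi.single r 1) (by rw [zero_add, sum_single_index]; norm_num)
  rw [mixedDeriv_add_left hW' _ _ _ hs hp', mixedDeriv_zero, dz_holo (differentiableAt_pi.mp hd q),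
    fderiv_component hd] at h1
  rw [h1, mul_zero]

theorem vanish_of_fderiv_eq_zero (hW' : IsOpen W') (hh : DifferentiableOn ℂ h W') (hp' : p' ∈ W')
    (h0 : h p' = 0) (h1 : fderiv ℂ h p' = 0) (q : Fin n) (γ : Fin n → ℕ) (hγ : ∑ i, γ i < 2) :
    mixedDeriv γ 0 (fun y => h y q) p' = 0 := by
  have hd := hh.differentiableAt (hW'.mem_nhds hp')
  have hs : ContDiffOn ℝ (⊤ : ℕ∞) (fun y => h y q) W' :=
    contDiffOn_pi.mp ((holo_smooth hW' hh).restrict_scalars ℝ) q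
  obtain ⟨m, a, rfl⟩ := exists_cnt γ
  rw [sum_cnt, Finset.card_univ, Fintype.card_fin] at hγ
  interval_cases m
  · have : cnt Finset.univ a = 0 := by simp [cnt]
    rw [this, mixedDeriv_zero, h0, Pi.zero_apply]
  · have : cnt Finset.univ a = 0 + Pi.single (a 0) 1 := by simp [cnt]
    rw [this, mixedDeriv_add_left hW' _ _ _ hs hp', mixedDeriv_zero,
      dz_holo (differentiableAt_pi.mp hd q), fderiv_component hd, h1]
    rfl

/-- At the base point φ_t has value p and derivative L for all t, so the path is admissible there
for every real time. -/
theorem mem_pathDom (hW' : IsOpen W') (hh : DifferentiableOn ℂ h W') (hp : p ∈ W) (hp' : p' ∈ W')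
    (hL : IsUnit L)
    (hvan : ∀ q, ∀ γ : Fin n → ℕ, ∑ i, γ i < 2 → mixedDeriv γ 0 (fun y => h y q) p' = 0) (t : ℝ) :
    (t, p') ∈ pathDom p p' L h W W' := by
  have h0 : h p' = 0 := by
    ext q
    have := hvan q 0 (by simp)
    rwa [mixedDeriv_zero] at this
  refine ⟨hp', ?_, ?_⟩
  · simpa [pathMap, h0] using hp
  · have h1 : pathDeriv L h t p' = L := by
      rw [pathDeriv, fderiv_eq_zero_of_vanish hW' hh hp' hvan]
      ext v : 1
      simp
    change IsUnit (pathDeriv L h t p')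
    rw [h1]
    exact hL

theorem pathVec_eq_zero (hW : IsOpen W) (hW' : IsOpen W') (hh : DifferentiableOn ℂ h W')
    (hp : p ∈ W) (hp' : p' ∈ W') (hL : IsUnit L) {m : ℕ} (hm : 2 ≤ m)
    (hvan : ∀ q, ∀ γ : Fin n → ℕ, ∑ i, γ i < m → mixedDeriv γ 0 (fun y => h y q) p' = 0) (t : ℝ)
    (q : Fin n) (γ : Fin n → ℕ) (hγ : ∑ i, γ i < m) :
    mixedDeriv γ 0 (fun y => pathVec L h t y q) p' = 0 := by
  have hx := mem_pathDom hW' hh hp hp' hL (fun q γ h => hvan q γ (h.trans_le hm)) t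
  have h1 : L (fun r => mixedDeriv γ 0 (fun y => pathVec L h t y r) p') = 0 := by
    ext q
    rw [pathVec_jet hW hW' hh hx hL hm hvan γ hγ.le, hvan q γ hγ, Pi.zero_apply]
  obtain ⟨u, rfl⟩ := hL
  have h2 := congrArg (fun v => (↑u⁻¹ : (Fin n → ℂ) →L[ℂ] (Fin n → ℂ)) v) h1
  have h3 : ∀ v, (↑u⁻¹ : (Fin n → ℂ) →L[ℂ] (Fin n → ℂ)) ((u : (Fin n → ℂ) →L[ℂ] (Fin n → ℂ)) v)
      = v := fun v => congrArg (fun A : (Fin n → ℂ) →L[ℂ] (Fin n → ℂ) => A v) (Units.inv_mul u)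
  simp only [h3, map_zero] at h2
  exact congrFun h2 q

theorem mixedDeriv_conj_pathVec (hW : IsOpen W) (hW' : IsOpen W') (hh : DifferentiableOn ℂ h W')
    {t : ℝ} (hx : (t, p') ∈ pathDom p p' L h W W') (q : Fin n) (γ : Fin n → ℕ) :
    mixedDeriv 0 γ (fun y => (starRingEnd ℂ) (pathVec L h t y q)) p' =
      (starRingEnd ℂ) (mixedDeriv γ 0 (fun y => pathVec L h t y q) p') :=
  mixedDeriv_conj (isOpen_slice (isOpen_pathDom hW hW' hh) t) γ 0
    (smooth_slice (smooth_pathVec (p := p) (p' := p') (L := L) (W := W) hW' hh q) t) hx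

open scoped Classical in
theorem hasDerivAt_path_jetVar (hW : IsOpen W) (hW' : IsOpen W') (hh : DifferentiableOn ℂ h W')
    {f : (Fin n → ℂ) → ℂ} (hf : ContDiffOn ℝ (⊤ : ℕ∞) f W) {t : ℝ} {x : Fin n → ℂ}
    (hx : (t, x) ∈ pathDom p p' L h W W') {ε : Type*} (S T : Finset ε) (a b : ε → Fin n) :
    HasDerivAt (fun s => mixedDeriv (cnt S a) (cnt T b) (fun y => f (pathMap p p' L h s y)) x)
      (jetVar (fun α β => mixedDeriv α β (fun y => f (pathMap p p' L h t y)) x)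
        (fun q γ => mixedDeriv γ 0 (fun y => pathVec L h t y q) x)
        (fun q γ => mixedDeriv 0 γ (fun y => (starRingEnd ℂ) (pathVec L h t y q)) x) S T a b) t :=
  hasDerivAt_path hW hW' hh hf hx S T a b

end Paths

/-! ### Jets of the potential and invariance of the sum -/

section Jets

open scoped Classical

variable {n : ℕ}

/-- A metric determines only those derivatives of a potential that have both a barred and an
unbarred index, so two potentials of one metric can differ in the others. -/
theorem mixedDeriv_congr_hessian {U : Set (Fin n → ℂ)} (hU : IsOpen U) {f g : (Fin n → ℂ) → ℂ}
    (hf : ContDiffOn ℝ (⊤ : ℕ∞) f U) (hg : ContDiffOn ℝ (⊤ : ℕ∞) g U)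
    (hfg : ∀ i j, EqOn (dz i (dzbar j f)) (dz i (dzbar j g)) U) {α β : Fin n → ℕ} (hα : α ≠ 0)
    (hβ : β ≠ 0) {x : Fin n → ℂ} (hx : x ∈ U) : mixedDeriv α β f x = mixedDeriv α β g x := by
  induction α using multiIndex_induction with
  | zero => exact absurd rfl hα
  | add α i =>
    induction β using multiIndex_induction with
    | zero => exact absurd rfl hβ
    | add β j =>
      rw [mixedDeriv_add_add hU _ _ _ _ hf hx, mixedDeriv_add_add hU _ _ _ _ hg hx]
      exact (localOp_mixedDeriv hU α β).congr _ _ (hfg i j) hx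

theorem cnt_ne_zero {ε : Type*} {S : Finset ε} (a : ε → Fin n) (hS : 1 ≤ S.card) :
    cnt S a ≠ 0 := by
  intro h
  have := sum_cnt S a
  rw [h] at this
  simp at this
  simp [← this] at hS

/-- Every vertex of a semistable graph has an inward and an outward edge, so its value involves only
derivatives with indices of both kinds. -/
theorem jetEval_congr {H : MultiDigraph} (hH : H.Semistable) (P : Matrix (Fin n) (Fin n) ℂ)
    {J J' : (Fin n → ℕ) → (Fin n → ℕ) → ℂ}
    (h : ∀ α β, α ≠ 0 → β ≠ 0 → J α β = J' α β) : jetEval H P J = jetEval H P J' := by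
  unfold jetEval
  refine Finset.sum_congr rfl fun a _ => Finset.sum_congr rfl fun b _ => ?_
  congr 1
  refine Finset.prod_congr rfl fun v _ => h _ _ (cnt_ne_zero _ ?_) (cnt_ne_zero _ ?_)
  · rw [card_outE]
    exact (hH v).2.1
  · rw [card_inE]
    exact (hH v).1

theorem totalEval_congr (G : MultiDigraph) (k : ℕ) {P P' : Matrix (Fin n) (Fin n) ℂ}
    {J J' : (Fin n → ℕ) → (Fin n → ℕ) → ℂ}
    (h : ∀ H : MultiDigraph, H.Semistable → jetEval H P J = jetEval H P' J') :
    totalEval G k P J = totalEval G k P' J' := by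
  unfold totalEval labelledSum
  refine Finset.sum_congr rfl fun m _ => ?_
  congr 1
  refine Finset.sum_congr rfl fun x _ => ?_
  beta_reduce
  split_ifs with hx
  · exact h _ hx.1
  · rfl

theorem linMatrix_mulVec (L : (Fin n → ℂ) →L[ℂ] (Fin n → ℂ)) (v : Fin n → ℂ) :
    (linMatrix L).mulVec v = L v := by
  have hv : v = ∑ r, v r • (Pi.single r 1 : Fin n → ℂ) := by
    ext j
    simp [Pi.single_apply]
  conv_rhs => rw [hv, map_sum]
  ext q
  simp [Matrix.mulVec, dotProduct, linMatrix, mul_comm]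

theorem isUnit_of_linMatrix {L : (Fin n → ℂ) →L[ℂ] (Fin n → ℂ)} (h : (linMatrix L).det ≠ 0) :
    IsUnit L := by
  have hu : IsUnit (linMatrix L).det := isUnit_iff_ne_zero.mpr h
  rw [isUnit_iff_exists]
  refine ⟨LinearMap.toContinuousLinearMap (Matrix.toLin' (linMatrix L)⁻¹), ?_, ?_⟩
  · ext v : 1
    change L ((linMatrix L)⁻¹.mulVec v) = v
    rw [← linMatrix_mulVec, Matrix.mulVec_mulVec, Matrix.mul_nonsing_inv _ hu, Matrix.one_mulVec]
  · ext v : 1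
    change (linMatrix L)⁻¹.mulVec (L v) = v
    rw [← linMatrix_mulVec, Matrix.mulVec_mulVec, Matrix.nonsing_inv_mul _ hu, Matrix.one_mulVec]

/-- The complexified potential of a chart. -/
def KahlerChart.pot (M : KahlerChart n) (x : Fin n → ℂ) : ℂ := (M.potential x : ℂ)

/-- The jet of the potential at the base point. -/
noncomputable def KahlerChart.jet (M : KahlerChart n) (α β : Fin n → ℕ) : ℂ :=
  mixedDeriv α β M.pot M.pt

/-- The combination of graphs, evaluated on a chart. -/
noncomputable def totalInvariant (G : MultiDigraph) (k : ℕ) (M : KahlerChart n) : ℂ :=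
  totalEval G k (M.metric M.pt)⁻¹ M.jet

theorem KahlerChart.pot_smooth (M : KahlerChart n) : ContDiffOn ℝ (⊤ : ℕ∞) M.pot M.dom :=
  ofReal_smooth M.smooth

theorem KahlerChart.jet_single (M : KahlerChart n) (i j : Fin n) :
    M.jet (Pi.single i 1) (Pi.single j 1) = M.metric M.pt i j := by
  have := mixedDeriv_add_add M.isOpen_dom 0 0 i j M.pot_smooth M.pt_mem
  rw [zero_add, zero_add, mixedDeriv_zero] at this
  exact this

open scoped ComplexOrder in
theorem KahlerChart.isUnit_metric (M : KahlerChart n) {x : Fin n → ℂ} (hx : x ∈ M.dom) :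
    IsUnit (M.metric x).det :=
  (Matrix.isUnit_iff_isUnit_det _).mp (M.posDef x hx).isUnit

theorem KahlerChart.eval_eq (M : KahlerChart n) (H : MultiDigraph) :
    H.eval M = jetEval H (M.metric M.pt)⁻¹ M.jet := eval_eq_jetEval H M

theorem pullback_apply (g A : Matrix (Fin n) (Fin n) ℂ) (i j : Fin n) :
    ∑ p, ∑ q, g p q * A p i * (starRingEnd ℂ) (A q j) =
      (A.transpose * g * A.map (starRingEnd ℂ)) i j := by
  simp only [Matrix.mul_apply, Finset.sum_mul, Matrix.transpose_apply, Matrix.map_apply]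
  rw [Finset.sum_comm]
  refine Finset.sum_congr rfl fun q _ => Finset.sum_congr rfl fun r _ => ?_
  ring

theorem metric_eq_of_coordinateChange {M' M : KahlerChart n} {φ : (Fin n → ℂ) → Fin n → ℂ}
    (hφ : M'.IsCoordinateChange M φ) {x : Fin n → ℂ} (hx : x ∈ M'.dom) :
    M'.metric x = (linMatrix (fderiv ℂ φ x)).transpose * M.metric (φ x) *
      (linMatrix (fderiv ℂ φ x)).map (starRingEnd ℂ) := by
  ext i j
  rw [hφ.pullback x hx i j]
  exact pullback_apply _ (linMatrix (fderiv ℂ φ x)) i j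

/-- The combination of graphs is invariant under changes of coordinates. -/
theorem totalInvariant_coordinateChange (G : MultiDigraph) (k : ℕ) {M' M : KahlerChart n}
    {φ : (Fin n → ℂ) → Fin n → ℂ} (hφ : M'.IsCoordinateChange M φ) :
    totalInvariant G k M' = totalInvariant G k M := by
  set L := fderiv ℂ φ M'.pt with hLdef
  set A := linMatrix L with hA
  have hmet := metric_eq_of_coordinateChange hφ M'.pt_mem
  rw [hφ.map_pt, ← hLdef, ← hA] at hmet
  have hu' := M'.isUnit_metric M'.pt_mem
  have hu := M.isUnit_metric M.pt_mem
  have hAu : IsUnit A.det := by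
    have h1 := hu'
    rw [hmet, Matrix.det_mul, Matrix.det_mul, Matrix.det_transpose] at h1
    exact isUnit_of_mul_isUnit_left (isUnit_of_mul_isUnit_left h1)
  have hL : IsUnit L := isUnit_of_linMatrix hAu.ne_zero
  -- The remainder of φ after its affine part: the path leads from the affine map at t = 0 to φ at t
  -- = 1.
  set h : (Fin n → ℂ) → Fin n → ℂ := fun w => φ w - (M.pt + L (w - M'.pt)) with hh
  have haff : ∀ w, HasFDerivAt (fun y => M.pt + L (y - M'.pt)) L w := fun w =>
    (L.hasFDerivAt.comp w ((hasFDerivAt_id w).sub_const M'.pt)).const_add M.pt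
  have hhd : DifferentiableOn ℂ h M'.dom := hφ.holomorphic.sub fun w _ =>
    (haff w).differentiableAt.differentiableWithinAt
  have hvan := vanish_of_fderiv_eq_zero M'.isOpen_dom hhd M'.pt_mem
    (by simp [hh, hφ.map_pt])
    (by
      have h1 := (hφ.holomorphic.differentiableAt
        (M'.isOpen_dom.mem_nhds M'.pt_mem)).hasFDerivAt.sub (haff M'.pt)
      rw [← hLdef, sub_self] at h1
      exact h1.fderiv)
  set J : ℝ → (Fin n → ℕ) → (Fin n → ℕ) → ℂ := fun t α β =>
    mixedDeriv α β (fun y => M.pot (pathMap M.pt M'.pt L h t y)) M'.pt with hJ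
  have hdom := mem_pathDom M'.isOpen_dom hhd M.pt_mem M'.pt_mem hL hvan
  have hξ := pathVec_eq_zero M.isOpen_dom M'.isOpen_dom hhd M.pt_mem M'.pt_mem hL le_rfl hvan
  have hη : ∀ (t : ℝ) (q : Fin n) (γ : Fin n → ℕ), ∑ i, γ i < 2 →
      mixedDeriv 0 γ (fun y => (starRingEnd ℂ) (pathVec L h t y q)) M'.pt = 0 := by
    intro t q γ hγ
    rw [mixedDeriv_conj_pathVec M.isOpen_dom M'.isOpen_dom hhd (hdom t), hξ t q γ hγ, map_zero]
  have hder : ∀ (t : ℝ) (ε : Type) (S T : Finset ε) (a b : ε → Fin n),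
      HasDerivAt (fun s => J s (cnt S a) (cnt T b)) (jetVar (J t)
        (fun q γ => mixedDeriv γ 0 (fun y => pathVec L h t y q) M'.pt)
        (fun q γ => mixedDeriv 0 γ (fun y => (starRingEnd ℂ) (pathVec L h t y q)) M'.pt)
        S T a b) t := fun t ε S T a b =>
    hasDerivAt_path_jetVar M.isOpen_dom M'.isOpen_dom hhd M.pot_smooth (hdom t) S T a b
  have hpath1 : ∀ y, pathMap M.pt M'.pt L h 1 y = φ y := by
    intro y
    simp [pathMap, hh]
  -- The given potential of M' and the pullback of that of M are different functions in general, but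
  -- they have the same complex Hessian.
  have hJ1 : ∀ α β, α ≠ 0 → β ≠ 0 → M'.jet α β = J 1 α β := by
    intro α β hα hβ
    simp only [hJ, hpath1]
    refine mixedDeriv_congr_hessian M'.isOpen_dom M'.pot_smooth
      (M.pot_smooth.comp ((holo_smooth M'.isOpen_dom hφ.holomorphic).restrict_scalars ℝ) hφ.mapsTo)
      (fun i j x hx => ?_) hα hβ M'.pt_mem
    exact (hφ.pullback x hx i j).trans
      (dz_dzbar_comp M'.isOpen_dom M.isOpen_dom hφ.holomorphic hφ.mapsTo M.pot_smooth i j hx).symm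
  have hsingle : ∀ i : Fin n, (Pi.single i 1 : Fin n → ℕ) ≠ 0 := fun i h0 => by
    have := congrFun h0 i
    simp at this
  have hP : Matrix.of (fun i j => J 0 (Pi.single i 1) (Pi.single j 1)) * (M'.metric M'.pt)⁻¹ = 1 := by
    have : Matrix.of (fun i j => J 0 (Pi.single i 1) (Pi.single j 1)) = M'.metric M'.pt := by
      ext i j
      -- The metric at the base point is the same at t = 0 and at t = 1, and at t = 1 it is that of
      -- M'.
      rw [Matrix.of_apply, metric_const hξ hη hder 0 1, ← hJ1 _ _ (hsingle i) (hsingle j),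
        M'.jet_single]
    rw [this, Matrix.mul_nonsing_inv _ hu']
  have hPM : A.map (starRingEnd ℂ) * (M'.metric M'.pt)⁻¹ * A.transpose = (M.metric M.pt)⁻¹ := by
    have hAc : IsUnit (A.map (starRingEnd ℂ)).det := by
      rw [← RingHom.mapMatrix_apply, ← RingHom.map_det]
      exact hAu.map _
    have hAt : IsUnit A.transpose.det := by rwa [Matrix.det_transpose]
    rw [hmet, Matrix.mul_inv_rev, Matrix.mul_inv_rev, ← Matrix.mul_assoc, ← Matrix.mul_assoc,
      Matrix.mul_nonsing_inv _ hAc, Matrix.one_mul, Matrix.mul_assoc,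
      Matrix.nonsing_inv_mul _ hAt, Matrix.mul_one]
  calc totalInvariant G k M' = totalEval G k (M'.metric M'.pt)⁻¹ (J 1) :=
        totalEval_congr G k fun H hH => jetEval_congr hH _ hJ1
    _ = totalEval G k (M'.metric M'.pt)⁻¹ (J 0) := totalEval_const G k _ hξ hη hder hP 1 0
    _ = totalInvariant G k M := by
        refine totalEval_congr G k fun H _ => ?_
        have h0 := jetEval_comp_affine M.isOpen_dom M.pt M'.pt M.pt_mem L M.pot_smooth H
          (M'.metric M'.pt)⁻¹
        rw [← hA, hPM] at h0
        refine Eq.trans ?_ h0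
        simp [hJ, pathMap]

end Jets

end WeylGraph

namespace WeylGraph

open Set

/-! ### Taylor monomials -/

section Monomials

variable {n : ℕ}

/-- The monomial with exponent `γ` in the coordinates centered at `p`, divided by `γ!`. -/
noncomputable def taylorMonomial (p : Fin n → ℂ) (γ : Fin n → ℕ) (w : Fin n → ℂ) : ℂ :=
  ∏ l, (w l - p l) ^ γ l / (γ l).factorial

theorem differentiable_taylorMonomial (p : Fin n → ℂ) (γ : Fin n → ℕ) :
    Differentiable ℂ (taylorMonomial p γ) := by
  unfold taylorMonomial
  fun_prop

theorem hasDerivAt_pow_div_factorial (c : ℂ) (k : ℕ) :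
    HasDerivAt (fun s : ℂ => (c + s) ^ (k + 1) / ((k + 1).factorial : ℂ)) (c ^ k / k.factorial)
      0 := by
  have h1 : HasDerivAt (fun s : ℂ => (c + s) ^ (k + 1) / ((k + 1).factorial : ℂ))
      ((((k + 1 : ℕ) : ℂ) * (c + 0) ^ k * 1) / ((k + 1).factorial : ℂ)) 0 :=
    (((hasDerivAt_id (0 : ℂ)).const_add c).pow (k + 1)).div_const _
  refine h1.congr_deriv ?_
  have h2 : (k.factorial : ℂ) ≠ 0 := Nat.cast_ne_zero.mpr k.factorial_ne_zero
  have h3 : ((k : ℂ) + 1) ≠ 0 := by exact_mod_cast k.succ_ne_zero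
  rw [Nat.factorial_succ]
  push_cast
  field_simp
  simp

theorem taylorMonomial_line (p : Fin n → ℂ) (γ : Fin n → ℕ) (w : Fin n → ℂ) (i : Fin n) (s : ℂ) :
    taylorMonomial p γ (w + s • Pi.single i 1) =
      ((w i - p i) + s) ^ γ i / (γ i).factorial *
        ∏ l ∈ Finset.univ.erase i, (w l - p l) ^ γ l / (γ l).factorial := by
  rw [taylorMonomial, ← Finset.mul_prod_erase _ _ (Finset.mem_univ i)]
  congr 1
  · simp only [Pi.add_apply, Pi.smul_apply, Pi.single_eq_same, smul_eq_mul, mul_one]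
    rw [add_sub_right_comm]
  · refine Finset.prod_congr rfl fun l hl => ?_
    simp [Finset.ne_of_mem_erase hl]

theorem dz_eq_of_hasDerivAt_line {f : (Fin n → ℂ) → ℂ} (hf : Differentiable ℂ f) (i : Fin n)
    (w : Fin n → ℂ) {c : ℂ} (h : HasDerivAt (fun s : ℂ => f (w + s • Pi.single i 1)) c 0) :
    dz i f w = c := by
  rw [dz_holo (hf w)]
  have h1 : HasDerivAt (fun s : ℂ => w + s • (Pi.single i 1 : Fin n → ℂ)) (Pi.single i 1) 0 := by
    have := ((hasDerivAt_id (0 : ℂ)).smul_const (Pi.single i 1 : Fin n → ℂ)).const_add w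
    rwa [one_smul] at this
  have h2 : HasFDerivAt f (fderiv ℂ f w) (w + (0 : ℂ) • (Pi.single i 1 : Fin n → ℂ)) := by
    rw [zero_smul, add_zero]
    exact (hf w).hasFDerivAt
  exact (h2.comp_hasDerivAt (0 : ℂ) h1).unique h

theorem dz_taylorMonomial_add (p : Fin n → ℂ) (γ : Fin n → ℕ) (i : Fin n) :
    dz i (taylorMonomial p (γ + Pi.single i 1)) = taylorMonomial p γ := by
  ext w
  refine dz_eq_of_hasDerivAt_line (differentiable_taylorMonomial _ _) i w ?_
  simp only [taylorMonomial_line, Pi.add_apply, Pi.single_eq_same]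
  have h1 := (hasDerivAt_pow_div_factorial (w i - p i) (γ i)).mul_const
    (∏ l ∈ Finset.univ.erase i, (w l - p l) ^ (γ l + (Pi.single i 1 : Fin n → ℕ) l) /
      ((γ l + (Pi.single i 1 : Fin n → ℕ) l).factorial : ℂ))
  refine h1.congr_deriv ?_
  rw [taylorMonomial, ← Finset.mul_prod_erase _ _ (Finset.mem_univ i)]
  congr 1
  refine Finset.prod_congr rfl fun l hl => ?_
  simp [Finset.ne_of_mem_erase hl]

theorem dz_taylorMonomial_eq_zero (p : Fin n → ℂ) {γ : Fin n → ℕ} {i : Fin n} (h : γ i = 0) :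
    dz i (taylorMonomial p γ) = fun _ => 0 := by
  ext w
  refine dz_eq_of_hasDerivAt_line (differentiable_taylorMonomial _ _) i w ?_
  simp only [taylorMonomial_line, h, pow_zero]
  exact hasDerivAt_const _ _

theorem smooth_taylorMonomial (p : Fin n → ℂ) (γ : Fin n → ℕ) :
    ContDiffOn ℝ (⊤ : ℕ∞) (taylorMonomial p γ) univ :=
  (contDiffOn_of_differentiableOn isOpen_univ
    (differentiable_taylorMonomial p γ).differentiableOn).restrict_scalars ℝ

theorem mixedDeriv_taylorMonomial (p : Fin n → ℂ) (α γ : Fin n → ℕ) :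
    mixedDeriv α 0 (taylorMonomial p γ) p = if α = γ then 1 else 0 := by
  induction α using multiIndex_induction generalizing γ with
  | zero =>
    rw [mixedDeriv_zero, taylorMonomial]
    split_ifs with h
    · simp [← h]
    · obtain ⟨l, hl⟩ : ∃ l, γ l ≠ 0 := by
        by_contra! hc
        exact h (funext fun l => (hc l).symm)
      refine Finset.prod_eq_zero (Finset.mem_univ l) ?_
      simp [hl]
  | add α i ih =>
    rw [mixedDeriv_add_left isOpen_univ α 0 i (smooth_taylorMonomial p γ) (mem_univ p)]
    by_cases hi : γ i = 0
    · rw [dz_taylorMonomial_eq_zero p hi,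
        (localOp_mixedDeriv isOpen_univ α 0).zero (fun _ _ => rfl) (mem_univ p), if_neg]
      intro h
      have := congrFun h i
      simp [hi] at this
    · obtain ⟨γ', rfl⟩ : ∃ γ' : Fin n → ℕ, γ = γ' + Pi.single i 1 := by
        refine ⟨γ - Pi.single i 1, ?_⟩
        ext l
        by_cases hl : l = i
        · subst hl
          simp
          omega
        · simp [hl]
      rw [dz_taylorMonomial_add, ih]
      simp only [add_left_inj]

/-- A holomorphic map with prescribed derivatives of order `m` and vanishing derivatives of lower
order. -/
theorem exists_holomorphic_jet (p : Fin n → ℂ) (m : ℕ) (c : Fin n → (Fin n → ℕ) → ℂ) :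
    ∃ h : (Fin n → ℂ) → Fin n → ℂ, Differentiable ℂ h ∧
      (∀ q γ, ∑ i, γ i < m → mixedDeriv γ 0 (fun y => h y q) p = 0) ∧
      ∀ q γ, ∑ i, γ i = m → mixedDeriv γ 0 (fun y => h y q) p = c q γ := by
  classical
  refine ⟨fun w q => ∑ γ ∈ Finset.univ.piAntidiag m, c q γ * taylorMonomial p γ w, ?_, ?_⟩
  · rw [differentiable_pi]
    intro q
    exact Differentiable.fun_sum fun γ _ => (differentiable_taylorMonomial p γ).const_mul _
  have hval : ∀ q α, mixedDeriv α 0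
      (fun y => ∑ γ ∈ Finset.univ.piAntidiag m, c q γ * taylorMonomial p γ y) p =
      ∑ γ ∈ Finset.univ.piAntidiag m, c q γ * if α = γ then 1 else 0 := by
    intro q α
    have hop := localOp_mixedDeriv (n := n) isOpen_univ α 0
    rw [hop.sum _ _ (fun γ _ => contDiffOn_const.mul (smooth_taylorMonomial p γ)) (mem_univ p)]
    refine Finset.sum_congr rfl fun γ _ => ?_
    rw [hop.const_mul _ _ (smooth_taylorMonomial p γ) (mem_univ p)]
    beta_reduce
    rw [mixedDeriv_taylorMonomial]
  constructor
  · intro q γ hγ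
    rw [hval]
    refine Finset.sum_eq_zero fun γ' hγ' => ?_
    rw [if_neg, mul_zero]
    rintro rfl
    exact hγ.ne (Finset.mem_piAntidiag.mp hγ').1
  · intro q γ hγ
    rw [hval]
    simp only [mul_ite, mul_one, mul_zero, Finset.sum_ite_eq, Finset.mem_piAntidiag]
    rw [if_pos ⟨hγ, fun i _ => Finset.mem_univ i⟩]

end Monomials

end WeylGraph

namespace WeylGraph

open MultiDigraph Set

/-! ### Normal coordinates -/

section Normal

variable {n : ℕ}

theorem isUnit_linMatrix {L : (Fin n → ℂ) →L[ℂ] (Fin n → ℂ)} (h : IsUnit L) :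
    IsUnit (linMatrix L) := by
  rw [← Matrix.mulVec_injective_iff_isUnit]
  obtain ⟨u, rfl⟩ := h
  intro v w hvw
  rw [linMatrix_mulVec, linMatrix_mulVec] at hvw
  exact (ContinuousLinearEquiv.unitsEquiv ℂ (Fin n → ℂ) u).injective hvw

/-- The inverse function theorem; shrinking the domain is what turns a polynomial map into a change
of coordinates. -/
theorem exists_injOn {φ : (Fin n → ℂ) → Fin n → ℂ} (hφ : Differentiable ℂ φ) {p : Fin n → ℂ}
    (hp : IsUnit (fderiv ℂ φ p)) : ∃ V, IsOpen V ∧ p ∈ V ∧ InjOn φ V := by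
  obtain ⟨u, hu⟩ := hp
  have h1 : HasStrictFDerivAt φ (fderiv ℂ φ p) p :=
    (((holo_smooth isOpen_univ hφ.differentiableOn).contDiffAt
      (isOpen_univ.mem_nhds (mem_univ p))).hasStrictFDerivAt (by simp))
  have h2 : HasStrictFDerivAt φ
      (ContinuousLinearEquiv.unitsEquiv ℂ (Fin n → ℂ) u : (Fin n → ℂ) →L[ℂ] (Fin n → ℂ)) p := by
    have : (ContinuousLinearEquiv.unitsEquiv ℂ (Fin n → ℂ) u : (Fin n → ℂ) →L[ℂ] (Fin n → ℂ)) =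
        fderiv ℂ φ p := by
      rw [← hu]
      rfl
    rwa [this]
  exact ⟨_, (h2.toOpenPartialHomeomorph φ).open_source, h2.mem_toOpenPartialHomeomorph_source,
    (h2.toOpenPartialHomeomorph φ).injOn⟩

open scoped ComplexOrder in
theorem pullback_posDef {g A : Matrix (Fin n) (Fin n) ℂ} (hg : g.PosDef) (hA : IsUnit A) :
    (A.transpose * g * A.map (starRingEnd ℂ)).PosDef := by
  have h1 : A.transpose = (A.map (starRingEnd ℂ)).conjTranspose := by
    ext i j
    simp [Matrix.conjTranspose_apply]
  rw [h1]
  refine hg.conjTranspose_mul_mul_same (Matrix.mulVec_injective_iff_isUnit.mpr ?_)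
  exact hA.map (starRingEnd ℂ).mapMatrix

/-- The chart obtained from `M` by a locally invertible holomorphic map. -/
theorem exists_pullback_chart (M : KahlerChart n) {φ : (Fin n → ℂ) → Fin n → ℂ}
    (hφ : Differentiable ℂ φ) {p : Fin n → ℂ} (hp : φ p = M.pt) (hu : IsUnit (fderiv ℂ φ p)) :
    ∃ M' : KahlerChart n, M'.pt = p ∧ M'.pot = (fun x => M.pot (φ x)) ∧
      M'.IsCoordinateChange M φ := by
  obtain ⟨V, hV, hpV, hinj⟩ := exists_injOn hφ hu
  have hcont : Continuous (fderiv ℂ φ) := by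
    have h1 := (holo_smooth isOpen_univ hφ.differentiableOn)
    exact (contDiffOn_univ.mp h1).continuous_fderiv (by simp)
  set U : Set (Fin n → ℂ) := V ∩ φ ⁻¹' M.dom ∩ {x | IsUnit (fderiv ℂ φ x)} with hUdef
  have hU : IsOpen U := (hV.inter (M.isOpen_dom.preimage hφ.continuous)).inter
    (Units.isOpen.preimage hcont)
  have hmaps : MapsTo φ U M.dom := fun x hx => hx.1.2
  have hpull : ∀ x ∈ U, ∀ i j, complexHessian (fun y => M.potential (φ y)) x i j =
      ∑ p, ∑ q, M.metric (φ x) p q * fderiv ℂ φ x (Pi.single i 1) p *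
        (starRingEnd ℂ) (fderiv ℂ φ x (Pi.single j 1) q) := fun x hx i j =>
    dz_dzbar_comp hU M.isOpen_dom hφ.differentiableOn hmaps M.pot_smooth i j hx
  refine ⟨⟨U, hU, p, ⟨⟨hpV, ?_⟩, hu⟩, fun x => M.potential (φ x), ?_, ?_⟩, rfl, rfl, ?_⟩
  · rw [mem_preimage, hp]
    exact M.pt_mem
  · exact M.smooth.comp ((holo_smooth hU hφ.differentiableOn).restrict_scalars ℝ) hmaps
  · intro x hx
    have h1 : complexHessian (fun y => M.potential (φ y)) x =
        (linMatrix (fderiv ℂ φ x)).transpose * M.metric (φ x) *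
          (linMatrix (fderiv ℂ φ x)).map (starRingEnd ℂ) := by
      ext i j
      rw [hpull x hx i j]
      exact pullback_apply _ (linMatrix (fderiv ℂ φ x)) i j
    rw [h1]
    exact pullback_posDef (M.posDef _ hx.1.2) (isUnit_linMatrix hx.2)
  · exact ⟨hmaps, hφ.differentiableOn, hinj.mono fun x hx => hx.1.1, hp, hpull⟩

/-! ### Normality in terms of the jet of the potential -/

theorem KahlerChart.jet_conj (M : KahlerChart n) (α β : Fin n → ℕ) :
    M.jet β α = (starRingEnd ℂ) (M.jet α β) := by
  have h := mixedDeriv_conj M.isOpen_dom α β M.pot_smooth M.pt_mem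
  have h1 : (fun x => (starRingEnd ℂ) (M.pot x)) = M.pot := by
    ext x
    exact Complex.conj_ofReal _
  rwa [h1] at h

/-- Normality up to order `m`, in terms of the jet of the potential. -/
def KahlerChart.NormalBelow (M : KahlerChart n) (m : ℕ) : Prop :=
  M.metric M.pt = 1 ∧ ∀ (α : Fin n → ℕ) (j : Fin n), 2 ≤ ∑ i, α i → ∑ i, α i < m →
    M.jet α (Pi.single j 1) = 0

theorem KahlerChart.NormalBelow.jet_eq_zero' {M : KahlerChart n} {m : ℕ} (h : M.NormalBelow m)
    (α : Fin n → ℕ) (j : Fin n) (h2 : 2 ≤ ∑ i, α i) (hm : ∑ i, α i < m) :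
    M.jet (Pi.single j 1) α = 0 := by
  rw [M.jet_conj, h.2 α j h2 hm, map_zero]

theorem exists_add_single {α : Fin n → ℕ} (h : 1 ≤ ∑ i, α i) :
    ∃ (β : Fin n → ℕ) (i : Fin n), α = β + Pi.single i 1 := by
  induction α using multiIndex_induction with
  | zero => simp at h
  | add β i => exact ⟨β, i, rfl⟩

theorem sum_add_single (β : Fin n → ℕ) (i : Fin n) :
    ∑ l, (β + Pi.single i 1 : Fin n → ℕ) l = ∑ l, β l + 1 := by
  simp only [Pi.add_apply, Finset.sum_add_distrib, sum_single_index]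

/-- A derivative of order l of the metric is one of the potential with l + 1 indices of one kind and
one of the other, so orders 1, …, N become 2 ≤ |α| < N + 2. The antiholomorphic conditions are
conjugate to the holomorphic ones because the potential is real. -/
theorem KahlerChart.isNormal_iff (M : KahlerChart n) (N : ℕ) :
    M.IsNormal N ↔ M.NormalBelow (N + 2) := by
  have key : ∀ (α : Fin n → ℕ) (i j : Fin n),
      mixedDeriv α 0 (fun x => M.metric x i j) M.pt =
        M.jet (α + Pi.single i 1) (Pi.single j 1) := by
    intro α i j
    have := mixedDeriv_add_add M.isOpen_dom α 0 i j M.pot_smooth M.pt_mem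
    rw [zero_add] at this
    exact this.symm
  have key' : ∀ (α : Fin n → ℕ) (i j : Fin n),
      mixedDeriv 0 α (fun x => M.metric x i j) M.pt =
        M.jet (Pi.single i 1) (α + Pi.single j 1) := by
    intro α i j
    have := mixedDeriv_add_add M.isOpen_dom 0 α i j M.pot_smooth M.pt_mem
    rw [zero_add] at this
    exact this.symm
  constructor
  · rintro ⟨h1, h2⟩
    refine ⟨h1, fun α j hα hα' => ?_⟩
    obtain ⟨β, i, rfl⟩ := exists_add_single (one_le_two.trans hα)
    rw [sum_add_single] at hα hα'
    rw [← key]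
    exact (h2 i j β (by omega) (by omega)).1
  · intro h
    refine ⟨h.1, fun i j α hα hα' => ⟨?_, ?_⟩⟩
    · rw [key]
      exact h.2 _ _ (by rw [sum_add_single]; omega) (by rw [sum_add_single]; omega)
    · rw [key']
      exact h.jet_eq_zero' _ _ (by rw [sum_add_single]; omega) (by rw [sum_add_single]; omega)

-- Factor g as C*C and take for B the complex conjugate of C⁻¹.
open scoped ComplexOrder in
theorem exists_pullback_eq_one {g : Matrix (Fin n) (Fin n) ℂ} (hg : g.PosDef) :
    ∃ B : Matrix (Fin n) (Fin n) ℂ, B.transpose * g * B.map (starRingEnd ℂ) = 1 ∧ IsUnit B := by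
  obtain ⟨C, hC⟩ : ∃ C : Matrix (Fin n) (Fin n) ℂ, g = C.conjTranspose * C := by
    open scoped MatrixOrder in
    exact CStarAlgebra.nonneg_iff_eq_star_mul_self.mp hg.posSemidef.nonneg
  have hdet : IsUnit C.det := by
    have h1 := (Matrix.isUnit_iff_isUnit_det _).mp hg.isUnit
    rw [hC, Matrix.det_mul] at h1
    exact isUnit_of_mul_isUnit_right h1
  have hCu : IsUnit C⁻¹ := (Matrix.isUnit_iff_isUnit_det _).mpr
    ((Matrix.isUnit_nonsing_inv_det_iff).mpr hdet)
  refine ⟨C⁻¹.map (starRingEnd ℂ), ?_, hCu.map (starRingEnd ℂ).mapMatrix⟩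
  have h1 : (C⁻¹.map (starRingEnd ℂ)).transpose = C⁻¹.conjTranspose := rfl
  have h2 : (C⁻¹.map (starRingEnd ℂ)).map (starRingEnd ℂ) = C⁻¹ := by
    ext i j
    simp
  rw [h1, h2, hC, ← Matrix.mul_assoc, ← Matrix.conjTranspose_mul, Matrix.mul_nonsing_inv _ hdet,
    Matrix.conjTranspose_one, Matrix.one_mul, Matrix.mul_nonsing_inv _ hdet]

theorem exists_chart_metric_one (M : KahlerChart n) :
    ∃ (M' : KahlerChart n) (φ : _), M'.IsCoordinateChange M φ ∧ M'.NormalBelow 2 := by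
  obtain ⟨B, hB, hBu⟩ := exists_pullback_eq_one (M.posDef _ M.pt_mem)
  set L : (Fin n → ℂ) →L[ℂ] (Fin n → ℂ) := LinearMap.toContinuousLinearMap (Matrix.toLin' B)
    with hL
  have hLB : linMatrix L = B := by
    ext i j
    change B.mulVec (Pi.single j 1) i = B i j
    simp
  have hder : ∀ x, HasFDerivAt (fun w => M.pt + L w) L x := fun x =>
    L.hasFDerivAt.const_add M.pt
  have hunit : IsUnit L := isUnit_of_linMatrix (by
    rw [hLB]
    exact ((Matrix.isUnit_iff_isUnit_det _).mp hBu).ne_zero)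
  obtain ⟨M', hpt, -, hφ⟩ := exists_pullback_chart M (φ := fun w => M.pt + L w) (p := 0)
    (fun x => (hder x).differentiableAt) (by simp) (by rw [(hder 0).fderiv]; exact hunit)
  -- For m = 2 no order satisfies 2 ≤ |α| < m, so only the value of the metric matters.
  refine ⟨M', _, hφ, ?_, fun α j h2 h2' => absurd h2 h2'.not_ge⟩
  rw [metric_eq_of_coordinateChange hφ M'.pt_mem, hφ.map_pt, (hder _).fderiv, hLB]
  exact hB

open scoped Classical in
/-- A holomorphic change of coordinates of order `m` changes the derivatives of order `m` of the
metric by the derivatives of the change of coordinates. -/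
theorem exists_chart_normal_step {M : KahlerChart n} {m : ℕ} (hm : 2 ≤ m) (hM : M.NormalBelow m) :
    ∃ (M' : KahlerChart n) (φ : _), M'.IsCoordinateChange M φ ∧ M'.NormalBelow (m + 1) := by
  -- The path of maps will add the derivatives of order m of `h` to the jet, so these are chosen to
  -- cancel the unwanted ones.
  obtain ⟨h, hh, hvan, htop⟩ := exists_holomorphic_jet M.pt m
    fun q γ => -M.jet γ (Pi.single q 1)
  set p := M.pt with hp
  set L : (Fin n → ℂ) →L[ℂ] (Fin n → ℂ) := 1 with hL
  have hLu : IsUnit L := isUnit_one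
  have hhd := hh.differentiableOn (s := univ)
  have hdom := mem_pathDom (W := M.dom) isOpen_univ hhd M.pt_mem (mem_univ p) hLu
    (fun q γ hγ => hvan q γ (hγ.trans_le hm))
  have hξ := pathVec_eq_zero M.isOpen_dom isOpen_univ hhd M.pt_mem (mem_univ p) hLu hm hvan
  set J : ℝ → (Fin n → ℕ) → (Fin n → ℕ) → ℂ := fun t α β =>
    mixedDeriv α β (fun y => M.pot (pathMap p p L h t y)) p with hJ
  have hη : ∀ (t : ℝ) (q : Fin n) (γ : Fin n → ℕ), ∑ i, γ i < m →
      mixedDeriv 0 γ (fun y => (starRingEnd ℂ) (pathVec L h t y q)) p = 0 := by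
    intro t q γ hγ
    rw [mixedDeriv_conj_pathVec M.isOpen_dom isOpen_univ hhd (hdom t), hξ t q γ hγ, map_zero]
  have hder : ∀ (t : ℝ) (ε : Type) (S T : Finset ε) (a b : ε → Fin n),
      HasDerivAt (fun s => J s (cnt S a) (cnt T b)) (jetVar (J t)
        (fun q γ => mixedDeriv γ 0 (fun y => pathVec L h t y q) p)
        (fun q γ => mixedDeriv 0 γ (fun y => (starRingEnd ℂ) (pathVec L h t y q)) p)
        S T a b) t := fun t ε S T a b =>
    hasDerivAt_path_jetVar M.isOpen_dom isOpen_univ hhd M.pot_smooth (hdom t) S T a b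
  have hmap0 : ∀ y, pathMap p p L h 0 y = y := by
    intro y
    simp [pathMap, hL]
  have hJ0 : ∀ α β, J 0 α β = M.jet α β := by
    intro α β
    simp only [hJ, hmap0]
    rfl
  have hmetric : ∀ t i j, J t (Pi.single i 1) (Pi.single j 1) = if i = j then 1 else 0 := by
    intro t i j
    rw [metric_const (fun t q γ hγ => hξ t q γ (hγ.trans_le hm))
      (fun t q γ hγ => hη t q γ (hγ.trans_le hm)) hder t 0, hJ0, M.jet_single, hM.1,
      Matrix.one_apply]
  -- With at most m unbarred labels and one barred label, only R = S can contribute: fewer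
  -- derivatives of the field vanish, and so do the barred ones, as 1 < m. The cofactor is the
  -- metric, which is the identity, and for L = 1 the derivatives of the field up to order m are
  -- those of `h`.
  have hvar : ∀ (t : ℝ) (ε : Type) (S : Finset ε) (τ : ε) (a b : ε → Fin n), S.card ≤ m →
      jetVar (J t) (fun q γ => mixedDeriv γ 0 (fun y => pathVec L h t y q) p)
        (fun q γ => mixedDeriv 0 γ (fun y => (starRingEnd ℂ) (pathVec L h t y q)) p)
        S {τ} a b = mixedDeriv (cnt S a) 0 (fun y => h y (b τ)) p := by
    intro t ε S τ a b hS
    rw [jetVar]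
    refine (congrArg₂ (· + ·) (Finset.sum_eq_single S ?_ ?_) (Finset.sum_eq_zero ?_)).trans ?_
    · intro R hR hne
      refine Finset.sum_eq_zero fun q _ => ?_
      rw [hξ, zero_mul]
      rw [sum_cnt]
      exact (Finset.card_lt_card ((Finset.mem_powerset.mp hR).ssubset_of_ne hne)).trans_le hS
    · intro hS
      exact absurd (Finset.mem_powerset_self S) hS
    · intro R hR
      refine Finset.sum_eq_zero fun q _ => ?_
      rw [hη, zero_mul]
      rw [sum_cnt]
      have := Finset.card_le_card (Finset.mem_powerset.mp hR)
      rw [Finset.card_singleton] at this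
      omega
    · simp only [Finset.sdiff_self, cnt_empty, zero_add, cnt_singleton, hmetric, mul_ite, mul_one,
        mul_zero, Finset.sum_ite_eq', Finset.mem_univ, if_true, add_zero]
      exact pathVec_jet M.isOpen_dom isOpen_univ hhd (hdom t) hLu hm hvan (cnt S a)
        (by rwa [sum_cnt]) (b τ)
  have hincr : ∀ (ε : Type) (S : Finset ε) (τ : ε) (a b : ε → Fin n), S.card ≤ m →
      J 1 (cnt S a) (cnt {τ} b) =
        J 0 (cnt S a) (cnt {τ} b) + mixedDeriv (cnt S a) 0 (fun y => h y (b τ)) p := by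
    intro ε S τ a b hS
    -- The rate of change does not depend on t, so this entry of the jet is affine in t.
    set c := mixedDeriv (cnt S a) 0 (fun y => h y (b τ)) p
    have h1 := eq_of_hasDerivAt_zero (f := fun t : ℝ => J t (cnt S a) (cnt {τ} b) - (t : ℂ) * c)
      (fun t => by
        have h2 := hder t ε S {τ} a b
        rw [hvar t ε S τ a b hS] at h2
        have h3 : HasDerivAt (fun t : ℝ => (t : ℂ) * c) (1 * c) t :=
          (Complex.ofRealCLM.hasDerivAt (x := t)).mul_const c
        exact (h2.sub h3).congr_deriv (by ring)) 1 0
    simp only [Complex.ofReal_one, Complex.ofReal_zero, one_mul, zero_mul, sub_zero] at h1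
    rw [← h1]
    ring
  have hpathd : ∀ w, HasFDerivAt (pathMap p p L h 1) (pathDeriv L h 1 w) w := fun w =>
    hasFDerivAt_pathMap isOpen_univ hhd 1 (mem_univ w)
  have hpp : pathMap p p L h 1 p = M.pt := by
    have h0 : h p = 0 := by
      ext q
      have := hvan q 0 (by simp; omega)
      rwa [mixedDeriv_zero] at this
    rw [pathMap, h0, sub_self, map_zero, smul_zero, add_zero, add_zero]
  obtain ⟨M', hpt, hpot, hφ⟩ := exists_pullback_chart M (φ := pathMap p p L h 1) (p := p)
    (fun w => (hpathd w).differentiableAt) hpp (by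
      rw [(hpathd p).fderiv]
      exact (hdom 1).2.2)
  have hJ1 : ∀ α β, M'.jet α β = J 1 α β := by
    intro α β
    rw [KahlerChart.jet, hpot, hpt]
  refine ⟨M', _, hφ, ?_, ?_⟩
  · ext i j
    rw [← M'.jet_single, hJ1, hmetric, Matrix.one_apply]
  · intro α j hα hα'
    obtain ⟨k, a, rfl⟩ := exists_cnt α
    rw [sum_cnt, Finset.card_univ, Fintype.card_fin] at hα hα'
    -- Any element can serve as the label of the single barred derivative; one exists because k ≥ 2.
    have h1 := hincr (Fin k) Finset.univ ⟨0, by omega⟩ a (fun _ => j) (by simp; omega)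
    rw [cnt_singleton, hJ0, ← hJ1] at h1
    rw [h1]
    rcases (Nat.lt_succ_iff.mp hα').lt_or_eq with hlt | heq
    · rw [hvan j _ (by rwa [sum_cnt, Finset.card_univ, Fintype.card_fin]),
        hM.2 _ j (by rwa [sum_cnt, Finset.card_univ, Fintype.card_fin])
          (by rwa [sum_cnt, Finset.card_univ, Fintype.card_fin]), add_zero]
    · rw [htop j _ (by rwa [sum_cnt, Finset.card_univ, Fintype.card_fin]), add_neg_cancel]

/-- Every chart is connected to a normal one by changes of coordinates. -/
theorem exists_normal_chart (M : KahlerChart n) (N : ℕ) :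
    ∃ M', Relation.ReflTransGen (fun M M' : KahlerChart n => ∃ φ, M'.IsCoordinateChange M φ) M M' ∧
      M'.IsNormal N := by
  simp only [KahlerChart.isNormal_iff]
  induction N with
  | zero =>
    obtain ⟨M', φ, h1, h2⟩ := exists_chart_metric_one M
    exact ⟨M', .single ⟨φ, h1⟩, h2⟩
  | succ N ih =>
    obtain ⟨M₁, h1, h2⟩ := ih
    obtain ⟨M', φ, h3, h4⟩ := exists_chart_normal_step (by omega) h2
    exact ⟨M', h1.tail ⟨φ, h3⟩, h4⟩

end Normal

end WeylGraph

namespace WeylGraph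

open MultiDigraph Set

/-! ### Canonical invariants -/

section Canonical

open scoped Classical

variable {n : ℕ}

theorem KahlerChart.IsNormal.mono {M : KahlerChart n} {N N' : ℕ} (h : M.IsNormal N) (hN : N' ≤ N) :
    M.IsNormal N' :=
  ⟨h.1, fun i j α h1 h2 => h.2 i j α h1 (h2.trans hN)⟩

theorem autCard_eq {G H : MultiDigraph} (i : Iso G H) : G.autCard = H.autCard := by
  rw [← card_iso i, ← card_iso i.symm]
  exact Nat.card_congr ⟨Iso.symm, Iso.symm, fun _ => rfl, fun _ => rfl⟩

/-- In normal coordinates the semistable graphs that are not stable vanish. -/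
theorem eval_eq_zero_of_normal {M : KahlerChart n} {H : MultiDigraph} (hH : H.Semistable)
    (hs : ¬ H.Stable) (hM : M.IsNormal (Fintype.card H.E)) : H.eval M = 0 := by
  rw [M.isNormal_iff] at hM
  rw [M.eval_eq, jetEval]
  obtain ⟨v, hv⟩ : ∃ v, H.inDeg v = 1 ∨ H.outDeg v = 1 := by
    by_contra! hc
    exact hs fun v => ⟨by have := (hc v).1; have := (hH v).1; omega,
      by have := (hc v).2; have := (hH v).2.1; omega⟩
  have h3 := (hH v).2.2
  refine Finset.sum_eq_zero fun a _ => Finset.sum_eq_zero fun b _ => ?_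
  rw [Finset.prod_eq_zero (Finset.mem_univ v), mul_zero]
  -- No degree exceeds the number of edges, so normality to the order |E| covers all derivatives at
  -- `v`.
  have hout := Finset.card_le_univ (outE H v)
  have hin := Finset.card_le_univ (inE H v)
  rw [← card_outE, ← card_inE] at h3 hv
  rcases hv with hv | hv
  · obtain ⟨e, he⟩ := Finset.card_eq_one.mp hv
    rw [he, cnt_singleton]
    exact hM.2 _ _ (by rw [sum_cnt]; omega) (by rw [sum_cnt]; omega)
  · obtain ⟨e, he⟩ := Finset.card_eq_one.mp hv
    rw [he, cnt_singleton]
    exact hM.jet_eq_zero' _ _ (by rw [sum_cnt]; omega) (by rw [sum_cnt]; omega)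

/-- Of the classes in the sum only that of G is stable, and its coefficient is 1. The order 3k
suffices for all other classes, because |V| ≤ 2k gives |E| ≤ 3k. -/
theorem finsum_classes_of_normal {G : MultiDigraph} (hG : G.Stable) {k : ℕ} (hk : G.weight = k)
    {M : KahlerChart n} (hM : M.IsNormal (3 * k)) :
    ∑ᶠ c ∈ stabilizableClasses G k, coefficient G (Quotient.out c) * (Quotient.out c).eval M =
      G.eval M := by
  rw [finsum_mem_eq_finite_toFinset_sum _ (classes_finite G k),
    Finset.sum_eq_single (Quotient.mk _ G : GraphClass)]
  · obtain ⟨i⟩ : Nonempty (Iso G (Quotient.out (Quotient.mk _ G : GraphClass))) :=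
      Setoid.symm (Quotient.mk_out G)
    rw [coefficient, (iso_card i).1, ← autCard_eq i, sub_self, zpow_zero, one_mul, div_self,
      one_mul, M.eval_eq, M.eval_eq, Iso.jetEval i]
    exact Nat.cast_ne_zero.mpr (autCard_ne_zero G)
  · intro c hc hne
    rw [Set.Finite.mem_toFinset, mem_classes] at hc
    obtain ⟨hst, hw⟩ := hc
    rw [eval_eq_zero_of_normal hst.1 (fun hstab => hne ?_), mul_zero]
    · refine hM.mono ?_
      have h1 := stab_card_le hst
      have h2 := card_of_weight hw
      omega
    · obtain ⟨i⟩ := iso_of_stable hstab hst.2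
      rw [← Quotient.out_eq c]
      exact Quotient.sound ⟨i⟩
  · intro h
    rw [Set.Finite.mem_toFinset] at h
    exact absurd ⟨G, rfl, hG.semistable, hk, hG, G, .refl, ⟨Iso.refl G⟩⟩ h

theorem finsum_classes_eq (G : MultiDigraph) (k : ℕ) (M : KahlerChart n) :
    ∑ᶠ c ∈ stabilizableClasses G k, coefficient G (Quotient.out c) * (Quotient.out c).eval M =
      (G.autCard : ℂ) * (-1) ^ Fintype.card G.V * totalInvariant G k M := by
  rw [totalInvariant, ← finsum_eq_totalEval]
  simp only [M.eval_eq]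

theorem invariant_of_reflTransGen {F : KahlerChart n → ℂ}
    (hF : ∀ (M' M : KahlerChart n) (φ : (Fin n → ℂ) → Fin n → ℂ),
      M'.IsCoordinateChange M φ → F M' = F M) {M M' : KahlerChart n}
    (h : Relation.ReflTransGen (fun M M' : KahlerChart n => ∃ φ, M'.IsCoordinateChange M φ) M M') :
    F M' = F M := by
  induction h with
  | refl => rfl
  | tail _ h ih =>
    obtain ⟨φ, hφ⟩ := h
    rw [hF _ _ φ hφ, ih]

end Canonical

end WeylGraph

/-! ### The theorem -/

theorem theorem3p5 (k : ℤ) (G : WeylGraph.MultiDigraph) (hG : G.Stable) (hk : G.weight = k) :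
    (WeylGraph.stabilizableClasses G k).Finite ∧
    ∀ (n : ℕ) (F : WeylGraph.KahlerChart n → ℂ),
      WeylGraph.IsCanonicalInvariant G F ↔
        ∀ M : WeylGraph.KahlerChart n,
          F M = ∑ᶠ c ∈ WeylGraph.stabilizableClasses G k,
            WeylGraph.coefficient G (Quotient.out c) * (Quotient.out c).eval M := by
  obtain ⟨k, hk'⟩ := WeylGraph.weight_nonneg_of_stable hG
  obtain rfl := hk'.symm.trans hk
  refine ⟨WeylGraph.classes_finite G k, fun n F => ⟨?_, ?_⟩⟩
  · rintro ⟨hinv, N, hN⟩ M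
    -- The order is large enough both for F to agree with G and for the sum to reduce to G;
    -- invariance carries the equality back to M.
    obtain ⟨M', hM', hnormal⟩ := WeylGraph.exists_normal_chart M (max N (3 * k))
    rw [← WeylGraph.invariant_of_reflTransGen hinv hM', hN M' (hnormal.mono (le_max_left _ _)),
      ← WeylGraph.finsum_classes_of_normal hG hk' (hnormal.mono (le_max_right _ _)),
      WeylGraph.finsum_classes_eq, WeylGraph.finsum_classes_eq]
    have h := WeylGraph.invariant_of_reflTransGen
      (fun _ _ _ h => WeylGraph.totalInvariant_coordinateChange G k h) hM'
    rw [h]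
  · intro hF
    refine ⟨fun M' M φ hφ => ?_, 3 * k, fun M hM => ?_⟩
    · rw [hF, hF, WeylGraph.finsum_classes_eq, WeylGraph.finsum_classes_eq,
        WeylGraph.totalInvariant_coordinateChange G k hφ]
    · rw [hF, WeylGraph.finsum_classes_of_normal hG hk' hM]
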